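/- **Setting.** Functions are complex-valued on $\mathbb R^+=(0,\infty)$, $\omega^a(x)=x^a$, $(f,g)_{\omega^a}=\int_0^\infty f\bar g\,x^a\,dx$, $\|f\|_{\omega^a}^2=(f,f)_{\omega^a}$, and $L^2_{\omega^a}$ is the corresponding weighted space (the weight is omitted if $a=0$). For $\mu>0$ let ${}_0I_x^{\mu}u(x)=\frac1{\Gamma(\mu)}\int_0^x(x-y)^{\mu-1}u(y)\,dy$. For $\lambda>0$ and $s\in[k-1,k)$, $k\in\{1,2,\dots\}$, the tempered fractional derivative of a function $u$ that is integrable on bounded intervals is ${}_0D_x^{s,\lambda}u=e^{-\lambda x}\frac{d^k}{dx^k}\,{}_0I_x^{k-s}\{e^{\lambda x}u\}$, with the $k$-th derivative in the weak (locally absolutely continuous) sense on $(0,\infty)$. For $N\in\mathbb N_0$ let $\mathcal F_N^{\nu,\lambda}=\{x^{\nu}e^{-\lambda x}p(x): p \text{ a polynomial of degree at most } N\}$. Let $k\ge1$ be an integer and $s\in[k-1,k)$. For $\lambda>0$ and $f\in L^2(\mathbb R^+)$ let $u$ be a solution of $${}_0D_x^{s,\lambda}u=f\ \text{ on }\mathbb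 R^+,\qquad u^{(j)}(0)=0,\quad j=0,1,\dots,k-1,$$ where the $u^{(j)}(0)$ are one-sided derivatives and $u$ is continuous from the right at $0$. For $N\in\mathbb N_0$ let $u_N\in\mathcal F_N^{s,\lambda}$ be a solution of the Petrov–Galerkin scheme $$({}_0D_x^{s,\lambda}u_N,v)=(f,v)\qquad\text{for all }v\in\mathcal F_N^{0,\lambda}.$$ **Theorem.** 1. $u\in L^2_{\omega^{-s}}$, and $u_N$ is the $L^2_{\omega^{-s}}$-orthogonal projection of $u$ to $\mathcal F_N^{s,\lambda}$: $(u_N-u,w)_{\omega^{-s}}=0$ for all $w\in\mathcal F_N^{s,\lambda}$. 2. For every $m\in\mathbb N_0$ there are constants $c=c_N$, depending only on $s$, $m$ and $N$, with $c_N\to1$ as $N\to\infty$, such that the following holds for all $\lambda>0$, all $N\ge1$ with $m\le N+1$, and all $f,u,u_N$ as above: if ${}_0D_x^{m,\lambda}f$ exists and belongs to $L^2_{\omega^m}$, then ${}_0D_x^{s+m,\lambda}u={}_0D_x^{m,\lambda}f$ and $$\|u-u_N\|_{\omega^{-s}}\le c_N(2\lambda N)^{-\frac{s+m}2}\|{}_0D_x^{s+m,\lambda}u\|_{\omega^m}=c_N(2\lambda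 N)^{-\frac{s+m}2}\|{}_0D_x^{m,\lambda}f\|_{\omega^m}.$$ -/

import Mathlib

open MeasureTheory Set Filter Topology Polynomial

noncomputable section

/-- The measure `x ^ a dx` on the half line `(0, ∞)`. -/
def halfLineWeight (a : ℝ) : Measure ℝ :=
  (volume.restrict (Ioi (0 : ℝ))).withDensity fun x => ENNReal.ofReal (x ^ a)

/-- Membership in the weighted space `L²((0, ∞), x ^ a dx)`. -/
def MemWeightedL2 (a : ℝ) (u : ℝ → ℂ) : Prop :=
  MemLp u 2 (halfLineWeight a)

/-- The inner product `∫ u conj(v) x ^ a dx` over `(0, ∞)`. -/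
def weightedInner (a : ℝ) (u v : ℝ → ℂ) : ℂ :=
  ∫ x, u x * (starRingEnd ℂ) (v x) ∂(halfLineWeight a)

/-- The norm of `L²((0, ∞), x ^ a dx)`. -/
def weightedNorm (a : ℝ) (u : ℝ → ℂ) : ℝ :=
  (eLpNorm u 2 (halfLineWeight a)).toReal

/-- The left Riemann-Liouville fractional integral of order `μ > 0` with base point `0`. -/
def rlIntegral (μ : ℝ) (u : ℝ → ℂ) (x : ℝ) : ℂ :=
  ((Real.Gamma μ)⁻¹ : ℝ) • ∫ y in (0 : ℝ)..x, ((x - y) ^ (μ - 1) : ℝ) • u y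

/-- `G` is the `k`-th derivative of `F` on `(0, ∞)`, in the sense of locally absolutely continuous
functions (equivalently, in the weak sense): up to null sets `F = w 0`, `G = w k`, and each `w j`
with `j < k` is a primitive of the locally integrable function `w (j + 1)`. -/
def HasACDeriv (k : ℕ) (F G : ℝ → ℂ) : Prop :=
  ∃ w : ℕ → ℝ → ℂ,
    w 0 =ᵐ[volume.restrict (Ioi (0 : ℝ))] F ∧
    w k =ᵐ[volume.restrict (Ioi (0 : ℝ))] G ∧
    ∀ j < k, LocallyIntegrableOn (w (j + 1)) (Ioi (0 : ℝ)) ∧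
      ∀ a b : ℝ, 0 < a → a ≤ b → w j b - w j a = ∫ t in a..b, w (j + 1) t

/-- `G` is the left Riemann-Liouville derivative of order `s ≥ 0` of `F` on `(0, ∞)`: with
`k = ⌊s⌋ + 1`, so that `k - 1 ≤ s < k`, it is the `k`-th derivative of the fractional integral of
order `k - s` of the function `F`, which is integrable on bounded intervals. -/
def HasRLDeriv (s : ℝ) (F G : ℝ → ℂ) : Prop :=
  LocallyIntegrableOn F (Ici (0 : ℝ)) ∧
    HasACDeriv (⌊s⌋₊ + 1) (rlIntegral ((⌊s⌋₊ + 1 : ℝ) - s) F) G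

/-- `g` is the left tempered fractional derivative of `u` of order `s ≥ 0` on `(0, ∞)`:
`g = e^{-lam x} D^s {e^{lam x} u}` with the Riemann-Liouville derivative `D^s`. -/
def HasTemperedDeriv (s lam : ℝ) (u g : ℝ → ℂ) : Prop :=
  HasRLDeriv s (fun x => (Real.exp (lam * x) : ℂ) * u x) (fun x => (Real.exp (lam * x) : ℂ) * g x)

/-- `u` is continuous at `0` from the right, and the one-sided derivatives `u^{(j)}(0)` with
`j < k` exist and vanish. Here `v j` is the `j`-th derivative of `u`, which has to exist close
to `0` when `j + 1 < k`, and at `0` itself when `j + 1 = k`. -/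
def ZeroInitialData (k : ℕ) (u : ℝ → ℂ) : Prop :=
  ContinuousWithinAt u (Ici (0 : ℝ)) 0 ∧
  ∃ v : ℕ → ℝ → ℂ, v 0 = u ∧
    (∀ j, j + 2 < k → ∀ᶠ x in 𝓝[≥] (0 : ℝ), HasDerivWithinAt (v j) (v (j + 1) x) (Ici (0 : ℝ)) x) ∧
    (∀ j, j + 1 < k → HasDerivWithinAt (v j) (v (j + 1) 0) (Ici (0 : ℝ)) 0) ∧
    ∀ j < k, v j 0 = 0

/-- `u` solves the initial value problem of order `s`, where `k - 1 ≤ s < k`, with right-hand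
side `f`. -/
def SolvesTemperedIVP (k : ℕ) (s lam : ℝ) (f u : ℝ → ℂ) : Prop :=
  HasTemperedDeriv s lam u f ∧ ZeroInitialData k u

/-- Membership in the space of the functions `x ^ ν e^{-lam x} p(x)` on `(0, ∞)`, where `p` is a
polynomial of degree at most `N`. -/
def MemGLFSpace (ν lam : ℝ) (N : ℕ) (w : ℝ → ℂ) : Prop :=
  ∃ p : ℂ[X], p.natDegree ≤ N ∧
    ∀ x : ℝ, 0 < x → w x = ((x ^ ν * Real.exp (-lam * x) : ℝ) : ℂ) * p.eval (x : ℂ)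

/-- `uN` is a solution of the Petrov-Galerkin scheme: it lies in the trial space, and its tempered
derivative `d` of order `s` has `(d, v) = (f, v)` for all `v` in the test space. -/
def SolvesPetrovGalerkin (s lam : ℝ) (N : ℕ) (f uN : ℝ → ℂ) : Prop :=
  MemGLFSpace s lam N uN ∧
  ∃ d : ℝ → ℂ, HasTemperedDeriv s lam uN d ∧
    ∀ v : ℝ → ℂ, MemGLFSpace 0 lam N v → weightedInner 0 d v = weightedInner 0 f v

/-- `uN` is the orthogonal projection of `u` in `L²((0, ∞), x ^ (-ν) dx)` to the space of the
functions `x ^ ν e^{-lam x} p(x)` with `deg p ≤ N`. -/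
def IsGLFProjection (ν lam : ℝ) (N : ℕ) (u uN : ℝ → ℂ) : Prop :=
  MemWeightedL2 (-ν) u ∧ MemWeightedL2 (-ν) uN ∧ MemGLFSpace ν lam N uN ∧
    ∀ w : ℝ → ℂ, MemGLFSpace ν lam N w → weightedInner (-ν) (fun x => uN x - u x) w = 0

end

/-! Write T f = e^{-λx} I^s(e^{λx} f) (`temperedIntegral`). By the semigroup law of fractional
integrals, I^{k-s}(e^{λx}u) and I^k(e^{λx}f) have the same k-th derivative. They differ by a
polynomial of degree < k, which the zero initial data force to be o(x^{k-1}) at 0, so it vanishes.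
Hence u = T f almost everywhere (`SolvesTemperedIVP.ae_eq_temperedIntegral`). A Schur-type estimate
of the kernel shows that T maps L² to L² with weight x^{-s}.

Projection. The weight x^{-s} cancels the factor x^s of a trial function: (T f, x^s e^{-λx} q) = ∫ T
f · e^{-λx} q = ∫ f · e^{-λx} A q for real q, where the adjoint A (`adjointPoly`) acts on
polynomials and does not raise degrees. As u_N is likewise T of its own derivative, the scheme
tested with e^{-λx} A q says that u_N - u is orthogonal to x^s e^{-λx} q.

Error. T(e^{-λx} p) = x^s e^{-λx} B p with B = `trialPoly` diagonal in the monomials. The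
composition A B is triangular, and symmetric for the form ∫ p q e^{-2λx}. Such a map has the
orthogonal polynomials p_n of the form as eigenvectors, with its diagonal entries as eigenvalues
(`IsTriangular.eq_smul_of_symmetric`); here these are σ_n = (2λ)^{-s} n!/Γ(n+1+s). The same argument
for q ↦ e^{2λx} (-d/dx)^m (e^{-2λx} x^m q^{(m)}) gives τ_n = (2λ)^m n!/(n-m)!, without any explicit
Laguerre identity.

Consequently φ_n = x^s e^{-λx} B p_n and ψ_n = e^{-λx} p_n^{(m)} are orthogonal families for the
weights x^{-s} and x^m. Their squared norms are σ_n h_n and τ_n h_n with h_n = ∫ p_n² e^{-2λx}.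
Moreover (u, φ_n) = σ_n (f, e^{-λx} p_n), and by parts (g, ψ_n) = τ_n (f, e^{-λx} p_n), where g is
the m-th tempered derivative of f. So the coefficient of u - u_N at φ_n is 0 for n ≤ N and
(σ_n/τ_n)(g, ψ_n) for n > N. The φ_n are complete, because a density with exponential decay is
determined by its moments, and therefore ‖u - u_N‖² ≤ sup_{n>N} (σ_n/τ_n) ‖g‖². The quotient is
nonincreasing in n; its value at N+1 is (2λ)^{-(s+m)} (N+1-m)!/Γ(N+2+s), asymptotic to
(2λN)^{-(s+m)}. -/

/-! ### Comparison of norms through orthogonal families -/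

theorem norm_sq_finsupp_sum_smul {V : Type*} [NormedAddCommGroup V] [InnerProductSpace ℂ V]
    (χ : ℕ → V) (hχ : ∀ i j, i ≠ j → inner ℂ (χ i) (χ j) = 0) (b : ℕ →₀ ℂ) :
    ‖b.sum fun n c => c • χ n‖ ^ 2 = ∑ n ∈ b.support, ‖b n‖ ^ 2 * ‖χ n‖ ^ 2 := by
  have : ((‖b.sum fun n c => c • χ n‖ : ℝ) : ℂ) ^ 2 =
      ((∑ n ∈ b.support, ‖b n‖ ^ 2 * ‖χ n‖ ^ 2 : ℝ) : ℂ) := by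
    refine (inner_self_eq_norm_sq_to_K (𝕜 := ℂ) (b.sum fun n c => c • χ n)).symm.trans ?_
    rw [Finsupp.sum, sum_inner]
    push_cast
    refine Finset.sum_congr rfl fun n hn => ?_
    rw [inner_sum, Finset.sum_eq_single n]
    · rw [inner_smul_left, inner_smul_right, ← mul_assoc, inner_self_eq_norm_sq_to_K (𝕜 := ℂ),
        ← Complex.normSq_eq_conj_mul_self, Complex.normSq_eq_norm_sq]
      push_cast; rfl
    · intro m _ hm
      rw [inner_smul_left, inner_smul_right, hχ n m hm.symm]; simp
    · intro hn'; exact absurd hn hn'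
  exact_mod_cast this

/-- If `φ` is an orthogonal family with dense span, and the coefficients of `e` with respect to `φ`
are controlled by those of `g` with respect to an orthogonal family `ψ`, then `‖e‖` is controlled
by `‖g‖`. -/
theorem norm_le_of_inner_eq_mul_inner {E G : Type*} [NormedAddCommGroup E] [InnerProductSpace ℂ E]
    [NormedAddCommGroup G] [InnerProductSpace ℂ G] (φ : ℕ → E) (ψ : ℕ → G)
    (hφ : ∀ i j, i ≠ j → inner ℂ (φ i) (φ j) = 0) (hψ : ∀ i j, i ≠ j → inner ℂ (ψ i) (ψ j) = 0)
    (hd : Dense (Submodule.span ℂ (range φ) : Set E)) (e : E) (g : G) (r : ℕ → ℝ) (κ : ℝ)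
    (hκ : 0 ≤ κ) (h : ∀ n, inner ℂ (φ n) e = (r n : ℂ) * inner ℂ (ψ n) g)
    (hr : ∀ n, r n ^ 2 * ‖ψ n‖ ^ 2 ≤ κ ^ 2 * ‖φ n‖ ^ 2) : ‖e‖ ≤ κ * ‖g‖ := by
  have key : ∀ w ∈ (Submodule.span ℂ (range φ) : Set E), ‖inner ℂ w e‖ ≤ κ * ‖g‖ * ‖w‖ := by
    intro w hw
    obtain ⟨b, rfl⟩ := Finsupp.mem_span_range_iff_exists_finsupp.1 hw
    -- Moving the real factors r n onto ψ n turns the pairing of e with Σ b_n φ_n into the pairing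
    -- of g with Σ b_n r_n ψ_n. By orthogonality the latter vector has at most κ times the norm of
    -- the former, so Cauchy–Schwarz bounds e on the dense span.
    let ψ' : ℕ → G := fun n => (r n : ℂ) • ψ n
    have h1 : inner ℂ (b.sum fun n c => c • φ n) e = inner ℂ (b.sum fun n c => c • ψ' n) g := by
      rw [Finsupp.sum, Finsupp.sum, sum_inner, sum_inner]
      refine Finset.sum_congr rfl fun n _ => ?_
      simp only [ψ', inner_smul_left, h n, Complex.conj_ofReal]
    have h2 : ‖b.sum fun n c => c • ψ' n‖ ≤ κ * ‖b.sum fun n c => c • φ n‖ := by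
      refine le_of_sq_le_sq ?_ (by positivity)
      rw [mul_pow, norm_sq_finsupp_sum_smul φ hφ, norm_sq_finsupp_sum_smul ψ' (fun i j hij => by
        simp only [ψ', inner_smul_left, inner_smul_right, hψ i j hij, mul_zero]), Finset.mul_sum]
      refine Finset.sum_le_sum fun n _ => ?_
      have : ‖ψ' n‖ ^ 2 = r n ^ 2 * ‖ψ n‖ ^ 2 := by
        simp [ψ', norm_smul, mul_pow]
      rw [this]
      nlinarith [hr n, sq_nonneg ‖b n‖, mul_le_mul_of_nonneg_left (hr n) (sq_nonneg ‖b n‖)]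
    rw [h1]
    calc _ ≤ _ := norm_inner_le_norm _ _
      _ ≤ _ := by nlinarith [norm_nonneg g]
  have hcl : ∀ w : E, ‖inner ℂ w e‖ ≤ κ * ‖g‖ * ‖w‖ := by
    have hc : IsClosed {w : E | ‖inner ℂ w e‖ ≤ κ * ‖g‖ * ‖w‖} :=
      isClosed_le (by fun_prop) (by fun_prop)
    intro w
    exact hc.closure_subset_iff.2 key (hd w)
  have := hcl e
  rw [inner_self_eq_norm_sq_to_K (𝕜 := ℂ)] at this
  simp only [norm_pow, Complex.norm_real, norm_norm, Complex.coe_algebraMap] at this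
  by_contra! hlt
  have h0 : 0 < ‖e‖ := lt_of_le_of_lt (by positivity) hlt
  nlinarith

/-! ### Asymptotics of the error constant -/

theorem prod_add_range_mul_Gamma {s : ℝ} (hs : 0 < s) (n : ℕ) :
    (∏ j ∈ Finset.range n, (s + j)) * Real.Gamma s = Real.Gamma (s + n) := by
  induction n with
  | zero => simp
  | succ n ih =>
    rw [Finset.prod_range_succ, mul_right_comm, ih, Nat.cast_succ, ← add_assoc,
      Real.Gamma_add_one (by positivity), mul_comm]

/-- `Γ(n + s + 1) ∼ n! n ^ s`. -/
theorem tendsto_rpow_mul_factorial_div_Gamma {s : ℝ} (hs : 0 ≤ s) :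
    Tendsto (fun n : ℕ => (n : ℝ) ^ s * n.factorial / Real.Gamma (n + s + 1)) atTop (𝓝 1) := by
  rcases hs.eq_or_lt with rfl | hs
  · refine tendsto_const_nhds.congr fun n => ?_
    rw [Real.rpow_zero, add_zero, Real.Gamma_nat_eq_factorial, one_mul, div_self]
    exact_mod_cast n.factorial_ne_zero
  have h := (Real.GammaSeq_tendsto_Gamma s).div_const (Real.Gamma s)
  rw [div_self (Real.Gamma_pos_of_pos hs).ne'] at h
  refine h.congr fun n => ?_
  rw [Real.GammaSeq, div_div, prod_add_range_mul_Gamma hs]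
  congr 2
  push_cast; ring

/-- The constant of the error estimate. -/
noncomputable def errorConst (s : ℝ) (m N : ℕ) : ℝ :=
  Real.sqrt ((N : ℝ) ^ (s + m) * (N + 1 - m).factorial / Real.Gamma (N + 2 + s))

/-- Once n ≥ m + 1, the radicand is the product of n^s n!/Γ(n+s+1), (n+1)/(n+s+1) and n^m divided by
the falling factorial of n+1 of length m; each factor tends to 1. -/
theorem tendsto_errorConst {s : ℝ} (hs : 0 ≤ s) (m : ℕ) :
    Tendsto (errorConst s m) atTop (𝓝 1) := by
  have h1 := tendsto_rpow_mul_factorial_div_Gamma hs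
  have h2 : Tendsto (fun n : ℕ => ((n : ℝ) + 1) / (n + s + 1)) atTop (𝓝 1) := by
    have : Tendsto (fun n : ℕ => 1 - s / (n + (s + 1))) atTop (𝓝 (1 - 0)) :=
      tendsto_const_nhds.sub (Tendsto.div_atTop tendsto_const_nhds
        (tendsto_atTop_add_const_right _ _ tendsto_natCast_atTop_atTop))
    rw [sub_zero] at this
    refine this.congr fun n => ?_
    have : (n : ℝ) + s + 1 ≠ 0 := by positivity
    rw [← add_assoc]; field_simp; ring
  have h3 : Tendsto (fun n : ℕ => (n : ℝ) ^ m / (n + 1).descFactorial m) atTop (𝓝 1) := by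
    have ha : Tendsto (fun n : ℕ => ((n + 1 : ℕ) : ℝ) ^ m / (n + 1).descFactorial m) atTop (𝓝 1) := by
      have := (isEquivalent_descFactorial m).symm
      rw [Asymptotics.isEquivalent_iff_tendsto_one] at this
      · exact (tendsto_add_atTop_iff_nat 1).2 this
      · filter_upwards [eventually_ge_atTop m] with n hn
        have := Nat.pow_sub_lt_descFactorial (n := n) (k := m)
        intro h0
        have : n.descFactorial m = 0 := by exact_mod_cast h0
        rw [Nat.descFactorial_eq_zero_iff_lt] at this
        omega
    have hb : Tendsto (fun n : ℕ => ((n : ℝ) / (n + 1)) ^ m) atTop (𝓝 (1 ^ m)) :=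
      (tendsto_natCast_div_add_atTop 1).pow m
    rw [one_pow] at hb
    have hc := ha.mul hb
    rw [one_mul] at hc
    refine hc.congr fun n => ?_
    have : (n : ℝ) + 1 ≠ 0 := by positivity
    rw [div_pow]; push_cast; field_simp
  have h4 := ((h1.mul h2).mul h3).sqrt
  rw [one_mul, one_mul, Real.sqrt_one] at h4
  refine h4.congr' ?_
  filter_upwards [eventually_ge_atTop (m + 1)] with n hn
  rw [errorConst]
  congr 1
  have hn0 : (0 : ℝ) < n := by exact_mod_cast (show 0 < n by omega)
  have e1 : ((n + 1 - m).factorial : ℝ) * (n + 1).descFactorial m = (n + 1).factorial := by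
    exact_mod_cast Nat.factorial_mul_descFactorial (show m ≤ n + 1 by omega)
  have e2 : Real.Gamma (n + 2 + s) = (n + s + 1) * Real.Gamma (n + s + 1) := by
    rw [← Real.Gamma_add_one (by positivity)]; congr 1; ring
  have e3 : ((n + 1).descFactorial m : ℝ) ≠ 0 := by
    simp only [ne_eq, Nat.cast_eq_zero, Nat.descFactorial_eq_zero_iff_lt]; omega
  have e4 : Real.Gamma (n + s + 1) ≠ 0 := (Real.Gamma_pos_of_pos (by positivity)).ne'
  have e5 : ((n + 1).factorial : ℝ) = (n + 1) * n.factorial := by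
    rw [Nat.factorial_succ]; push_cast; ring
  rw [e2, Real.rpow_add hn0, Real.rpow_natCast]
  have e6 : ((n + 1 - m).factorial : ℝ) = (n + 1) * n.factorial / (n + 1).descFactorial m := by
    rw [eq_div_iff e3, e1, e5]
  rw [e6]
  have : (n : ℝ) + s + 1 ≠ 0 := by positivity
  field_simp

/-! ### Triangular operators on polynomials -/

/-- The linear map `S` on polynomials is triangular with diagonal `σ` in the monomial basis. -/
def IsTriangular (S : ℝ[X] →ₗ[ℝ] ℝ[X]) (σ : ℕ → ℝ) : Prop :=
  ∀ n, S (X ^ n) - σ n • X ^ n ∈ degreeLT ℝ n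

theorem X_pow_mem_degreeLT {i n : ℕ} (h : i < n) : (X ^ i : ℝ[X]) ∈ degreeLT ℝ n := by
  rw [mem_degreeLT, degree_X_pow]; exact_mod_cast h

theorem IsTriangular.map_mem {S : ℝ[X] →ₗ[ℝ] ℝ[X]} {σ : ℕ → ℝ} (h : IsTriangular S σ) {n : ℕ}
    {p : ℝ[X]} (hp : p ∈ degreeLT ℝ n) : S p ∈ degreeLT ℝ n := by
  classical
  suffices degreeLT ℝ n ≤ (degreeLT ℝ n).comap S from this hp
  conv_lhs => rw [degreeLT_eq_span_X_pow]
  rw [Submodule.span_le]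
  intro q hq
  simp only [Finset.coe_image, Finset.coe_range, mem_image, mem_Iio] at hq
  obtain ⟨i, hi, rfl⟩ := hq
  have h1 := degreeLT_mono hi.le (h i)
  have h2 := (degreeLT ℝ n).add_mem h1 ((degreeLT ℝ n).smul_mem (σ i) (X_pow_mem_degreeLT hi))
  simpa using h2

theorem IsTriangular.map_sub_mem {S : ℝ[X] →ₗ[ℝ] ℝ[X]} {σ : ℕ → ℝ} (h : IsTriangular S σ) {n : ℕ}
    {p : ℝ[X]} (hp : p - X ^ n ∈ degreeLT ℝ n) : S p - σ n • p ∈ degreeLT ℝ n := by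
  have h1 := h.map_mem hp
  have h2 := (degreeLT ℝ n).smul_mem (σ n) hp
  have := (degreeLT ℝ n).sub_mem ((degreeLT ℝ n).add_mem h1 (h n)) h2
  convert this using 1
  rw [map_sub, smul_sub]; abel

theorem IsTriangular.comp {S S' : ℝ[X] →ₗ[ℝ] ℝ[X]} {σ σ' : ℕ → ℝ} (h : IsTriangular S σ)
    (h' : IsTriangular S' σ') : IsTriangular (S ∘ₗ S') fun n => σ n * σ' n := by
  intro n
  have := (degreeLT ℝ n).add_mem (h.map_mem (h' n)) ((degreeLT ℝ n).smul_mem (σ' n) (h n))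
  convert this using 1
  rw [LinearMap.comp_apply, map_sub, map_smul, smul_sub, smul_smul, mul_comm]; abel

theorem IsTriangular.pow {S : ℝ[X] →ₗ[ℝ] ℝ[X]} {σ : ℕ → ℝ} (h : IsTriangular S σ) (m : ℕ) :
    IsTriangular (S ^ m) fun n => σ n ^ m := by
  induction m with
  | zero => intro n; simp
  | succ m ih =>
    have := ih.comp h
    simp only [pow_succ]
    exact this

/-- A triangular map that is symmetric for a definite form has the orthogonal polynomials of the
form as eigenvectors. -/
theorem IsTriangular.eq_smul_of_symmetric {S : ℝ[X] →ₗ[ℝ] ℝ[X]} {σ : ℕ → ℝ} (h : IsTriangular S σ)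
    (ℓ : ℝ[X] →ₗ[ℝ] ℝ) (hℓ : ∀ p, ℓ (p * p) = 0 → p = 0)
    (hS : ∀ p q, ℓ (S p * q) = ℓ (p * S q)) {n : ℕ} {p : ℝ[X]} (hp : p - X ^ n ∈ degreeLT ℝ n)
    (horth : ∀ q ∈ degreeLT ℝ n, ℓ (p * q) = 0) : S p = σ n • p := by
  have h1 := h.map_sub_mem hp
  -- The defect r = S p - σ_n p has degree < n, and so has S r. Hence ℓ(r r) = ℓ(p · S r) - σ_n ℓ(p
  -- r) = 0, and definiteness gives r = 0.
  rw [← sub_eq_zero]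
  apply hℓ
  set q := S p - σ n • p with hq
  conv_lhs => rw [hq]
  rw [sub_mul, map_sub, hS, horth _ (h.map_mem h1), smul_mul_assoc, map_smul, horth _ h1]
  simp

/-! ### Orthogonal polynomials for e^{-2λx} -/

/-- The operator `2 lam - d/dx`, with `(e^{-2 lam x} q)' = - e^{-2 lam x} (expDual lam q)`. -/
noncomputable def expDual (lam : ℝ) : ℝ[X] →ₗ[ℝ] ℝ[X] :=
  (2 * lam) • LinearMap.id - derivative

theorem expDual_apply (lam : ℝ) (q : ℝ[X]) :
    expDual lam q = (2 * lam) • q - derivative q := rfl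

theorem derivative_X_pow_mem (n : ℕ) : derivative (X ^ n : ℝ[X]) ∈ degreeLT ℝ n := by
  rcases n with _ | n
  · simp
  · rw [derivative_X_pow, ← smul_eq_C_mul]
    exact Submodule.smul_mem _ _ (X_pow_mem_degreeLT (by simp))

theorem isTriangular_expDual (lam : ℝ) : IsTriangular (expDual lam) fun _ => 2 * lam := by
  intro n
  have : expDual lam (X ^ n) - (2 * lam) • X ^ n = -derivative (X ^ n) := by
    rw [expDual_apply]; abel
  rw [this]
  exact Submodule.neg_mem _ (derivative_X_pow_mem n)

/-- Each application of the operator lowers the order of the zero at 0 by at most one. This makes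
the boundary terms at 0 vanish in repeated integrations by parts. -/
theorem X_pow_dvd_expDual_pow (lam : ℝ) (q : ℝ[X]) (i j : ℕ) :
    X ^ j ∣ (expDual lam ^ i) (X ^ (j + i) * q) := by
  induction i generalizing q with
  | zero => simp
  | succ i ih =>
    have : expDual lam (X ^ (j + (i + 1)) * q) =
        X ^ (j + i) * ((2 * lam) • (X * q) - ((j + i + 1 : ℕ) : ℝ) • q - X * derivative q) := by
      rw [expDual_apply, derivative_mul, ← add_assoc, derivative_X_pow]
      simp only [smul_eq_C_mul, Nat.add_sub_cancel]
      simp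
      ring
    rw [pow_succ, Module.End.mul_apply, this]
    exact ih _

/-- The functional `p ↦ ∫ e^{-2 lam x} p(x) dx` over `(0, ∞)`. -/
noncomputable def expMoment (lam : ℝ) : ℝ[X] →ₗ[ℝ] ℝ :=
  Polynomial.lsum fun n => ((n.factorial : ℝ) * (1 / (2 * lam)) ^ (n + 1)) • LinearMap.id

theorem expMoment_X_pow (lam : ℝ) (n : ℕ) :
    expMoment lam (X ^ n) = n.factorial * (1 / (2 * lam)) ^ (n + 1) := by
  rw [expMoment, Polynomial.lsum_apply, ← monomial_one_right_eq_X_pow,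
    Polynomial.sum_monomial_index _ _ (by simp)]
  simp

theorem integrableOn_pow_mul_exp {r : ℝ} (hr : 0 < r) (n : ℕ) :
    IntegrableOn (fun x : ℝ => x ^ n * Real.exp (-(r * x))) (Ioi 0) := by
  have := integrableOn_rpow_mul_exp_neg_mul_rpow (p := 1) (s := n) (b := r)
    (by have : (0 : ℝ) ≤ n := n.cast_nonneg
        linarith) one_pos hr
  refine this.congr_fun (fun x _ => ?_) measurableSet_Ioi
  simp

theorem integral_pow_mul_exp {r : ℝ} (hr : 0 < r) (n : ℕ) :
    ∫ x in Ioi (0 : ℝ), x ^ n * Real.exp (-(r * x)) = n.factorial * (1 / r) ^ (n + 1) := by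
  have := Real.integral_rpow_mul_exp_neg_mul_Ioi (a := n + 1) (r := r) (by positivity) hr
  rw [Real.Gamma_nat_eq_factorial] at this
  rw [mul_comm, ← Real.rpow_natCast (1 / r)]
  push_cast
  rw [← this]
  refine setIntegral_congr_fun measurableSet_Ioi fun x _ => ?_
  simp

theorem integrableOn_eval_mul_exp {r : ℝ} (hr : 0 < r) (p : ℝ[X]) :
    IntegrableOn (fun x : ℝ => p.eval x * Real.exp (-(r * x))) (Ioi 0) := by
  induction p using Polynomial.induction_on' with
  | add p q hp hq => 
    simp only [eval_add, add_mul]; exact hp.add hq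
  | monomial n a =>
    simp only [eval_monomial, mul_assoc]
    exact (integrableOn_pow_mul_exp hr n).const_mul a

theorem expMoment_eq_integral {lam : ℝ} (hl : 0 < lam) (p : ℝ[X]) :
    expMoment lam p = ∫ x in Ioi (0 : ℝ), p.eval x * Real.exp (-(2 * lam * x)) := by
  induction p using Polynomial.induction_on' with
  | add p q hp hq =>
    simp only [eval_add, add_mul, map_add]
    rw [integral_add (integrableOn_eval_mul_exp (by positivity) p)
      (integrableOn_eval_mul_exp (by positivity) q), hp, hq]
  | monomial n a =>
    rw [← C_mul_X_pow_eq_monomial, ← smul_eq_C_mul, map_smul, expMoment_X_pow]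
    simp only [eval_smul, eval_pow, eval_X, smul_eq_mul, mul_assoc]
    rw [integral_const_mul]
    simp only [← mul_assoc]
    rw [integral_pow_mul_exp (by positivity)]
    ring

/-- The fundamental theorem of calculus for e^{-2λx} q, checked on monomials with the explicit
moments. -/
theorem expMoment_expDual {lam : ℝ} (hl : 0 < lam) (q : ℝ[X]) :
    expMoment lam (expDual lam q) = q.eval 0 := by
  induction q using Polynomial.induction_on' with
  | add p q hp hq => rw [map_add, map_add, hp, hq, eval_add]
  | monomial n a =>
    rw [← C_mul_X_pow_eq_monomial, ← smul_eq_C_mul, map_smul, map_smul, eval_smul, expDual_apply,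
      map_sub, map_smul, expMoment_X_pow]
    rcases n with _ | n
    · simp; field_simp
    · rw [derivative_X_pow, ← smul_eq_C_mul, map_smul, Nat.add_sub_cancel, expMoment_X_pow,
        Nat.factorial_succ]
      simp only [eval_pow, eval_X, smul_eq_mul, Nat.cast_mul, Nat.cast_succ]
      rw [zero_pow n.succ_ne_zero, mul_zero]
      have : 2 * lam * (1 / (2 * lam)) = 1 := by field_simp
      linear_combination (a * (n + 1) * n.factorial * (1 / (2 * lam)) ^ (n + 1)) * this

theorem expMoment_mul_expDual {lam : ℝ} (hl : 0 < lam) (p q : ℝ[X]) (hq : q.eval 0 = 0) :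
    expMoment lam (p * expDual lam q) = expMoment lam (derivative p * q) := by
  have h := expMoment_expDual hl (p * q)
  have e : p * expDual lam q = expDual lam (p * q) + derivative p * q := by
    simp only [expDual_apply, derivative_mul, mul_sub, smul_eq_C_mul]; ring
  rw [e, map_add, h, eval_mul, hq]; simp

/-- Integrating by parts m times moves every derivative onto p. Before the last step and at it, the
second factor still contains a power of x, so nothing is left at 0. The right side makes the
symmetry of p ↦ `expDual`^m (x^m p^{(m)}) visible. -/
theorem expMoment_mul_expDual_pow {lam : ℝ} (hl : 0 < lam) (p q : ℝ[X]) (m : ℕ) :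
    expMoment lam (p * (expDual lam ^ m) (X ^ m * q)) =
      expMoment lam (derivative^[m] p * X ^ m * q) := by
  have : ∀ i ≤ m, expMoment lam (p * (expDual lam ^ m) (X ^ m * q)) =
      expMoment lam (derivative^[i] p * (expDual lam ^ (m - i)) (X ^ m * q)) := by
    intro i
    induction i with
    | zero => simp
    | succ i ih =>
      intro hi
      rw [ih (by omega), Function.iterate_succ_apply',
        show m - i = (m - (i + 1)) + 1 by omega, pow_succ', Module.End.mul_apply,
        expMoment_mul_expDual hl]
      obtain ⟨c, hc⟩ := X_pow_dvd_expDual_pow lam q (m - (i + 1)) (i + 1)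
      rw [show i + 1 + (m - (i + 1)) = m by omega] at hc
      rw [hc]; simp
  rw [this m le_rfl]
  simp [mul_assoc]

theorem eq_zero_of_expMoment_mul_self {lam : ℝ} (hl : 0 < lam) (p : ℝ[X])
    (h : expMoment lam (p * p) = 0) : p = 0 := by
  rw [expMoment_eq_integral hl, integral_eq_zero_iff_of_nonneg
    (fun x => by rw [eval_mul]; exact mul_nonneg (mul_self_nonneg _) (Real.exp_pos _).le)
    (integrableOn_eval_mul_exp (by positivity) _)] at h
  have h2 : ∀ᵐ x ∂(volume.restrict (Ioi (0 : ℝ))), x ∈ {x | p.IsRoot x} := by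
    filter_upwards [h] with x hx
    simpa [Real.exp_ne_zero] using hx
  by_contra hp
  have hfin := p.finite_setOfPred_isRoot hp
  have h3 : ∀ᵐ x ∂(volume.restrict (Ioi (0 : ℝ))), x ∉ {x | p.IsRoot x} :=
    ae_restrict_of_ae (measure_eq_zero_iff_ae_notMem.1 (hfin.measure_zero volume))
  have h4 : ∀ᵐ x ∂(volume.restrict (Ioi (0 : ℝ))), False := by
    filter_upwards [h2, h3] with x hx hx' using hx' hx
  rw [eventually_false_iff_eq_bot, ae_eq_bot, Measure.restrict_eq_zero] at h4
  simp at h4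

/-- The monic orthogonal polynomials for the weight `e^{-2 lam x}` on `(0, ∞)`, by the formula of
Rodrigues. -/
noncomputable def orthPoly (lam : ℝ) (n : ℕ) : ℝ[X] :=
  (1 / (2 * lam)) ^ n • (expDual lam ^ n) (X ^ n)

theorem orthPoly_sub_mem {lam : ℝ} (hl : 0 < lam) (n : ℕ) :
    orthPoly lam n - X ^ n ∈ degreeLT ℝ n := by
  have := (degreeLT ℝ n).smul_mem ((1 / (2 * lam)) ^ n) ((isTriangular_expDual lam).pow n n)
  convert this using 1
  rw [orthPoly, smul_sub, smul_smul, ← mul_pow, one_div_mul_cancel (by positivity)]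
  simp

theorem iterate_derivative_eq_zero_of_mem {n : ℕ} {q : ℝ[X]} (hq : q ∈ degreeLT ℝ n) :
    derivative^[n] q = 0 := by
  rcases eq_or_ne q 0 with rfl | h0
  · exact iterate_derivative_zero
  · rw [mem_degreeLT, ← natDegree_lt_iff_degree_lt h0] at hq
    exact iterate_derivative_eq_zero hq

/-- Transposing the n-fold operator in the Rodrigues formula produces q^{(n)}, which is zero for
degree < n. -/
theorem expMoment_orthPoly_mul {lam : ℝ} (hl : 0 < lam) {n : ℕ} {q : ℝ[X]}
    (hq : q ∈ degreeLT ℝ n) : expMoment lam (orthPoly lam n * q) = 0 := by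
  have := expMoment_mul_expDual_pow hl q 1 n
  rw [iterate_derivative_eq_zero_of_mem hq] at this
  rw [orthPoly, smul_mul_assoc, map_smul, mul_comm _ q]
  simp only [mul_one, zero_mul, map_zero] at this
  rw [this, smul_zero]

theorem orthPoly_mem {lam : ℝ} (hl : 0 < lam) {n m : ℕ} (h : n < m) :
    orthPoly lam n ∈ degreeLT ℝ m := by
  have h1 := degreeLT_mono h.le (orthPoly_sub_mem hl n)
  have h2 := (degreeLT ℝ m).add_mem h1 (X_pow_mem_degreeLT h)
  simpa using h2

theorem expMoment_orthPoly_mul_orthPoly {lam : ℝ} (hl : 0 < lam) {i j : ℕ} (h : i ≠ j) :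
    expMoment lam (orthPoly lam i * orthPoly lam j) = 0 := by
  rcases h.lt_or_gt with h | h
  · rw [mul_comm]; exact expMoment_orthPoly_mul hl (orthPoly_mem hl h)
  · exact expMoment_orthPoly_mul hl (orthPoly_mem hl h)

/-- The orthogonal polynomials are eigenvectors of `q ↦ expDual ^ m (x ^ m q^{(m)})`. -/
theorem expDual_pow_orthPoly {lam : ℝ} (hl : 0 < lam) (m n : ℕ) :
    (expDual lam ^ m) (X ^ m * derivative^[m] (orthPoly lam n)) =
      ((2 * lam) ^ m * n.descFactorial m) • orthPoly lam n := by
  let S : ℝ[X] →ₗ[ℝ] ℝ[X] :=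
    (expDual lam ^ m) ∘ₗ LinearMap.mulLeft ℝ (X ^ m) ∘ₗ (derivative ^ m)
  have hSa : ∀ q, S q = (expDual lam ^ m) (X ^ m * derivative^[m] q) := fun q => by
    simp [S, Module.End.pow_apply]
  have hS : IsTriangular S fun n => (2 * lam) ^ m * n.descFactorial m := by
    intro n
    have : X ^ m * derivative^[m] (X ^ n : ℝ[X]) = (n.descFactorial m : ℝ) • X ^ n := by
      rw [iterate_derivative_X_pow_eq_smul]
      rcases lt_or_ge n m with h | h
      · simp [Nat.descFactorial_of_lt h]
      · rw [mul_smul_comm, ← pow_add, Nat.add_sub_of_le h]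
    beta_reduce
    rw [hSa, this, map_smul, mul_comm ((2 * lam) ^ m), ← smul_smul, ← smul_sub]
    exact Submodule.smul_mem _ _ ((isTriangular_expDual lam).pow m n)
  rw [← hSa]
  refine hS.eq_smul_of_symmetric (expMoment lam) (eq_zero_of_expMoment_mul_self hl) ?_
    (orthPoly_sub_mem hl n) fun q hq => expMoment_orthPoly_mul hl hq
  -- Symmetry: both sides equal the moment functional of p^{(m)} x^m q^{(m)}.
  intro p q
  rw [hSa, hSa, mul_comm, expMoment_mul_expDual_pow hl, expMoment_mul_expDual_pow hl]
  congr 1; ring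

/-! ### Riemann–Liouville integrals and their semigroup law -/

noncomputable section

theorem integral_rpow_mul_sub_rpow {a b c : ℝ} (ha : 0 < a) (hb : 0 < b) (hc : 0 < c) :
    ∫ x in (0 : ℝ)..c, x ^ (a - 1) * (c - x) ^ (b - 1) =
      c ^ (a + b - 1) * (Real.Gamma a * Real.Gamma b / Real.Gamma (a + b)) := by
  have h := Complex.betaIntegral_scaled a b hc
  have h2 := Complex.Gamma_mul_Gamma_eq_betaIntegral (s := a) (t := b) (by simpa) (by simpa)
  have hG : (Real.Gamma (a + b) : ℂ) ≠ 0 :=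
    Complex.ofReal_ne_zero.2 (Real.Gamma_pos_of_pos (by positivity)).ne'
  rw [← Complex.ofReal_inj, ← intervalIntegral.integral_ofReal]
  have h3 : Complex.betaIntegral a b =
      ((Real.Gamma a * Real.Gamma b / Real.Gamma (a + b) : ℝ) : ℂ) := by
    push_cast
    rw [eq_div_iff hG, ← Complex.Gamma_ofReal, ← Complex.Gamma_ofReal, ← Complex.Gamma_ofReal, h2]
    push_cast; ring
  rw [h3] at h
  rw [Complex.ofReal_mul, Complex.ofReal_cpow hc.le]
  push_cast at h ⊢
  rw [← h, intervalIntegral.integral_of_le hc.le, intervalIntegral.integral_of_le hc.le]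
  refine setIntegral_congr_fun measurableSet_Ioc fun x hx => ?_
  rw [Complex.ofReal_cpow hx.1.le, Complex.ofReal_cpow (by linarith [hx.2])]
  push_cast; ring

theorem integral_sub_rpow_mul_sub_rpow {a b t x : ℝ} (ha : 0 < a) (hb : 0 < b) (hc : t < x) :
    ∫ y in t..x, (x - y) ^ (a - 1) * (y - t) ^ (b - 1) =
      (x - t) ^ (a + b - 1) * (Real.Gamma a * Real.Gamma b / Real.Gamma (a + b)) := by
  have h := integral_rpow_mul_sub_rpow hb ha (sub_pos.2 hc)
  rw [add_comm b a, mul_comm (Real.Gamma b)] at h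
  rw [← h]
  have := intervalIntegral.integral_comp_sub_right (a := t) (b := x)
    (fun y => y ^ (b - 1) * (x - t - y) ^ (a - 1)) t
  rw [sub_self] at this
  rw [← this]
  refine intervalIntegral.integral_congr fun y _ => ?_
  rw [mul_comm]; congr 2; ring

theorem rlIntegral_of_pos {μ x : ℝ} (u : ℝ → ℂ) (hx : 0 < x) : rlIntegral μ u x =
    ∫ y in Ioc 0 x, (((Real.Gamma μ)⁻¹ * (x - y) ^ (μ - 1) : ℝ) : ℂ) * u y := by
  rw [rlIntegral, intervalIntegral.integral_of_le hx.le, ← integral_smul]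
  refine integral_congr_ae (Eventually.of_forall fun y => ?_)
  simp [mul_assoc]

/-- The kernel of the composition of the fractional integrals of the orders `a` and `b`. -/
def rlKernel (a b x y t : ℝ) : ℝ := (Real.Gamma a)⁻¹ * (Real.Gamma b)⁻¹ *
  (Ioi t).indicator (fun y => (x - y) ^ (a - 1) * (y - t) ^ (b - 1)) y

theorem ae_mem_Ioo_restrict_Ioc (x : ℝ) :
    ∀ᵐ t ∂(volume.restrict (Ioc (0 : ℝ) x)), t ∈ Ioo 0 x := by
  rw [← restrict_Ioo_eq_restrict_Ioc]
  exact ae_restrict_mem measurableSet_Ioo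

theorem integral_rlKernel_left {a b x t : ℝ} (ha : 0 < a) (hb : 0 < b) (ht : t ∈ Ioo 0 x) :
    ∫ y in Ioc 0 x, rlKernel a b x y t = (Real.Gamma (a + b))⁻¹ * (x - t) ^ (a + b - 1) := by
  have hGa := (Real.Gamma_pos_of_pos ha).ne'
  have hGb := (Real.Gamma_pos_of_pos hb).ne'
  simp only [rlKernel]
  rw [integral_const_mul, setIntegral_indicator measurableSet_Ioi]
  have : Ioc 0 x ∩ Ioi t = Ioc t x := by
    ext y; simp only [mem_inter_iff, mem_Ioc, mem_Ioi]
    exact ⟨fun h => ⟨h.2, h.1.2⟩, fun h => ⟨⟨ht.1.trans h.1, h.2⟩, h.1⟩⟩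
  rw [this, ← intervalIntegral.integral_of_le ht.2.le, integral_sub_rpow_mul_sub_rpow ha hb ht.2]
  field_simp

theorem integrable_rlKernel_mul {a b x : ℝ} (ha : 0 < a) (hb : 0 < b) (hab : 1 ≤ a + b)
    {U : ℝ → ℂ} (hU : IntegrableOn U (Ioc 0 x)) :
    Integrable (fun z : ℝ × ℝ => (rlKernel a b x z.1 z.2 : ℂ) * U z.2)
      ((volume.restrict (Ioc 0 x)).prod (volume.restrict (Ioc 0 x))) := by
  set ν : Measure ℝ := volume.restrict (Ioc 0 x) with hν
  set κ := rlKernel a b x with hκ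
  have hae : ∀ᵐ t ∂ν, t ∈ Ioo 0 x := ae_mem_Ioo_restrict_Ioc x
  have hκi : ∀ t ∈ Ioo 0 x, ∫ y, κ y t ∂ν = (Real.Gamma (a + b))⁻¹ * (x - t) ^ (a + b - 1) :=
    fun t ht => integral_rlKernel_left ha hb ht
  have hmem : ∀ᵐ t ∂ν, t ∈ Ioc 0 x := ae_restrict_mem measurableSet_Ioc
  have hκ0 : ∀ y t, y ∈ Ioc 0 x → 0 ≤ κ y t := by
    intro y t hy
    have h1 := (Real.Gamma_pos_of_pos ha).le
    have h2 := (Real.Gamma_pos_of_pos hb).le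
    refine mul_nonneg (by positivity) ?_
    rw [indicator_apply]
    split_ifs with h
    · exact mul_nonneg (Real.rpow_nonneg (sub_nonneg.2 hy.2) _)
        (Real.rpow_nonneg (sub_nonneg.2 (le_of_lt h)) _)
    · exact le_rfl
  have hκint : ∀ t ∈ Ioo 0 x, Integrable (fun y => κ y t) ν := by
    intro t ht
    -- The integral of a nonintegrable function is 0 by convention, so the positive value already
    -- computed proves integrability.
    refine not_imp_comm.1 integral_undef ?_
    rw [hκi t ht]
    have := Real.Gamma_pos_of_pos (add_pos ha hb)
    have := Real.rpow_pos_of_pos (sub_pos.2 ht.2) (a + b - 1)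
    positivity
  have hκm : Measurable (Function.uncurry κ) := by
    refine Measurable.const_mul ?_ _
    refine Measurable.ite (measurableSet_lt measurable_snd measurable_fst) ?_ measurable_const
    fun_prop
  have hmeas : AEStronglyMeasurable (fun z : ℝ × ℝ => (κ z.1 z.2 : ℂ) * U z.2) (ν.prod ν) := by
    refine AEStronglyMeasurable.mul ?_ hU.aestronglyMeasurable.comp_snd
    exact (Complex.measurable_ofReal.comp hκm).aestronglyMeasurable
  rw [integrable_prod_iff' hmeas]
  constructor
  · filter_upwards [hae] with t ht
    exact (hκint t ht).ofReal.mul_const _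
  · have e : (fun t => ∫ y, ‖(κ y t : ℂ) * U t‖ ∂ν) =ᵐ[ν]
        fun t => (Real.Gamma (a + b))⁻¹ * (x - t) ^ (a + b - 1) * ‖U t‖ := by
      filter_upwards [hae] with t ht
      rw [← hκi t ht, ← integral_mul_const]
      refine integral_congr_ae ?_
      filter_upwards [hmem] with y hy
      rw [norm_mul, Complex.norm_real, Real.norm_of_nonneg (hκ0 y t hy)]
    rw [integrable_congr e]
    -- Here a + b ≥ 1 enters: (x - t)^{a+b-1} is bounded, so integrability of U suffices and the
    -- semigroup law holds at every x > 0, not only almost everywhere.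
    refine Integrable.bdd_mul (c := (Real.Gamma (a + b))⁻¹ * x ^ (a + b - 1)) hU.norm
      (by
        have : 0 ≤ a + b - 1 := by linarith
        fun_prop (disch := exact this)) ?_
    filter_upwards [hae] with t ht
    have h0 : 0 ≤ x - t := (sub_pos.2 ht.2).le
    have := (Real.Gamma_pos_of_pos (add_pos ha hb)).le
    rw [Real.norm_of_nonneg (by positivity)]
    gcongr
    linarith [ht.1.le]

theorem integral_rlKernel_right {a b x y : ℝ} (hy : y ∈ Ioc 0 x) (U : ℝ → ℂ) :
    ∫ t in Ioc 0 x, (rlKernel a b x y t : ℂ) * U t =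
      (((Real.Gamma a)⁻¹ * (x - y) ^ (a - 1) : ℝ) : ℂ) * rlIntegral b U y := by
  rw [rlIntegral_of_pos _ hy.1, ← integral_const_mul]
  have : ∫ t in Ioc 0 x, (rlKernel a b x y t : ℂ) * U t = ∫ t in Ioc 0 x, (Iio y).indicator (fun t =>
      (((Real.Gamma a)⁻¹ * (Real.Gamma b)⁻¹ *
        ((x - y) ^ (a - 1) * (y - t) ^ (b - 1)) : ℝ) : ℂ) * U t) t := by
    refine integral_congr_ae (Eventually.of_forall fun t => ?_)
    by_cases h : t < y
    · simp [rlKernel, h]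
    · simp [rlKernel, h]
  rw [this, setIntegral_indicator measurableSet_Iio]
  have : Ioc 0 x ∩ Iio y = Ioo 0 y := by
    ext t; simp only [mem_inter_iff, mem_Ioc, mem_Iio, mem_Ioo]
    exact ⟨fun h => ⟨h.1.1, h.2⟩, fun h => ⟨⟨h.1, h.2.le.trans hy.2⟩, h.2⟩⟩
  rw [this, ← integral_Ioc_eq_integral_Ioo]
  refine integral_congr_ae (Eventually.of_forall fun t => ?_)
  simp only
  push_cast; ring

/-- The semigroup law of the fractional integrals. -/
theorem rlIntegral_rlIntegral {a b x : ℝ} (ha : 0 < a) (hb : 0 < b) (hab : 1 ≤ a + b) (hx : 0 < x)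
    {U : ℝ → ℂ} (hU : IntegrableOn U (Ioc 0 x)) :
    rlIntegral a (rlIntegral b U) x = rlIntegral (a + b) U x := by
  rw [rlIntegral_of_pos _ hx, rlIntegral_of_pos _ hx]
  calc _ = ∫ y in Ioc 0 x, ∫ t in Ioc 0 x, (rlKernel a b x y t : ℂ) * U t := by
        refine setIntegral_congr_fun measurableSet_Ioc fun y hy => ?_
        exact (integral_rlKernel_right hy U).symm
    _ = _ := integral_integral_swap (f := fun y t => (rlKernel a b x y t : ℂ) * U t)
        (integrable_rlKernel_mul ha hb hab hU)
    _ = _ := by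
        refine integral_congr_ae ?_
        filter_upwards [ae_mem_Ioo_restrict_Ioc x] with t ht
        rw [integral_mul_const, integral_complex_ofReal, integral_rlKernel_left ha hb ht]

theorem integrableOn_rlIntegral {b x : ℝ} (hb : 0 < b) {U : ℝ → ℂ}
    (hU : IntegrableOn U (Ioc 0 x)) : IntegrableOn (rlIntegral b U) (Ioc 0 x) := by
  -- For a = 1 the outer kernel is constant, so the marginal of the integrable double kernel is I^b
  -- U itself.
  have := (integrable_rlKernel_mul one_pos hb (by linarith) hU).integral_prod_left
  refine this.congr ?_
  filter_upwards [ae_restrict_mem measurableSet_Ioc] with y hy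
  rw [integral_rlKernel_right hy]
  simp

theorem rlIntegral_rpow {a b x : ℝ} (ha : 0 < a) (hb : -1 < b) (hx : 0 < x) :
    rlIntegral a (fun y => ((y ^ b : ℝ) : ℂ)) x =
      ((Real.Gamma (b + 1) / Real.Gamma (a + b + 1) * x ^ (a + b) : ℝ) : ℂ) := by
  have h := integral_rpow_mul_sub_rpow (a := b + 1) (b := a) (by linarith) ha hx
  have hGa := (Real.Gamma_pos_of_pos ha).ne'
  rw [rlIntegral]
  simp only [add_sub_cancel_right] at h
  have : ∫ y in (0 : ℝ)..x, ((x - y) ^ (a - 1) : ℝ) • ((y ^ b : ℝ) : ℂ) =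
      ((∫ y in (0 : ℝ)..x, y ^ b * (x - y) ^ (a - 1) : ℝ) : ℂ) := by
    rw [← intervalIntegral.integral_ofReal]
    refine intervalIntegral.integral_congr fun y _ => ?_
    simp [mul_comm]
  rw [this, h, Complex.real_smul, ← Complex.ofReal_mul]
  congr 1
  rw [show b + 1 + a - 1 = a + b by ring, show b + 1 + a = a + b + 1 by ring]
  field_simp

theorem rlIntegral_one (u : ℝ → ℂ) (x : ℝ) : rlIntegral 1 u x = ∫ y in (0 : ℝ)..x, u y := by
  simp [rlIntegral]

theorem rlIntegral_congr {μ x : ℝ} {u v : ℝ → ℂ} (hx : 0 < x)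
    (h : u =ᵐ[volume.restrict (Ioi (0 : ℝ))] v) : rlIntegral μ u x = rlIntegral μ v x := by
  rw [rlIntegral_of_pos _ hx, rlIntegral_of_pos _ hx]
  refine integral_congr_ae ?_
  filter_upwards [ae_restrict_of_ae_restrict_of_subset Ioc_subset_Ioi_self h] with y hy
  rw [hy]

/-! ### Chains of primitives and weak derivatives -/

/-- Each `w j` with `j < k` is on `(0, ∞)` a primitive of the locally integrable function
`w (j + 1)`. -/
def IsACChain (k : ℕ) (w : ℕ → ℝ → ℂ) : Prop :=
  ∀ j < k, LocallyIntegrableOn (w (j + 1)) (Ioi (0 : ℝ)) ∧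
    ∀ a b : ℝ, 0 < a → a ≤ b → w j b - w j a = ∫ t in a..b, w (j + 1) t

theorem intervalIntegrable_of_locallyIntegrableOn_Ioi {g : ℝ → ℂ}
    (hg : LocallyIntegrableOn g (Ioi (0 : ℝ))) {a b : ℝ} (ha : 0 < a) (hb : 0 < b) :
    IntervalIntegrable g volume a b := by
  rw [intervalIntegrable_iff]
  refine (hg.integrableOn_compact_subset (t := uIcc a b) ?_ isCompact_uIcc).mono_set
    uIoc_subset_uIcc
  intro x hx
  exact (lt_min ha hb).trans_le hx.1

theorem integrableOn_Ioc_of_locallyIntegrableOn_Ici {g : ℝ → ℂ}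
    (hg : LocallyIntegrableOn g (Ici (0 : ℝ))) (x : ℝ) : IntegrableOn g (Ioc 0 x) :=
  (hg.integrableOn_compact_subset Icc_subset_Ici_self isCompact_Icc).mono_set Ioc_subset_Icc_self

theorem IsACChain.sub {k : ℕ} {w w' : ℕ → ℝ → ℂ} (h : IsACChain k w) (h' : IsACChain k w') :
    IsACChain k fun j x => w j x - w' j x := by
  intro j hj
  refine ⟨(h j hj).1.sub (h' j hj).1, fun a b ha hab => ?_⟩
  rw [intervalIntegral.integral_sub
    (intervalIntegrable_of_locallyIntegrableOn_Ioi (h j hj).1 ha (ha.trans_le hab))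
    (intervalIntegrable_of_locallyIntegrableOn_Ioi (h' j hj).1 ha (ha.trans_le hab)),
    ← (h j hj).2 a b ha hab, ← (h' j hj).2 a b ha hab]
  ring

theorem IsACChain.succ {k : ℕ} {w : ℕ → ℝ → ℂ} (h : IsACChain (k + 1) w) :
    IsACChain k fun j => w (j + 1) := fun j hj => h (j + 1) (by omega)

theorem IsACChain.eq_add_integral {k : ℕ} {w : ℕ → ℝ → ℂ} (h : IsACChain k w) {j : ℕ} (hj : j < k)
    {a x : ℝ} (ha : 0 < a) (hx : 0 < x) : w j x = w j a + ∫ t in a..x, w (j + 1) t := by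
  rcases le_total a x with hax | hax
  · rw [← (h j hj).2 a x ha hax]; ring
  · rw [intervalIntegral.integral_symm, ← (h j hj).2 x a hx hax]; ring

theorem IsACChain.continuousOn {k : ℕ} {w : ℕ → ℝ → ℂ} (h : IsACChain k w) {j : ℕ} (hj : j < k) :
    ContinuousOn (w j) (Ioi 0) := by
  intro x (hx : 0 < x)
  have h2 : ContinuousOn (fun y => w j (x / 2) + ∫ t in (x / 2)..y, w (j + 1) t)
      (uIcc (x / 2) (2 * x)) := by
    refine continuousOn_const.add (intervalIntegral.continuousOn_primitive_interval ?_)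
    refine (h j hj).1.integrableOn_compact_subset ?_ isCompact_uIcc
    rw [uIcc_of_le (by linarith)]
    intro y hy
    exact (half_pos hx).trans_le hy.1
  have h3 : ContinuousAt (fun y => w j (x / 2) + ∫ t in (x / 2)..y, w (j + 1) t) x := by
    refine h2.continuousAt ?_
    rw [uIcc_of_le (by linarith)]
    exact Icc_mem_nhds (by linarith) (by linarith)
  refine (h3.congr ?_).continuousWithinAt
  filter_upwards [Ioi_mem_nhds hx] with y hy
  exact (h.eq_add_integral hj (half_pos hx) hy).symm

theorem eqOn_zero_of_ae_eq_zero {f : ℝ → ℂ} (hf : ContinuousOn f (Ioi 0))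
    (h : f =ᵐ[volume.restrict (Ioi (0 : ℝ))] 0) : EqOn f 0 (Ioi 0) :=
  Measure.eqOn_open_of_ae_eq h isOpen_Ioi hf continuousOn_const

/-- Lebesgue differentiation on the intervals (1/(n+1), n+1), which exhaust the half line. -/
theorem ae_eq_zero_of_intervalIntegral_eq_zero {g : ℝ → ℂ}
    (hg : LocallyIntegrableOn g (Ioi (0 : ℝ)))
    (h : ∀ a b : ℝ, 0 < a → a ≤ b → ∫ t in a..b, g t = 0) :
    g =ᵐ[volume.restrict (Ioi (0 : ℝ))] 0 := by
  have key : ∀ n : ℕ, ∀ᵐ x, x ∈ Ioo (1 / (n + 1 : ℝ)) (n + 1) → g x = 0 := by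
    intro n
    have hn : (0 : ℝ) < 1 / (n + 1) := by positivity
    have hn' : (0 : ℝ) < n + 1 := by positivity
    have hle : 1 / (n + 1 : ℝ) ≤ n + 1 := by
      rw [div_le_iff₀ hn']
      have : (0 : ℝ) ≤ n := n.cast_nonneg
      nlinarith
    have hi := intervalIntegrable_of_locallyIntegrableOn_Ioi hg hn hn'
    filter_upwards [hi.ae_hasDerivAt_integral] with x hx hxm
    have hxm' : x ∈ uIcc (1 / (n + 1 : ℝ)) (n + 1) := by
      rw [uIcc_of_le hle]; exact ⟨hxm.1.le, hxm.2.le⟩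
    have h1 := hx hxm' (1 / (n + 1 : ℝ)) left_mem_uIcc
    have h2 : HasDerivAt (fun y => ∫ t in (1 / (n + 1 : ℝ))..y, g t) 0 x := by
      refine (hasDerivAt_const x (0 : ℂ)).congr_of_eventuallyEq ?_
      filter_upwards [Ioi_mem_nhds hxm.1] with y hy
      exact h _ _ hn (le_of_lt hy)
    exact h1.unique h2
  rw [← ae_all_iff] at key
  filter_upwards [ae_restrict_of_ae key, ae_restrict_mem measurableSet_Ioi] with x hx hx0
  obtain ⟨n, hn⟩ := exists_nat_gt (max x (1 / x))
  have hx0' : 0 < x := hx0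
  refine hx n ⟨?_, ?_⟩
  · rw [div_lt_iff₀ (by positivity)]
    have := (le_max_right x (1 / x)).trans_lt hn
    rw [div_lt_iff₀ hx0'] at this
    nlinarith
  · have := (le_max_left x (1 / x)).trans_lt hn
    linarith

theorem IsACChain.eqOn_zero {k : ℕ} {w : ℕ → ℝ → ℂ} (h : IsACChain k w)
    (h0 : w 0 =ᵐ[volume.restrict (Ioi (0 : ℝ))] 0) :
    ∀ j ≤ k, w j =ᵐ[volume.restrict (Ioi (0 : ℝ))] 0 := by
  intro j
  induction j with
  | zero => exact fun _ => h0
  | succ j ih =>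
    intro hj
    have h1 := eqOn_zero_of_ae_eq_zero (h.continuousOn (show j < k by omega)) (ih (by omega))
    refine ae_eq_zero_of_intervalIntegral_eq_zero (h j (by omega)).1 fun a b ha hab => ?_
    rw [← (h j (by omega)).2 a b ha hab, h1 ha, h1 (ha.trans_le hab)]
    simp

theorem degreeLT_le_map_derivative (k : ℕ) :
    degreeLT ℂ k ≤ (degreeLT ℂ (k + 1)).map derivative := by
  classical
  conv_lhs => rw [degreeLT_eq_span_X_pow]
  rw [Submodule.span_le]
  intro q hq
  simp only [Finset.coe_image, Finset.coe_range, mem_image, mem_Iio] at hq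
  obtain ⟨i, hi, rfl⟩ := hq
  refine ⟨C (1 / (i + 1 : ℂ)) * X ^ (i + 1), ?_, ?_⟩
  · rw [← smul_eq_C_mul]
    refine Submodule.smul_mem _ _ ?_
    rw [mem_degreeLT, degree_X_pow]
    exact_mod_cast Nat.succ_lt_succ hi
  · have : (i + 1 : ℂ) ≠ 0 := by exact_mod_cast i.succ_ne_zero
    rw [derivative_C_mul, derivative_X_pow, ← mul_assoc, ← C_mul]
    push_cast
    rw [one_div_mul_cancel this]
    simp

theorem hasDerivAt_eval_ofReal (P : ℂ[X]) (x : ℝ) :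
    HasDerivAt (fun y : ℝ => P.eval (y : ℂ)) ((derivative P).eval (x : ℂ)) x :=
  (P.hasDerivAt (x : ℂ)).comp_ofReal

theorem integral_eval_derivative (P : ℂ[X]) (a b : ℝ) :
    ∫ t in a..b, (derivative P).eval (t : ℂ) = P.eval (b : ℂ) - P.eval (a : ℂ) :=
  intervalIntegral.integral_eq_sub_of_hasDerivAt (fun x _ => hasDerivAt_eval_ofReal P x)
    (Continuous.intervalIntegrable (by fun_prop) _ _)

theorem IsACChain.exists_polynomial {k : ℕ} {w : ℕ → ℝ → ℂ} (h : IsACChain k w)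
    (h0 : w k =ᵐ[volume.restrict (Ioi (0 : ℝ))] 0) :
    ∃ P ∈ degreeLT ℂ k, w 0 =ᵐ[volume.restrict (Ioi (0 : ℝ))] fun x => P.eval (x : ℂ) := by
  induction k generalizing w with
  | zero => exact ⟨0, Submodule.zero_mem _, by
      simp only [eval_zero]; exact h0⟩
  | succ k ih =>
    obtain ⟨P, hP, hw⟩ := ih h.succ h0
    obtain ⟨Q, hQ, rfl⟩ := degreeLT_le_map_derivative k hP
    -- The constant of integration is read off at the interior point 1, since the chain carries no
    -- information at 0.
    refine ⟨Q + C (w 0 1 - Q.eval 1), Submodule.add_mem _ hQ ?_, ?_⟩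
    · rw [mem_degreeLT]
      exact degree_C_le.trans_lt (by exact_mod_cast k.succ_pos)
    · filter_upwards [ae_restrict_mem measurableSet_Ioi] with x hx
      have hx : 0 < x := hx
      rw [h.eq_add_integral k.succ_pos one_pos hx]
      have : ∫ t in (1 : ℝ)..x, w (0 + 1) t = ∫ t in (1 : ℝ)..x, (derivative Q).eval (t : ℂ) := by
        refine intervalIntegral.integral_congr_ae' ?_ ?_
        · filter_upwards [(ae_restrict_iff' measurableSet_Ioi).1 hw] with t ht ht'
          exact ht (one_pos.trans ht'.1)
        · filter_upwards [(ae_restrict_iff' measurableSet_Ioi).1 hw] with t ht ht'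
          exact ht (hx.trans ht'.1)
      rw [this, integral_eval_derivative]
      simp only [eval_add, eval_C, Complex.ofReal_one]
      ring

/-- The iterated primitives from `0`. -/
def iterPrim (F : ℝ → ℂ) : ℕ → ℝ → ℂ
  | 0 => F
  | n + 1 => fun x => ∫ t in (0 : ℝ)..x, iterPrim F n t

theorem integrableOn_iterPrim {F : ℝ → ℂ} (hF : ∀ x, IntegrableOn F (Ioc 0 x)) (n : ℕ) (x : ℝ) :
    IntegrableOn (iterPrim F n) (Ioc 0 x) := by
  induction n generalizing x with
  | zero => exact hF x
  | succ n ih =>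
    rcases le_or_gt x 0 with hx | hx
    · simp [Ioc_eq_empty_of_le hx]
    have : ContinuousOn (iterPrim F (n + 1)) (uIcc 0 x) :=
      intervalIntegral.continuousOn_primitive_interval (by
        rw [uIcc_of_le hx.le, integrableOn_Icc_iff_integrableOn_Ioc]; exact ih x)
    rw [uIcc_of_le hx.le] at this
    exact (this.integrableOn_compact isCompact_Icc).mono_set Ioc_subset_Icc_self

theorem iterPrim_eq_rlIntegral {F : ℝ → ℂ} (hF : ∀ x, IntegrableOn F (Ioc 0 x)) (n : ℕ) {x : ℝ}
    (hx : 0 < x) : iterPrim F (n + 1) x = rlIntegral (n + 1 : ℝ) F x := by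
  induction n generalizing x with
  | zero => simp [iterPrim, rlIntegral_one]
  | succ n ih =>
    rw [iterPrim]
    have h1 := rlIntegral_rlIntegral (a := 1) (b := n + 1) one_pos (by positivity)
      (by linarith [(n.cast_nonneg : (0 : ℝ) ≤ n)]) hx (hF x)
    push_cast
    rw [add_comm ((n : ℝ) + 1) 1, ← h1, rlIntegral_one, intervalIntegral.integral_of_le hx.le,
      intervalIntegral.integral_of_le hx.le]
    exact setIntegral_congr_fun measurableSet_Ioc fun y hy => ih hy.1

theorem locallyIntegrableOn_Ioi_of_Ioc {g : ℝ → ℂ} (hg : ∀ x, IntegrableOn g (Ioc 0 x)) :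
    LocallyIntegrableOn g (Ioi 0) := by
  intro x hx
  exact ⟨Ioc 0 (x + 1), mem_nhdsWithin_of_mem_nhds (Ioc_mem_nhds hx (by linarith)), hg _⟩

theorem isACChain_iterPrim {F : ℝ → ℂ} (hF : ∀ x, IntegrableOn F (Ioc 0 x)) (k : ℕ) :
    IsACChain k fun j => iterPrim F (k - j) := by
  intro j hj
  refine ⟨locallyIntegrableOn_Ioi_of_Ioc (integrableOn_iterPrim hF _), fun a b ha hab => ?_⟩
  beta_reduce
  rw [show k - j = (k - (j + 1)) + 1 by omega]
  simp only [iterPrim]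
  have hi : ∀ x : ℝ, 0 ≤ x → IntervalIntegrable (iterPrim F (k - (j + 1))) volume 0 x := by
    intro x hx
    rw [intervalIntegrable_iff, uIoc_of_le hx]
    exact integrableOn_iterPrim hF _ x
  exact intervalIntegral.integral_interval_sub_left (hi b (by linarith)) (hi a ha.le)

/-- The fractional integral of natural order `k ≥ 1` has its integrand as derivative of order
`k`. -/
theorem isACChain_exists_rlIntegral {F : ℝ → ℂ} (hF : ∀ x, IntegrableOn F (Ioc 0 x)) {k : ℕ}
    (hk : 1 ≤ k) : ∃ w, IsACChain k w ∧ (∀ x, 0 < x → w 0 x = rlIntegral k F x) ∧ w k = F := by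
  refine ⟨_, isACChain_iterPrim hF k, fun x hx => ?_, by simp [iterPrim]⟩
  obtain ⟨n, rfl⟩ : ∃ n, k = n + 1 := ⟨k - 1, by omega⟩
  simpa using iterPrim_eq_rlIntegral hF n hx

theorem HasACDeriv.unique {k : ℕ} {F F' G G' : ℝ → ℂ} (h : HasACDeriv k F G)
    (h' : HasACDeriv k F' G') (hF : F =ᵐ[volume.restrict (Ioi (0 : ℝ))] F') :
    G =ᵐ[volume.restrict (Ioi (0 : ℝ))] G' := by
  obtain ⟨w, h0, hk, hw⟩ := h
  obtain ⟨w', h0', hk', hw'⟩ := h'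
  have := IsACChain.eqOn_zero (IsACChain.sub hw hw') (by
    filter_upwards [h0, h0', hF] with x h1 h2 h3
    simp [h1, h2, h3]) k le_rfl
  filter_upwards [this, hk, hk'] with x h1 h2 h3
  rw [← h2, ← h3]
  exact sub_eq_zero.1 h1

theorem hasACDeriv_rlIntegral {F : ℝ → ℂ} (hF : ∀ x, IntegrableOn F (Ioc 0 x)) {k : ℕ}
    (hk : 1 ≤ k) : HasACDeriv k (rlIntegral k F) F := by
  obtain ⟨w, hw, h0, h1⟩ := isACChain_exists_rlIntegral hF hk
  refine ⟨w, ?_, h1 ▸ EventuallyEq.rfl, hw⟩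
  filter_upwards [ae_restrict_mem measurableSet_Ioi] with x hx using h0 x hx

/-! ### Behaviour at 0 and the solution formula -/

/-- Along this filter an almost everywhere identity can be used in a limit at 0+. -/
instance neBot_nhdsGT_inf_ae : (𝓝[>] (0 : ℝ) ⊓ ae volume).NeBot := by
  rw [inf_neBot_iff]
  intro s hs t ht
  obtain ⟨ε, hε, hsub⟩ := (mem_nhdsGT_iff_exists_Ioo_subset (a := (0 : ℝ))).1 hs
  by_contra hne
  rw [not_nonempty_iff_eq_empty, ← disjoint_iff_inter_eq_empty] at hne
  have h1 : Ioo 0 ε ⊆ tᶜ := fun x hx hxt => disjoint_left.1 hne (hsub hx) hxt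
  have h2 := measure_mono_null h1 (mem_ae_iff.1 ht)
  have hε : 0 < ε := hε
  simp at h2
  linarith

theorem coeff_zero_eq_zero_of_isLittleO_pow {l : Filter ℝ} [l.NeBot] (hl : l ≤ 𝓝[>] 0) {n : ℕ}
    {P : ℂ[X]} (h : (fun x : ℝ => P.eval (x : ℂ)) =o[l] fun x : ℝ => x ^ n) : P.coeff 0 = 0 := by
  have h0 : Tendsto (fun x : ℝ => P.eval (x : ℂ)) l (𝓝 (P.eval 0)) := by
    have : Continuous fun x : ℝ => P.eval (x : ℂ) := by fun_prop
    have := (this.tendsto 0).mono_left (hl.trans nhdsWithin_le_nhds)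
    simpa using this
  have hb : (fun x : ℝ => x ^ n) =O[l] (fun _ => (1 : ℝ)) := by
    refine Asymptotics.IsBigO.of_bound 1 ?_
    filter_upwards [hl (Ioo_mem_nhdsGT one_pos)] with x hx
    rw [Real.norm_of_nonneg (pow_nonneg hx.1.le _), norm_one, one_mul]
    exact pow_le_one₀ hx.1.le hx.2.le
  have := (Asymptotics.isLittleO_one_iff ℝ).1 (h.trans_isBigO hb)
  rw [coeff_zero_eq_eval_zero]
  exact tendsto_nhds_unique h0 this

/-- The constant coefficient is the limit at 0, hence zero; divide by x and repeat. -/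
theorem eq_zero_of_isLittleO_pow {l : Filter ℝ} [l.NeBot] (hl : l ≤ 𝓝[>] 0) {n : ℕ} {P : ℂ[X]}
    (hP : P ∈ degreeLT ℂ (n + 1))
    (h : (fun x : ℝ => P.eval (x : ℂ)) =o[l] fun x : ℝ => x ^ n) : P = 0 := by
  have hpos : ∀ᶠ x in l, (0 : ℝ) < x := hl self_mem_nhdsWithin
  have hc0 := coeff_zero_eq_zero_of_isLittleO_pow hl h
  induction n generalizing P with
  | zero =>
    rw [zero_add, mem_degreeLT, Nat.cast_one, Nat.WithBot.lt_one_iff_le_zero] at hP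
    rw [eq_C_of_degree_le_zero hP, hc0, C_0]
  | succ n ih =>
    have hdiv : P = X * P.divX := by
      conv_lhs => rw [← P.X_mul_divX_add, hc0, C_0, add_zero]
    have hQ : (fun x : ℝ => P.divX.eval (x : ℂ)) =o[l] fun x : ℝ => x ^ n := by
      have := (Asymptotics.isBigO_refl (fun x : ℝ => ((x⁻¹ : ℝ) : ℂ)) l).mul_isLittleO
        (h.trans_isBigO (Asymptotics.IsBigO.of_bound 1 (g := fun x : ℝ => ((x ^ (n + 1) : ℝ) : ℂ))
          (Eventually.of_forall fun x => by simp)))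
      refine (this.congr' ?_ ?_).trans_isBigO (Asymptotics.IsBigO.of_bound 1
        (f := fun x : ℝ => ((x ^ n : ℝ) : ℂ)) (Eventually.of_forall fun x => by simp))
      · filter_upwards [hpos] with x hx
        conv_lhs => rw [hdiv]
        have : (x : ℂ) ≠ 0 := by exact_mod_cast hx.ne'
        rw [eval_mul, eval_X]; push_cast; field_simp
      · filter_upwards [hpos] with x hx
        have : (x : ℂ) ≠ 0 := by exact_mod_cast hx.ne'
        push_cast; field_simp; ring
    have hQd : P.divX ∈ degreeLT ℂ (n + 1) := by
      rw [mem_degreeLT, degree_lt_iff_coeff_zero] at hP ⊢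
      intro m hm
      rw [coeff_divX]
      exact hP _ (by omega)
    rw [hdiv, ih hQd hQ (coeff_zero_eq_zero_of_isLittleO_pow hl hQ), mul_zero]

theorem integral_sub_rpow {r x : ℝ} (hr : 0 < r) :
    ∫ y in (0 : ℝ)..x, (x - y) ^ (r - 1) = x ^ r / r := by
  rw [intervalIntegral.integral_comp_sub_left (fun y => y ^ (r - 1)) x,
    integral_rpow (Or.inl (by linarith))]
  simp [Real.zero_rpow hr.ne']

theorem intervalIntegrable_sub_rpow {r x : ℝ} (hr : 0 < r) :
    IntervalIntegrable (fun y => (x - y) ^ (r - 1)) volume 0 x := by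
  have := (intervalIntegral.intervalIntegrable_rpow' (a := x) (b := 0) (r := r - 1)
    (by linarith)).comp_sub_left x
  simpa using this

/-- A fractional integral of order r gains a factor x^r at 0, and r > 0. -/
theorem isLittleO_rlIntegral_of_bound {r : ℝ} (hr : 0 < r) {n : ℕ} {U : ℝ → ℂ} {C δ : ℝ}
    (hδ : 0 < δ) (hC : 0 ≤ C) (hU : ∀ x ∈ Ioo 0 δ, ‖U x‖ ≤ C * x ^ n) :
    rlIntegral r U =o[𝓝[>] 0] fun x : ℝ => x ^ n := by
  have h1 : rlIntegral r U =O[𝓝[>] 0] fun x : ℝ => x ^ r * x ^ n := by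
    refine Asymptotics.IsBigO.of_bound ((Real.Gamma r)⁻¹ * C / r) ?_
    filter_upwards [Ioo_mem_nhdsGT hδ] with x hx
    have hG := Real.Gamma_pos_of_pos hr
    rw [rlIntegral, norm_smul, Real.norm_of_nonneg (by positivity)]
    have : ‖∫ y in (0 : ℝ)..x, ((x - y) ^ (r - 1) : ℝ) • U y‖ ≤
        ∫ y in (0 : ℝ)..x, (x - y) ^ (r - 1) * (C * x ^ n) := by
      refine intervalIntegral.norm_integral_le_of_norm_le hx.1.le
        (Eventually.of_forall fun y hy => ?_) ((intervalIntegrable_sub_rpow hr).mul_const _)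
      have hxy : 0 ≤ x - y := sub_nonneg.2 hy.2
      rw [norm_smul, Real.norm_of_nonneg (by positivity)]
      gcongr
      refine (hU y ⟨hy.1, hy.2.trans_lt hx.2⟩).trans ?_
      have := hy.1.le
      gcongr
      exact hy.2
    rw [intervalIntegral.integral_mul_const, integral_sub_rpow hr] at this
    have hx0 := hx.1
    rw [norm_mul, Real.norm_of_nonneg (by positivity), Real.norm_of_nonneg (by positivity)]
    calc _ ≤ (Real.Gamma r)⁻¹ * (x ^ r / r * (C * x ^ n)) := by gcongr
      _ = _ := by ring
  have h2 : (fun x : ℝ => x ^ r) =o[𝓝[>] 0] fun _ => (1 : ℝ) := by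
    rw [Asymptotics.isLittleO_one_iff]
    have := (Real.continuous_rpow_const hr.le).tendsto 0
    rw [Real.zero_rpow hr.ne'] at this
    exact this.mono_left nhdsWithin_le_nhds
  refine h1.trans_isLittleO ?_
  simpa using h2.mul_isBigO (Asymptotics.isBigO_refl (fun x : ℝ => x ^ n) (𝓝[>] 0))

/-- The kernel is at most x^n/Γ(n+1), and the remaining factor ∫_0^x |F| tends to 0 by integrability
alone. -/
theorem isLittleO_rlIntegral_succ {n : ℕ} {F : ℝ → ℂ} (hF : ∀ x, IntegrableOn F (Ioc 0 x)) :
    rlIntegral (n + 1 : ℝ) F =o[𝓝[>] 0] fun x : ℝ => x ^ n := by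
  have hG : 0 < Real.Gamma (n + 1 : ℝ) := Real.Gamma_pos_of_pos (by positivity)
  have h1 : rlIntegral (n + 1 : ℝ) F =O[𝓝[>] 0]
      fun x : ℝ => (∫ y in (0 : ℝ)..x, ‖F y‖) * x ^ n := by
    refine Asymptotics.IsBigO.of_bound (Real.Gamma (n + 1 : ℝ))⁻¹ ?_
    filter_upwards [self_mem_nhdsWithin] with x hx
    have hx : 0 < x := hx
    rw [rlIntegral, norm_smul, Real.norm_of_nonneg (by positivity)]
    gcongr
    have : ‖∫ y in (0 : ℝ)..x, ((x - y) ^ ((n : ℝ) + 1 - 1) : ℝ) • F y‖ ≤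
        ∫ y in (0 : ℝ)..x, ‖F y‖ * x ^ n := by
      refine intervalIntegral.norm_integral_le_of_norm_le hx.le
        (Eventually.of_forall fun y hy => ?_) ?_
      · have hxy : 0 ≤ x - y := sub_nonneg.2 hy.2
        rw [norm_smul, Real.norm_of_nonneg (by positivity), add_sub_cancel_right,
          Real.rpow_natCast, mul_comm]
        gcongr
        linarith [hy.1.le]
      · rw [intervalIntegrable_iff, uIoc_of_le hx.le]
        exact (hF x).norm.mul_const _
    rw [intervalIntegral.integral_mul_const] at this
    exact this.trans (le_abs_self _)
  have h2 : (fun x : ℝ => ∫ y in (0 : ℝ)..x, ‖F y‖) =o[𝓝[>] 0] fun _ => (1 : ℝ) := by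
    rw [Asymptotics.isLittleO_one_iff]
    have hc : ContinuousOn (fun x : ℝ => ∫ y in (0 : ℝ)..x, ‖F y‖) (uIcc 0 1) := by
      refine intervalIntegral.continuousOn_primitive_interval ?_
      rw [uIcc_of_le zero_le_one, integrableOn_Icc_iff_integrableOn_Ioc]
      exact (hF 1).norm
    rw [uIcc_of_le zero_le_one] at hc
    have := hc 0 (left_mem_Icc.2 zero_le_one)
    rw [ContinuousWithinAt, intervalIntegral.integral_same] at this
    refine this.mono_left ?_
    rw [← nhdsWithin_Ioc_eq_nhdsGT one_pos]
    exact nhdsWithin_mono _ Ioc_subset_Icc_self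
  refine h1.trans_isLittleO ?_
  simpa using h2.mul_isBigO (Asymptotics.isBigO_refl (fun x : ℝ => x ^ n) (𝓝[>] 0))

/-- The zero initial data give `u = O(x ^ (k - 1))` at `0`. -/
theorem ZeroInitialData.exists_bound {n : ℕ} {u : ℝ → ℂ} (h : ZeroInitialData (n + 1) u) :
    ∃ C δ : ℝ, 0 ≤ C ∧ 0 < δ ∧ ∀ x ∈ Ico 0 δ, ‖u x‖ ≤ C * x ^ n := by
  obtain ⟨hc, v, rfl, hd, hd0, hz⟩ := h
  rcases n with _ | n
  · rw [ContinuousWithinAt, hz 0 (by omega)] at hc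
    have := hc.norm.eventually_lt_const (show ‖(0 : ℂ)‖ < 1 by simp)
    obtain ⟨δ, hδ, hsub⟩ := (mem_nhdsGE_iff_exists_Ico_subset).1 this
    exact ⟨1, δ, zero_le_one, hδ, fun x hx => by simpa using (hsub hx).le⟩
  have key : ∀ i ≤ n, ∃ C δ : ℝ, 0 ≤ C ∧ 0 < δ ∧ ∀ x ∈ Ico 0 δ, ‖v (n - i) x‖ ≤ C * x ^ (i + 1) := by
    intro i
    induction i with
    | zero =>
      intro _
      have h1 := hd0 n (by omega)
      rw [hz (n + 1) (by omega), hasDerivWithinAt_iff_isLittleO] at h1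
      have h2 := h1.def one_pos
      obtain ⟨δ, hδ, hsub⟩ := (mem_nhdsGE_iff_exists_Ico_subset).1 h2
      refine ⟨1, δ, zero_le_one, hδ, fun x hx => ?_⟩
      have := hsub hx
      simp only [mem_ofPred_eq, hz n (by omega), sub_zero, smul_zero, Real.norm_eq_abs,
        abs_of_nonneg hx.1] at this
      simpa using this
    | succ i ih =>
      intro hi
      obtain ⟨C, δ, hC, hδ, hb⟩ := ih (by omega)
      have h1 := hd (n - (i + 1)) (by omega)
      rw [show n - (i + 1) + 1 = n - i by omega] at h1
      obtain ⟨δ', hδ', hsub⟩ := (mem_nhdsGE_iff_exists_Ico_subset).1 h1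
      refine ⟨C, min δ δ', hC, lt_min hδ hδ', fun x hx => ?_⟩
      have := Convex.norm_image_sub_le_of_norm_hasDerivWithin_le (f := v (n - (i + 1)))
        (f' := v (n - i)) (s := Icc 0 x) (C := C * x ^ (i + 1)) (x := 0) (y := x)
        (fun y hy => (hsub ⟨hy.1, (hy.2.trans_lt hx.2).trans_le (min_le_right _ _)⟩).mono
          Icc_subset_Ici_self)
        (fun y hy => (hb y ⟨hy.1, (hy.2.trans_lt hx.2).trans_le (min_le_left _ _)⟩).trans (by
          have := hy.1
          gcongr
          exact hy.2))
        (convex_Icc _ _) (left_mem_Icc.2 hx.1) (right_mem_Icc.2 hx.1)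
      rw [hz _ (by omega), sub_zero, sub_zero, Real.norm_of_nonneg hx.1] at this
      calc _ ≤ _ := this
        _ = _ := by ring
  have := key n le_rfl
  rwa [Nat.sub_self] at this

/-- The tempered fractional integral of order `s ≥ 0`, the identity for `s = 0`. -/
def temperedIntegral (s lam : ℝ) (f : ℝ → ℂ) (x : ℝ) : ℂ :=
  -- The case distinction is needed: with the convention Γ(0) = 0, `rlIntegral` of order 0 is the
  -- zero map and not the identity.
  if s = 0 then f x else
    (Real.exp (-lam * x) : ℂ) * rlIntegral s (fun y => (Real.exp (lam * y) : ℂ) * f y) x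

theorem exp_mul_temperedIntegral_zero (lam : ℝ) (f : ℝ → ℂ) (x : ℝ) :
    (Real.exp (lam * x) : ℂ) * temperedIntegral 0 lam f x = (Real.exp (lam * x) : ℂ) * f x := by
  simp [temperedIntegral]

theorem exp_mul_temperedIntegral {s : ℝ} (hs : s ≠ 0) (lam : ℝ) (f : ℝ → ℂ) (x : ℝ) :
    (Real.exp (lam * x) : ℂ) * temperedIntegral s lam f x =
      rlIntegral s (fun y => (Real.exp (lam * y) : ℂ) * f y) x := by
  rw [temperedIntegral, if_neg hs, ← mul_assoc, ← Complex.ofReal_mul, ← Real.exp_add]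
  simp

theorem floor_add_one_eq {k : ℕ} (hk : 1 ≤ k) {s : ℝ} (hs : (k : ℝ) - 1 ≤ s) (hsk : s < k) :
    ⌊s⌋₊ + 1 = k := by
  have h0 : 0 ≤ s := by
    have : (1 : ℝ) ≤ k := by exact_mod_cast hk
    linarith
  have : ⌊s⌋₊ = k - 1 := by
    rw [Nat.floor_eq_iff h0]
    push_cast [hk]
    exact ⟨hs, by linarith⟩
  omega

theorem ae_eq_of_rlIntegral_ae_eq {n : ℕ} (hn : 1 ≤ n) {U V : ℝ → ℂ}
    (hU : ∀ x, IntegrableOn U (Ioc 0 x)) (hV : ∀ x, IntegrableOn V (Ioc 0 x))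
    (h : rlIntegral n U =ᵐ[volume.restrict (Ioi (0 : ℝ))] rlIntegral n V) :
    U =ᵐ[volume.restrict (Ioi (0 : ℝ))] V :=
  (hasACDeriv_rlIntegral hU hn).unique (hasACDeriv_rlIntegral hV hn) h

/-- Apply I^s to both sides: I^k U = I^{k+s} F = I^k (I^s F), and I^k is injective because k
differentiations undo it. -/
theorem ae_eq_rlIntegral_of_rlIntegral_ae_eq {k : ℕ} (hk : 1 ≤ k) {s : ℝ} (hs : 0 < s)
    (hsk : s < k) {U F : ℝ → ℂ} (hU : ∀ x, IntegrableOn U (Ioc 0 x))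
    (hF : ∀ x, IntegrableOn F (Ioc 0 x))
    (h : rlIntegral (k - s) U =ᵐ[volume.restrict (Ioi (0 : ℝ))] rlIntegral k F) :
    U =ᵐ[volume.restrict (Ioi (0 : ℝ))] rlIntegral s F := by
  have hk' : (1 : ℝ) ≤ k := by exact_mod_cast hk
  refine ae_eq_of_rlIntegral_ae_eq hk hU (fun x => integrableOn_rlIntegral hs (hF x)) ?_
  filter_upwards [ae_restrict_mem measurableSet_Ioi] with x hx
  rw [rlIntegral_rlIntegral (by linarith) hs (by linarith) hx (hF x), add_comm (k : ℝ),
    ← rlIntegral_rlIntegral hs (by linarith) (by linarith) hx (hF x), ← rlIntegral_congr hx h,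
    rlIntegral_rlIntegral hs (by linarith) (by linarith) hx (hU x), add_sub_cancel]

/-- The solution of the initial value problem is the tempered fractional integral of the right-hand
side. -/
theorem SolvesTemperedIVP.ae_eq_temperedIntegral {k : ℕ} (hk : 1 ≤ k) {s : ℝ}
    (hs : (k : ℝ) - 1 ≤ s) (hsk : s < k) {lam : ℝ} {f u : ℝ → ℂ}
    (hF : ∀ x, IntegrableOn (fun y => (Real.exp (lam * y) : ℂ) * f y) (Ioc 0 x))
    (h : SolvesTemperedIVP k s lam f u) :
    u =ᵐ[volume.restrict (Ioi (0 : ℝ))] temperedIntegral s lam f := by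
  obtain ⟨⟨hUl, hder⟩, hzero⟩ := h
  have hfl := floor_add_one_eq hk hs hsk
  have hfl' : ((⌊s⌋₊ : ℝ) + 1) = k := by exact_mod_cast hfl
  rw [hfl, hfl'] at hder
  set U := fun x => (Real.exp (lam * x) : ℂ) * u x with hUdef
  set F := fun x => (Real.exp (lam * x) : ℂ) * f x with hFdef
  have hU := integrableOn_Ioc_of_locallyIntegrableOn_Ici hUl
  have hrl : rlIntegral (k - s) U =ᵐ[volume.restrict (Ioi (0 : ℝ))] rlIntegral k F := by
    obtain ⟨w, hw0, hwk, hw⟩ := hder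
    obtain ⟨w', hw', hw0', hwk'⟩ := isACChain_exists_rlIntegral hF hk
    obtain ⟨P, hP, hPe⟩ := (IsACChain.sub hw hw').exists_polynomial (by
      filter_upwards [hwk] with x hx
      simp [hx, hwk'])
    have hPe' : (fun x => rlIntegral (k - s) U x - rlIntegral k F x)
        =ᵐ[volume.restrict (Ioi (0 : ℝ))] fun x => P.eval (x : ℂ) := by
      filter_upwards [hPe, hw0, ae_restrict_mem measurableSet_Ioi] with x h1 h2 h3
      rw [← h1, h2, hw0' x h3]
    -- P has degree < k, and both fractional integrals are o(x^{k-1}) at 0: the first by the zero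
    -- initial data and k - s > 0, the second because it has integer order k.
    have : P = 0 := by
      obtain ⟨n, rfl⟩ : ∃ n, k = n + 1 := ⟨k - 1, by omega⟩
      refine eq_zero_of_isLittleO_pow (l := 𝓝[>] (0 : ℝ) ⊓ ae volume) inf_le_left hP ?_
      obtain ⟨C, δ, hC, hδ, hb⟩ := hzero.exists_bound
      have h1 : rlIntegral ((n + 1 : ℕ) - s) U =o[𝓝[>] 0] fun x : ℝ => x ^ n := by
        refine isLittleO_rlIntegral_of_bound (C := Real.exp (|lam| * δ) * C) (by linarith) hδ
          (by positivity) fun x hx => ?_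
        rw [hUdef, norm_mul, Complex.norm_real, Real.norm_of_nonneg (Real.exp_pos _).le, mul_assoc]
        refine mul_le_mul ?_ (hb x ⟨hx.1.le, hx.2⟩) (norm_nonneg _) (Real.exp_pos _).le
        refine Real.exp_le_exp.2 (mul_le_mul (le_abs_self _) hx.2.le hx.1.le (abs_nonneg _))
      have h2 : rlIntegral ((n + 1 : ℕ) : ℝ) F =o[𝓝[>] 0] fun x : ℝ => x ^ n := by
        push_cast
        exact isLittleO_rlIntegral_succ hF
      refine ((h1.sub h2).mono inf_le_left).congr' ?_ EventuallyEq.rfl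
      have h3 := (ae_restrict_iff' measurableSet_Ioi).1 hPe'
      have h4 : ∀ᶠ x in 𝓝[>] (0 : ℝ) ⊓ ae volume, x ∈ Ioi (0 : ℝ) :=
        inf_le_left (a := 𝓝[>] (0 : ℝ)) self_mem_nhdsWithin
      filter_upwards [inf_le_right (a := 𝓝[>] (0 : ℝ)) h3, h4] with x hx hx0
      exact hx hx0
    subst this
    filter_upwards [hPe'] with x hx
    simpa [sub_eq_zero] using hx
  have hmain : U =ᵐ[volume.restrict (Ioi (0 : ℝ))]
      fun x => (Real.exp (lam * x) : ℂ) * temperedIntegral s lam f x := by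
    have hk' : (1 : ℝ) ≤ k := by exact_mod_cast hk
    rcases (show (0 : ℝ) ≤ s by linarith).eq_or_lt with h0 | h0
    · subst h0
      simp only [exp_mul_temperedIntegral_zero]
      rw [sub_zero] at hrl
      exact ae_eq_of_rlIntegral_ae_eq hk hU hF hrl
    · simp only [exp_mul_temperedIntegral h0.ne']
      exact ae_eq_rlIntegral_of_rlIntegral_ae_eq hk h0 hsk hU hF hrl
  filter_upwards [hmain] with x hx
  have : (Real.exp (lam * x) : ℂ) ≠ 0 := by exact_mod_cast (Real.exp_pos _).ne'
  exact mul_left_cancel₀ this hx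

/-! ### Weighted L² spaces -/

theorem enorm_ofReal {x : ℝ} (hx : 0 ≤ x) : ‖(x : ℂ)‖ₑ = ENNReal.ofReal x := by
  rw [← ofReal_norm, Complex.norm_real, Real.norm_of_nonneg hx]

theorem measurable_weight (a : ℝ) : Measurable fun x : ℝ => ENNReal.ofReal (x ^ a) := by
  fun_prop

theorem halfLineWeight_absolutelyContinuous (a : ℝ) :
    halfLineWeight a ≪ volume.restrict (Ioi (0 : ℝ)) :=
  withDensity_absolutelyContinuous _ _

theorem absolutelyContinuous_halfLineWeight (a : ℝ) :
    volume.restrict (Ioi (0 : ℝ)) ≪ halfLineWeight a := by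
  refine withDensity_absolutelyContinuous' (measurable_weight a).aemeasurable ?_
  filter_upwards [ae_restrict_mem measurableSet_Ioi] with x hx
  simpa using Real.rpow_pos_of_pos hx a

theorem ae_halfLineWeight_iff {a : ℝ} {p : ℝ → Prop} :
    (∀ᵐ x ∂halfLineWeight a, p x) ↔ ∀ᵐ x ∂(volume.restrict (Ioi (0 : ℝ))), p x :=
  ⟨fun h => (absolutelyContinuous_halfLineWeight a).ae_le h,
    fun h => (halfLineWeight_absolutelyContinuous a).ae_le h⟩

theorem halfLineWeight_zero : halfLineWeight 0 = volume.restrict (Ioi (0 : ℝ)) := by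
  simp [halfLineWeight]

theorem memWeightedL2_iff (a : ℝ) (u : ℝ → ℂ) : MemWeightedL2 a u ↔
    AEStronglyMeasurable u (volume.restrict (Ioi (0 : ℝ))) ∧
      ∫⁻ x in Ioi (0 : ℝ), ENNReal.ofReal (x ^ a) * ‖u x‖ₑ ^ (2 : ℝ) < ⊤ := by
  rw [MemWeightedL2, MemLp, eLpNorm_lt_top_iff_lintegral_rpow_enorm_lt_top two_ne_zero (by simp),
    halfLineWeight, lintegral_withDensity_eq_lintegral_mul_non_measurable _ (measurable_weight a)
      (by simp)]
  refine and_congr ⟨fun h => h.mono_ac (absolutelyContinuous_halfLineWeight a),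
    fun h => h.mono_ac (halfLineWeight_absolutelyContinuous a)⟩ ?_
  simp

theorem MemWeightedL2.congr {a : ℝ} {u v : ℝ → ℂ} (h : MemWeightedL2 a u)
    (huv : u =ᵐ[volume.restrict (Ioi (0 : ℝ))] v) : MemWeightedL2 a v :=
  MemLp.ae_eq ((halfLineWeight_absolutelyContinuous a).ae_eq huv) h

theorem integral_halfLineWeight (a : ℝ) (g : ℝ → ℂ) :
    ∫ x, g x ∂halfLineWeight a = ∫ x in Ioi (0 : ℝ), ((x ^ a : ℝ) : ℂ) * g x := by
  rw [halfLineWeight, integral_withDensity_eq_integral_toReal_smul (measurable_weight a) (by simp)]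
  refine setIntegral_congr_fun measurableSet_Ioi fun x hx => ?_
  rw [ENNReal.toReal_ofReal (Real.rpow_nonneg (le_of_lt hx) _), Complex.real_smul]

theorem MemWeightedL2.integrableOn_mul {a : ℝ} {u v : ℝ → ℂ} (hu : MemWeightedL2 a u)
    (hv : MemWeightedL2 a v) :
    IntegrableOn (fun x => ((x ^ a : ℝ) : ℂ) * (u x * v x)) (Ioi (0 : ℝ)) := by
  have h : Integrable (fun x => u x * v x) (halfLineWeight a) := MemLp.integrable_mul hu hv
  rw [halfLineWeight, integrable_withDensity_iff_integrable_smul' (measurable_weight a)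
    (by simp)] at h
  refine h.congr ?_
  filter_upwards [ae_restrict_mem measurableSet_Ioi] with x hx
  rw [ENNReal.toReal_ofReal (Real.rpow_nonneg (le_of_lt hx) _), Complex.real_smul]

theorem integrableOn_rpow_mul_exp {a r : ℝ} (ha : -1 < a) (hr : 0 < r) :
    IntegrableOn (fun x : ℝ => x ^ a * Real.exp (-(r * x))) (Ioi 0) := by
  have := integrableOn_rpow_mul_exp_neg_mul_rpow (p := 1) (s := a) (b := r) ha one_pos hr
  refine this.congr_fun (fun x _ => ?_) measurableSet_Ioi
  simp

theorem memWeightedL2_rpow_mul_exp {a ν lam : ℝ} (hl : 0 < lam) (h : -1 < a + 2 * ν) :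
    MemWeightedL2 a fun x => ((x ^ ν * Real.exp (-lam * x) : ℝ) : ℂ) := by
  rw [memWeightedL2_iff]
  refine ⟨Measurable.aestronglyMeasurable (by fun_prop), ?_⟩
  have h1 := integrableOn_rpow_mul_exp h (show 0 < 2 * lam by positivity)
  refine (lintegral_congr_ae ?_).trans_lt h1.lintegral_lt_top
  filter_upwards [ae_restrict_mem measurableSet_Ioi] with x hx
  have hx : 0 < x := hx
  rw [enorm_ofReal (by positivity),
    ENNReal.ofReal_rpow_of_nonneg (by positivity) (by positivity),
    ← ENNReal.ofReal_mul (by positivity)]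
  congr 1
  rw [Real.rpow_add hx, mul_comm 2 ν, Real.rpow_mul hx.le, Real.mul_rpow (by positivity)
    (by positivity), ← Real.exp_mul]
  have e : Real.exp (-lam * x * 2) = Real.exp (-(2 * lam * x)) := by congr 1; ring
  rw [e]; ring

theorem memWeightedL2_rpow_mul_exp_mul_eval {a ν lam : ℝ} (hl : 0 < lam) (h : -1 < a + 2 * ν)
    (p : ℂ[X]) : MemWeightedL2 a
      fun x => ((x ^ ν * Real.exp (-lam * x) : ℝ) : ℂ) * p.eval (x : ℂ) := by
  induction p using Polynomial.induction_on' with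
  | add p q hp hq =>
    simp only [eval_add, mul_add]
    exact MemLp.add hp hq
  | monomial n c =>
    have h2 := MemLp.const_mul (memWeightedL2_rpow_mul_exp (a := a) (ν := ν + n) hl (by
      have : (0 : ℝ) ≤ n := n.cast_nonneg
      linarith)) c
    refine MemWeightedL2.congr h2 ?_
    filter_upwards [ae_restrict_mem measurableSet_Ioi] with x hx
    rw [eval_monomial, Real.rpow_add hx, Real.rpow_natCast]
    push_cast; ring

theorem MemGLFSpace.memWeightedL2 {a ν lam : ℝ} {N : ℕ} {w : ℝ → ℂ} (hw : MemGLFSpace ν lam N w)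
    (hl : 0 < lam) (h : -1 < a + 2 * ν) : MemWeightedL2 a w := by
  obtain ⟨p, _, hp⟩ := hw
  refine (memWeightedL2_rpow_mul_exp_mul_eval hl h p).congr ?_
  filter_upwards [ae_restrict_mem measurableSet_Ioi] with x hx
  rw [hp x hx]

/-- Pairing with the weight `x ^ ν e^{-lam x} p(x) x ^ a`, the form in which the inner products with
the trial and test functions occur. -/
theorem MemWeightedL2.integrableOn_mul_exp {a ν lam : ℝ} {u : ℝ → ℂ} (hu : MemWeightedL2 a u)
    (hl : 0 < lam) (h : -1 < a + 2 * ν) (p : ℂ[X]) :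
    IntegrableOn (fun x => ((x ^ (a + ν) * Real.exp (-lam * x) : ℝ) : ℂ) * (u x * p.eval (x : ℂ)))
      (Ioi (0 : ℝ)) := by
  refine (hu.integrableOn_mul (memWeightedL2_rpow_mul_exp_mul_eval hl h p)).congr_fun
    (fun x hx => ?_) measurableSet_Ioi
  simp only
  rw [Real.rpow_add hx]
  push_cast; ring

theorem MemWeightedL2.integrableOn_exp_mul {lam : ℝ} {f : ℝ → ℂ} (hf : MemWeightedL2 0 f) (x : ℝ) :
    IntegrableOn (fun y => (Real.exp (lam * y) : ℂ) * f y) (Ioc 0 x) := by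
  rw [MemWeightedL2, halfLineWeight_zero] at hf
  have h1 : MemLp f 2 (volume.restrict (Ioc 0 x)) :=
    hf.mono_measure (Measure.restrict_mono Ioc_subset_Ioi_self le_rfl)
  have h2 : IntegrableOn f (Ioc 0 x) := h1.integrable (by norm_num)
  have h3 : ContinuousOn (fun y : ℝ => (Real.exp (lam * y) : ℂ)) (Icc 0 x) :=
    Continuous.continuousOn (by fun_prop)
  rw [← integrableOn_Icc_iff_integrableOn_Ioc] at h2 ⊢
  exact h2.continuousOn_mul h3 isCompact_Icc

/-! ### Boundedness of the tempered integral from L² to the weight x^{-s} -/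

/-- The kernel of the tempered fractional integral of order `s > 0`. -/
def temperedKernel (s lam : ℝ) : ℝ → ℝ :=
  (Ioi (0 : ℝ)).indicator fun t => (Real.Gamma s)⁻¹ * (t ^ (s - 1) * Real.exp (-(lam * t)))

theorem temperedKernel_nonneg {s : ℝ} (hs : 0 < s) (lam t : ℝ) : 0 ≤ temperedKernel s lam t := by
  have := Real.Gamma_pos_of_pos hs
  refine indicator_nonneg (fun t (ht : 0 < t) => ?_) t
  positivity

theorem measurable_temperedKernel (s lam : ℝ) : Measurable (temperedKernel s lam) :=
  Measurable.indicator (by fun_prop) measurableSet_Ioi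

theorem integrable_temperedKernel {s lam : ℝ} (hs : 0 < s) (hl : 0 < lam) :
    Integrable (temperedKernel s lam) := by
  rw [temperedKernel, integrable_indicator_iff measurableSet_Ioi]
  exact (integrableOn_rpow_mul_exp (by linarith) hl).const_mul _

theorem temperedIntegral_eq {s : ℝ} (hs : 0 < s) (lam : ℝ) (f : ℝ → ℂ) {x : ℝ} (hx : 0 < x) :
    temperedIntegral s lam f x = ∫ y in Ioi (0 : ℝ), (temperedKernel s lam (x - y) : ℂ) * f y := by
  have h1 : ∫ y in Ioi (0 : ℝ), (temperedKernel s lam (x - y) : ℂ) * f y =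
      ∫ y in Ioi (0 : ℝ), (Iio x).indicator (fun y => (((Real.Gamma s)⁻¹ *
        ((x - y) ^ (s - 1) * Real.exp (-(lam * (x - y)))) : ℝ) : ℂ) * f y) y := by
    refine integral_congr_ae (Eventually.of_forall fun y => ?_)
    by_cases h : y < x
    · simp [temperedKernel, h]
    · simp [temperedKernel, h]
  have h2 : Ioi (0 : ℝ) ∩ Iio x = Ioo 0 x := rfl
  rw [temperedIntegral, if_neg hs.ne', rlIntegral_of_pos _ hx, h1,
    setIntegral_indicator measurableSet_Iio, h2, ← integral_Ioc_eq_integral_Ioo,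
    ← integral_const_mul]
  refine integral_congr_ae (Eventually.of_forall fun y => ?_)
  have : Real.exp (-(lam * (x - y))) = Real.exp (-lam * x) * Real.exp (lam * y) := by
    rw [← Real.exp_add]; congr 1; ring
  simp only
  rw [this]
  push_cast; ring

/-- The exponential is bounded by 1. The power x^s that remains is what the weight x^{-s}
compensates. -/
theorem lintegral_temperedKernel_sub_left_le {s lam x : ℝ} (hs : 0 < s) (hl : 0 < lam)
    (hx : 0 < x) : ∫⁻ y in Ioi (0 : ℝ), ENNReal.ofReal (temperedKernel s lam (x - y)) ≤
      ENNReal.ofReal ((Real.Gamma s)⁻¹ * (x ^ s / s)) := by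
  have hG := Real.Gamma_pos_of_pos hs
  calc _ ≤ ∫⁻ y in Ioi (0 : ℝ), (Ioc 0 x).indicator
        (fun y => ENNReal.ofReal ((Real.Gamma s)⁻¹ * (x - y) ^ (s - 1))) y := by
        refine lintegral_mono_ae ?_
        filter_upwards [ae_restrict_mem measurableSet_Ioi] with y hy
        have hy : 0 < y := hy
        by_cases h : y < x
        · have h0 := sub_pos.2 h
          rw [indicator_of_mem (show y ∈ Ioc 0 x from ⟨hy, h.le⟩), temperedKernel,
            indicator_of_mem (show x - y ∈ Ioi 0 from h0)]
          refine ENNReal.ofReal_le_ofReal (mul_le_mul_of_nonneg_left ?_ (by positivity))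
          refine mul_le_of_le_one_right (by positivity) ?_
          rw [Real.exp_le_one_iff]
          have := mul_pos hl h0
          linarith
        · rw [temperedKernel, indicator_of_notMem (by simpa using h)]
          simp
    _ = ∫⁻ y in Ioc 0 x, ENNReal.ofReal ((Real.Gamma s)⁻¹ * (x - y) ^ (s - 1)) := by
        rw [lintegral_indicator measurableSet_Ioc, Measure.restrict_restrict measurableSet_Ioc,
          inter_eq_left.2 Ioc_subset_Ioi_self]
    _ = ENNReal.ofReal (∫ y in Ioc 0 x, (Real.Gamma s)⁻¹ * (x - y) ^ (s - 1)) := by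
        have hi := intervalIntegrable_sub_rpow (x := x) hs
        rw [intervalIntegrable_iff, uIoc_of_le hx.le] at hi
        rw [ofReal_integral_eq_lintegral_ofReal (hi.const_mul _)]
        filter_upwards [ae_restrict_mem measurableSet_Ioc] with y hy
        have : 0 ≤ x - y := sub_nonneg.2 hy.2
        positivity
    _ = _ := by
        rw [integral_const_mul, ← intervalIntegral.integral_of_le hx.le, integral_sub_rpow hs]

theorem lintegral_temperedKernel_sub_right_le {s lam : ℝ} (y : ℝ) :
    ∫⁻ x in Ioi (0 : ℝ), ENNReal.ofReal (temperedKernel s lam (x - y)) ≤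
      ∫⁻ x, ENNReal.ofReal (temperedKernel s lam x) :=
  (setLIntegral_le_lintegral _ _).trans_eq
    (lintegral_sub_right_eq_self (fun x => ENNReal.ofReal (temperedKernel s lam x)) y)

/-- Cauchy–Schwarz for K^{1/2} and K^{1/2} g. -/
theorem lintegral_mul_sq_le {α : Type*} [MeasurableSpace α] (μ : Measure α) {K g : α → ENNReal}
    (hK : AEMeasurable K μ) (hg : AEMeasurable g μ) :
    (∫⁻ y, K y * g y ∂μ) ^ (2 : ℝ) ≤ (∫⁻ y, K y ∂μ) * ∫⁻ y, K y * g y ^ (2 : ℝ) ∂μ := by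
  have h := ENNReal.lintegral_mul_le_Lp_mul_Lq μ Real.HolderConjugate.two_two
    (f := fun y => K y ^ (1 / 2 : ℝ)) (g := fun y => K y ^ (1 / 2 : ℝ) * g y)
    (hK.pow_const _) ((hK.pow_const _).mul hg)
  have e : ∀ y, K y ^ (1 / 2 : ℝ) * K y ^ (1 / 2 : ℝ) = K y := by
    intro y
    rw [← ENNReal.rpow_add_of_nonneg _ _ (by norm_num) (by norm_num)]
    norm_num
  have e2 : ∀ y, (K y ^ (1 / 2 : ℝ)) ^ (2 : ℝ) = K y := by
    intro y
    rw [← ENNReal.rpow_mul]; norm_num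
  simp only [Pi.mul_apply, ← mul_assoc, e] at h
  simp only [ENNReal.mul_rpow_of_nonneg _ _ zero_le_two, e2] at h
  refine (ENNReal.rpow_le_rpow h zero_le_two).trans_eq ?_
  rw [ENNReal.mul_rpow_of_nonneg _ _ zero_le_two, ← ENNReal.rpow_mul, ← ENNReal.rpow_mul]
  norm_num

theorem aestronglyMeasurable_temperedKernel_mul {s lam : ℝ} {f : ℝ → ℂ}
    (hf : AEStronglyMeasurable f (volume.restrict (Ioi (0 : ℝ)))) :
    AEStronglyMeasurable (fun z : ℝ × ℝ => (temperedKernel s lam (z.1 - z.2) : ℂ) * f z.2)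
      ((volume.restrict (Ioi (0 : ℝ))).prod (volume.restrict (Ioi (0 : ℝ)))) := by
  refine AEStronglyMeasurable.mul ?_ hf.comp_snd
  exact (Complex.measurable_ofReal.comp ((measurable_temperedKernel s lam).comp
    (measurable_fst.sub measurable_snd))).aestronglyMeasurable

/-- The tempered fractional integral maps `L²` to `L²` with the weight `x ^ (-s)`. -/
theorem memWeightedL2_temperedIntegral {s lam : ℝ} (hs : 0 ≤ s) (hl : 0 < lam) {f : ℝ → ℂ}
    (hf : MemWeightedL2 0 f) : MemWeightedL2 (-s) (temperedIntegral s lam f) := by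
  rcases hs.eq_or_lt with rfl | hs
  · have : temperedIntegral 0 lam f = f := by ext x; simp [temperedIntegral]
    rwa [this, neg_zero]
  obtain ⟨hfm, hfi⟩ := (memWeightedL2_iff 0 f).1 hf
  simp only [Real.rpow_zero, ENNReal.ofReal_one, one_mul] at hfi
  have hG := Real.Gamma_pos_of_pos hs
  set ν := volume.restrict (Ioi (0 : ℝ)) with hν
  set K : ℝ → ENNReal := fun t => ENNReal.ofReal (temperedKernel s lam t) with hK
  have hKm : Measurable K := (measurable_temperedKernel s lam).ennreal_ofReal
  have heq : temperedIntegral s lam f =ᵐ[ν]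
      fun x => ∫ y, (temperedKernel s lam (x - y) : ℂ) * f y ∂ν := by
    filter_upwards [ae_restrict_mem measurableSet_Ioi] with x hx using temperedIntegral_eq hs lam f hx
  rw [memWeightedL2_iff]
  refine ⟨(aestronglyMeasurable_temperedKernel_mul hfm).integral_prod_right'.congr heq.symm, ?_⟩
  set C := ENNReal.ofReal ((Real.Gamma s)⁻¹ / s) with hC
  have hfm2 : AEMeasurable (fun y => ‖f y‖ₑ ^ (2 : ℝ)) ν := hfm.enorm.pow_const _
  -- Cauchy–Schwarz puts the mass of the kernel in y, at most x^s/(s Γ(s)), in front of the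
  -- integral, and x^{-s} cancels its power. Integrating over x then needs only that the kernel is
  -- integrable, which comes from λ > 0.
  have hpt : ∀ᵐ x ∂ν, ENNReal.ofReal (x ^ (-s)) * ‖temperedIntegral s lam f x‖ₑ ^ (2 : ℝ) ≤
      C * ∫⁻ y, K (x - y) * ‖f y‖ₑ ^ (2 : ℝ) ∂ν := by
    filter_upwards [ae_restrict_mem measurableSet_Ioi, heq] with x hx hxe
    have hx : 0 < x := hx
    rw [hxe]
    have h1 : ‖∫ y, (temperedKernel s lam (x - y) : ℂ) * f y ∂ν‖ₑ ≤
        ∫⁻ y, K (x - y) * ‖f y‖ₑ ∂ν := by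
      refine (enorm_integral_le_lintegral_enorm _).trans_eq ?_
      refine lintegral_congr fun y => ?_
      rw [enorm_mul, enorm_ofReal (temperedKernel_nonneg hs _ _)]
    have h2 := lintegral_mul_sq_le ν (K := fun y => K (x - y)) (g := fun y => ‖f y‖ₑ)
      (hKm.comp (measurable_const.sub measurable_id)).aemeasurable hfm.enorm
    calc _ ≤ ENNReal.ofReal (x ^ (-s)) * (ENNReal.ofReal ((Real.Gamma s)⁻¹ * (x ^ s / s)) *
          ∫⁻ y, K (x - y) * ‖f y‖ₑ ^ (2 : ℝ) ∂ν) := by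
          gcongr
          refine (ENNReal.rpow_le_rpow h1 zero_le_two).trans (h2.trans ?_)
          gcongr
          exact lintegral_temperedKernel_sub_left_le hs hl hx
      _ = _ := by
          rw [← mul_assoc, ← ENNReal.ofReal_mul (by positivity)]
          congr 2
          rw [Real.rpow_neg hx.le]
          have := (Real.rpow_pos_of_pos hx s).ne'
          field_simp
  refine (lintegral_mono_ae hpt).trans_lt ?_
  rw [lintegral_const_mul' _ _ ENNReal.ofReal_ne_top]
  refine ENNReal.mul_lt_top ENNReal.ofReal_lt_top ?_
  have hm : AEMeasurable (Function.uncurry fun x y => K (x - y) * ‖f y‖ₑ ^ (2 : ℝ)) (ν.prod ν) :=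
    (hKm.comp (measurable_fst.sub measurable_snd)).aemeasurable.mul hfm2.comp_snd
  rw [lintegral_lintegral_swap hm]
  have hKfin : ∫⁻ x, K x < ⊤ := (integrable_temperedKernel hs hl).lintegral_lt_top
  calc _ ≤ ∫⁻ y, (∫⁻ x, K x) * ‖f y‖ₑ ^ (2 : ℝ) ∂ν := by
        refine lintegral_mono fun y => ?_
        rw [lintegral_mul_const (f := fun x => K (x - y)) _
          (hKm.comp (measurable_id.sub measurable_const))]
        exact mul_le_mul' (lintegral_temperedKernel_sub_right_le y) le_rfl
    _ = (∫⁻ x, K x) * ∫⁻ y, ‖f y‖ₑ ^ (2 : ℝ) ∂ν := lintegral_const_mul' _ _ hKfin.ne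
    _ < ⊤ := ENNReal.mul_lt_top hKfin hfi

/-! ### The tempered integral on polynomials, its adjoint and eigenvectors -/

/-- The diagonal map `x ^ n ↦ c n x ^ n`. -/
def diagMap {K : Type*} [Field K] (c : ℕ → K) : K[X] →ₗ[K] K[X] :=
  Polynomial.lsum fun n => c n • monomial n

theorem diagMap_monomial {K : Type*} [Field K] (c : ℕ → K) (n : ℕ) (a : K) :
    diagMap c (monomial n a) = monomial n (c n * a) := by
  rw [diagMap, Polynomial.lsum_apply, Polynomial.sum_monomial_index _ _ (by simp)]
  simp [smul_monomial]

theorem coeff_diagMap {K : Type*} [Field K] (c : ℕ → K) (p : K[X]) (n : ℕ) :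
    (diagMap c p).coeff n = c n * p.coeff n := by
  induction p using Polynomial.induction_on' with
  | add p q hp hq => simp only [map_add, coeff_add, hp, hq, mul_add]
  | monomial m a =>
    rw [diagMap_monomial, coeff_monomial, coeff_monomial]
    split_ifs with h
    · rw [h]
    · simp

theorem diagMap_diagMap_inv {K : Type*} [Field K] {c : ℕ → K} (hc : ∀ n, c n ≠ 0) (p : K[X]) :
    diagMap c (diagMap (fun n => (c n)⁻¹) p) = p := by
  ext n
  rw [coeff_diagMap, coeff_diagMap, mul_inv_cancel_left₀ (hc n)]

theorem natDegree_diagMap_le {K : Type*} [Field K] (c : ℕ → K) (p : K[X]) :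
    (diagMap c p).natDegree ≤ p.natDegree := by
  rw [natDegree_le_iff_coeff_eq_zero]
  intro n hn
  rw [coeff_diagMap, coeff_eq_zero_of_natDegree_lt hn, mul_zero]

theorem map_diagMap (c : ℕ → ℝ) (p : ℝ[X]) : (diagMap c p).map (algebraMap ℝ ℂ) =
    diagMap (fun n => (c n : ℂ)) (p.map (algebraMap ℝ ℂ)) := by
  ext n
  simp [coeff_diagMap]

theorem eval_map_ofReal (p : ℝ[X]) (x : ℝ) :
    (p.map (algebraMap ℝ ℂ)).eval (x : ℂ) = ((p.eval x : ℝ) : ℂ) := by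
  have := eval_map_apply (algebraMap ℝ ℂ) (p := p) x
  simpa using this

/-- The numbers `n! / Γ(n + 1 + s)` with `I ^ s x ^ n = n! / Γ(n + 1 + s) x ^ (n + s)`. -/
def gammaRatio (s : ℝ) (n : ℕ) : ℝ := n.factorial / Real.Gamma (n + 1 + s)

theorem gammaRatio_pos {s : ℝ} (hs : 0 ≤ s) (n : ℕ) : 0 < gammaRatio s n :=
  div_pos (by exact_mod_cast n.factorial_pos) (Real.Gamma_pos_of_pos (by positivity))

theorem temperedIntegral_exp_mul_eval {s : ℝ} (hs : 0 ≤ s) (lam : ℝ) (P : ℂ[X]) {x : ℝ}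
    (hx : 0 < x) :
    temperedIntegral s lam (fun y => (Real.exp (-lam * y) : ℂ) * P.eval (y : ℂ)) x =
      ((x ^ s * Real.exp (-lam * x) : ℝ) : ℂ) *
        (diagMap (fun n => (gammaRatio s n : ℂ)) P).eval (x : ℂ) := by
  rcases hs.eq_or_lt with rfl | hs
  · have : diagMap (fun n => (gammaRatio 0 n : ℂ)) P = P := by
      ext n
      rw [coeff_diagMap, gammaRatio, add_zero, Real.Gamma_nat_eq_factorial, div_self
        (by exact_mod_cast n.factorial_ne_zero)]
      simp
    simp [temperedIntegral, this]
  have h1 : rlIntegral s (fun y => (Real.exp (lam * y) : ℂ) *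
      ((Real.exp (-lam * y) : ℂ) * P.eval (y : ℂ))) x =
      ∑ n ∈ Finset.range (P.natDegree + 1), rlIntegral s (fun y => ((y ^ (n : ℝ) : ℝ) : ℂ)) x *
        P.coeff n := by
    rw [rlIntegral]
    simp only [rlIntegral]
    have e : ∀ y : ℝ, ((x - y) ^ (s - 1) : ℝ) • ((Real.exp (lam * y) : ℂ) *
        ((Real.exp (-lam * y) : ℂ) * P.eval (y : ℂ))) =
        ∑ n ∈ Finset.range (P.natDegree + 1),
          (((x - y) ^ (s - 1) : ℝ) • ((y ^ (n : ℝ) : ℝ) : ℂ)) * P.coeff n := by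
      intro y
      rw [← mul_assoc, ← Complex.ofReal_mul, ← Real.exp_add, eval_eq_sum_range, Complex.real_smul]
      simp only [neg_mul, add_neg_cancel, Real.exp_zero, Complex.ofReal_one, one_mul,
        Finset.mul_sum]
      refine Finset.sum_congr rfl fun n _ => ?_
      rw [Complex.real_smul, Real.rpow_natCast]
      push_cast; ring
    simp only [e]
    rw [intervalIntegral.integral_finsetSum]
    · rw [Finset.smul_sum]
      refine Finset.sum_congr rfl fun n _ => ?_
      rw [intervalIntegral.integral_mul_const, smul_mul_assoc]
    · intro n _
      refine IntervalIntegrable.mul_const ?_ _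
      have hi : IntervalIntegrable (fun y => (((x - y) ^ (s - 1) : ℝ) : ℂ)) volume 0 x := by
        have := intervalIntegrable_sub_rpow (x := x) hs
        exact ⟨this.1.ofReal, this.2.ofReal⟩
      have := hi.mul_continuousOn (g := fun y : ℝ => ((y ^ (n : ℝ) : ℝ) : ℂ))
        (Continuous.continuousOn (by simp only [Real.rpow_natCast]; fun_prop))
      exact this
  rw [temperedIntegral, if_neg hs.ne', h1, eval_eq_sum_range' (n := P.natDegree + 1)
    (Nat.lt_succ_of_le (natDegree_diagMap_le _ _)), Finset.mul_sum, Finset.mul_sum]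
  refine Finset.sum_congr rfl fun n _ => ?_
  rw [rlIntegral_rpow hs (by have : (0 : ℝ) ≤ n := n.cast_nonneg
                             linarith) hx, coeff_diagMap, gammaRatio, Real.Gamma_nat_eq_factorial,
    Real.rpow_add hx, Real.rpow_natCast, show s + n + 1 = n + 1 + s by ring]
  push_cast; ring

/-- The image of `x ^ n` under the adjoint of the tempered fractional integral. -/
def adjointMonomial (s lam : ℝ) (n : ℕ) : ℝ[X] :=
  ∑ j ∈ Finset.range (n + 1),
    (n.choose j * (∏ i ∈ Finset.range j, (s + i)) * (1 / (2 * lam)) ^ (s + j)) • X ^ (n - j)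

/-- The adjoint of the tempered fractional integral of order `s`: it maps `q` to the polynomial
`y ↦ e^{lam y} Γ(s)⁻¹ ∫ (x - y) ^ (s - 1) e^{-lam (x - y)} e^{-lam x} q(x) dx`, `x > y`. -/
def adjointPoly (s lam : ℝ) : ℝ[X] →ₗ[ℝ] ℝ[X] :=
  Polynomial.lsum fun n => LinearMap.toSpanSingleton ℝ ℝ[X] (adjointMonomial s lam n)

theorem adjointPoly_monomial (s lam : ℝ) (n : ℕ) (a : ℝ) :
    adjointPoly s lam (monomial n a) = a • adjointMonomial s lam n := by
  rw [adjointPoly, Polynomial.lsum_apply, Polynomial.sum_monomial_index _ _ (by simp)]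
  simp

/-- The summand j = 0 supplies the leading term, with coefficient (2λ)^{-s} independent of n. -/
theorem isTriangular_adjointPoly (s lam : ℝ) :
    IsTriangular (adjointPoly s lam) fun _ => (1 / (2 * lam)) ^ s := by
  intro n
  rw [← monomial_one_right_eq_X_pow, adjointPoly_monomial, one_smul, adjointMonomial,
    Finset.sum_range_succ']
  simp only [Finset.range_zero, Finset.prod_empty, Nat.choose_zero_right, Nat.cast_one, mul_one,
    Nat.cast_zero, add_zero, Nat.sub_zero, one_mul, monomial_one_right_eq_X_pow, add_sub_cancel_right]
  refine Submodule.sum_mem _ fun j hj => Submodule.smul_mem _ _ (X_pow_mem_degreeLT ?_)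
  rw [Finset.mem_range] at hj
  omega

/-- For j ≥ 1 the product contains the factor s = 0. Writing Γ(s+j)/Γ(s) as a product is what lets
the formula cover this case. -/
theorem adjointMonomial_zero {lam : ℝ} (n : ℕ) : adjointMonomial 0 lam n = X ^ n := by
  rw [adjointMonomial, Finset.sum_range_succ', Finset.sum_eq_zero]
  · simp
  · intro j _
    rw [Finset.prod_range_succ']
    simp

theorem adjointPoly_zero (lam : ℝ) (q : ℝ[X]) : adjointPoly 0 lam q = q := by
  induction q using Polynomial.induction_on' with
  | add p q hp hq => rw [map_add, hp, hq]
  | monomial n a =>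
    rw [adjointPoly_monomial, adjointMonomial_zero, ← monomial_one_right_eq_X_pow, smul_monomial]
    simp

/-- Substitute x = t + y and expand (t + y)^n. The exponentials combine to e^{-2λt} e^{-λy}, leaving
gamma integrals of argument s + j and rate 2λ. -/
theorem integral_temperedKernel_mul {s lam y : ℝ} (hs : 0 < s) (hl : 0 < lam) (hy : 0 < y)
    (n : ℕ) : ∫ x in Ioi (0 : ℝ), temperedKernel s lam (x - y) * (x ^ n * Real.exp (-lam * x)) =
      (adjointMonomial s lam n).eval y * Real.exp (-lam * y) := by
  have hG := (Real.Gamma_pos_of_pos hs).ne'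
  have h1 : ∫ x in Ioi (0 : ℝ), temperedKernel s lam (x - y) * (x ^ n * Real.exp (-lam * x)) =
      ∫ x, temperedKernel s lam (x - y) * ((x - y + y) ^ n * Real.exp (-lam * (x - y + y))) := by
    simp only [sub_add_cancel]
    refine setIntegral_eq_integral_of_forall_compl_eq_zero fun x hx => ?_
    have hx : ¬ 0 < x := hx
    rw [temperedKernel, indicator_of_notMem, zero_mul]
    simp only [mem_Ioi, sub_pos]
    linarith
  rw [h1, integral_sub_right_eq_self (fun x => temperedKernel s lam x *
    ((x + y) ^ n * Real.exp (-lam * (x + y)))) y]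
  have h2 : ∀ x, temperedKernel s lam x * ((x + y) ^ n * Real.exp (-lam * (x + y))) =
      (Ioi (0 : ℝ)).indicator (fun t => ∑ j ∈ Finset.range (n + 1),
        ((Real.Gamma s)⁻¹ * n.choose j * y ^ (n - j) * Real.exp (-lam * y)) *
          (t ^ (s + j - 1) * Real.exp (-(2 * lam * t)))) x := by
    intro x
    by_cases hx : x ∈ Ioi (0 : ℝ)
    · rw [temperedKernel, indicator_of_mem hx, indicator_of_mem hx, add_pow, Finset.sum_mul,
        Finset.mul_sum]
      refine Finset.sum_congr rfl fun j _ => ?_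
      rw [show s + (j : ℝ) - 1 = (s - 1) + j by ring, Real.rpow_add hx, Real.rpow_natCast,
        show Real.exp (-lam * (x + y)) = Real.exp (-(lam * x)) * Real.exp (-lam * y) by
          rw [← Real.exp_add]; congr 1; ring,
        show Real.exp (-(2 * lam * x)) = Real.exp (-(lam * x)) * Real.exp (-(lam * x)) by
          rw [← Real.exp_add]; congr 1; ring]
      ring
    · rw [temperedKernel, indicator_of_notMem hx, indicator_of_notMem hx, zero_mul]
  simp only [h2]
  rw [integral_indicator measurableSet_Ioi, integral_finsetSum, adjointMonomial, eval_finsetSum,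
    Finset.sum_mul]
  · refine Finset.sum_congr rfl fun j _ => ?_
    rw [integral_const_mul, Real.integral_rpow_mul_exp_neg_mul_Ioi (by positivity) (by positivity),
      ← prod_add_range_mul_Gamma hs, eval_smul, eval_pow, eval_X, smul_eq_mul]
    field_simp
  · intro j _
    refine Integrable.const_mul ?_ _
    refine integrableOn_rpow_mul_exp ?_ (by positivity)
    have : (0 : ℝ) ≤ j := j.cast_nonneg
    linarith

/-- Positivity serves Fubini in the adjointness relation: a nonzero integral certifies integrability
of the kernel in x, and the absolute values can be dropped. -/
theorem eval_adjointMonomial_pos {s lam y : ℝ} (hs : 0 < s) (hl : 0 < lam) (hy : 0 < y) (n : ℕ) :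
    0 < (adjointMonomial s lam n).eval y := by
  rw [adjointMonomial, eval_finsetSum]
  refine Finset.sum_pos (fun j hj => ?_) ⟨0, by simp⟩
  have h1 : 0 < n.choose j := Nat.choose_pos (by rw [Finset.mem_range] at hj; omega)
  have h2 : 0 < ∏ i ∈ Finset.range j, (s + i) := Finset.prod_pos fun i _ => by positivity
  simp only [eval_smul, eval_pow, eval_X, smul_eq_mul]
  positivity

theorem MemWeightedL2.integrableOn_mul_expPoly {s lam : ℝ} (hs : 0 ≤ s) (hl : 0 < lam) {u : ℝ → ℂ}
    (hu : MemWeightedL2 (-s) u) (q : ℝ[X]) :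
    IntegrableOn (fun x => u x * ((q.eval x * Real.exp (-lam * x) : ℝ) : ℂ)) (Ioi (0 : ℝ)) := by
  refine (hu.integrableOn_mul_exp (ν := s) hl (by linarith) (q.map (algebraMap ℝ ℂ))).congr_fun
    (fun x _ => ?_) measurableSet_Ioi
  simp only [eval_map_ofReal, neg_add_cancel, Real.rpow_zero]
  push_cast; ring

/-- The adjointness relation of the tempered fractional integral. -/
theorem integral_temperedIntegral_mul {s lam : ℝ} (hs : 0 ≤ s) (hl : 0 < lam) {f : ℝ → ℂ}
    (hf : MemWeightedL2 0 f) (q : ℝ[X]) :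
    ∫ x in Ioi (0 : ℝ), temperedIntegral s lam f x * ((q.eval x * Real.exp (-lam * x) : ℝ) : ℂ) =
      ∫ y in Ioi (0 : ℝ), f y *
        (((adjointPoly s lam q).eval y * Real.exp (-lam * y) : ℝ) : ℂ) := by
  rcases hs.eq_or_lt with rfl | hs0
  · simp [temperedIntegral, adjointPoly_zero]
  have hu := memWeightedL2_temperedIntegral hs hl hf
  have hf' : MemWeightedL2 (-0) f := by rwa [neg_zero]
  induction q using Polynomial.induction_on' with
  | add p q hp hq =>
    simp only [map_add, eval_add, add_mul, Complex.ofReal_add, mul_add]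
    rw [integral_add (hu.integrableOn_mul_expPoly hs hl p) (hu.integrableOn_mul_expPoly hs hl q),
      integral_add (hf'.integrableOn_mul_expPoly le_rfl hl _)
        (hf'.integrableOn_mul_expPoly le_rfl hl _), hp, hq]
  | monomial n a =>
    simp only [adjointPoly_monomial, eval_monomial, eval_smul, smul_eq_mul, mul_assoc,
      Complex.ofReal_mul a, mul_left_comm _ (a : ℂ)]
    rw [integral_const_mul, integral_const_mul]
    congr 1
    set ν := volume.restrict (Ioi (0 : ℝ)) with hν
    have hmem : ∀ᵐ x ∂ν, x ∈ Ioi (0 : ℝ) := ae_restrict_mem measurableSet_Ioi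
    let κ : ℝ → ℝ → ℝ := fun x y => temperedKernel s lam (x - y) * (x ^ n * Real.exp (-lam * x))
    have hκi : ∀ y ∈ Ioi (0 : ℝ), ∫ x, κ x y ∂ν =
        (adjointMonomial s lam n).eval y * Real.exp (-lam * y) :=
      fun y hy => integral_temperedKernel_mul hs0 hl hy n
    have hκint : ∀ y ∈ Ioi (0 : ℝ), Integrable (fun x => κ x y) ν := by
      intro y hy
      refine not_imp_comm.1 integral_undef ?_
      rw [hκi y hy]
      have := eval_adjointMonomial_pos hs0 hl hy n
      positivity
    have hint : Integrable (fun z : ℝ × ℝ => (κ z.1 z.2 : ℂ) * f z.2) (ν.prod ν) := by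
      have hmeas : AEStronglyMeasurable (fun z : ℝ × ℝ => (κ z.1 z.2 : ℂ) * f z.2) (ν.prod ν) := by
        refine AEStronglyMeasurable.mul ?_ ((memWeightedL2_iff 0 f).1 hf).1.comp_snd
        refine (Complex.measurable_ofReal.comp (Measurable.mul ((measurable_temperedKernel s lam).comp
          (measurable_fst.sub measurable_snd)) ?_)).aestronglyMeasurable
        fun_prop
      rw [integrable_prod_iff' hmeas]
      constructor
      · filter_upwards [hmem] with y hy
        exact (hκint y hy).ofReal.mul_const _
      · refine (hf'.integrableOn_mul_expPoly le_rfl hl (adjointMonomial s lam n)).norm.congr ?_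
        filter_upwards [hmem] with y hy
        rw [norm_mul, Complex.norm_real, Real.norm_of_nonneg
          (mul_nonneg (eval_adjointMonomial_pos hs0 hl hy n).le (Real.exp_pos _).le), ← hκi y hy,
          mul_comm, ← integral_mul_const]
        refine integral_congr_ae ?_
        filter_upwards [hmem] with x hx
        have hx : 0 < x := hx
        rw [norm_mul, Complex.norm_real, Real.norm_of_nonneg]
        exact mul_nonneg (temperedKernel_nonneg hs0 _ _) (by positivity)
    calc _ = ∫ x, ∫ y, (κ x y : ℂ) * f y ∂ν ∂ν := by
          refine integral_congr_ae ?_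
          filter_upwards [hmem] with x hx
          rw [temperedIntegral_eq hs0 lam f hx, ← integral_mul_const]
          refine integral_congr_ae (Eventually.of_forall fun y => ?_)
          simp only [κ]
          push_cast; ring
      _ = _ := integral_integral_swap (f := fun x y => (κ x y : ℂ) * f y) hint
      _ = _ := by
          refine integral_congr_ae ?_
          filter_upwards [hmem] with y hy
          rw [integral_mul_const, integral_complex_ofReal, hκi y hy, mul_comm]

/-- The diagonal map that describes the tempered fractional integral on `e^{-lam x} p(x)`. -/
abbrev trialPoly (s : ℝ) : ℝ[X] →ₗ[ℝ] ℝ[X] := diagMap (gammaRatio s)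

theorem memWeightedL2_exp_mul_eval {lam : ℝ} (hl : 0 < lam) (P : ℂ[X]) :
    MemWeightedL2 0 fun x => (Real.exp (-lam * x) : ℂ) * P.eval (x : ℂ) := by
  have := memWeightedL2_rpow_mul_exp_mul_eval (a := 0) (ν := 0) hl (by norm_num) P
  simpa using this

/-- Adjointness applied to f = e^{-λx} p. With B q in place of q, the left side becomes symmetric in
p and q, so A B is symmetric for the moment form. -/
theorem integral_rpow_mul_trialPoly {s lam : ℝ} (hs : 0 ≤ s) (hl : 0 < lam) (p q : ℝ[X]) :
    ∫ x in Ioi (0 : ℝ), x ^ s * ((trialPoly s p).eval x * q.eval x * Real.exp (-(2 * lam * x))) =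
      expMoment lam (p * adjointPoly s lam q) := by
  have h := integral_temperedIntegral_mul hs hl
    (memWeightedL2_exp_mul_eval hl (p.map (algebraMap ℝ ℂ))) q
  have hexp : ∀ x : ℝ, Real.exp (-(2 * lam * x)) = Real.exp (-lam * x) * Real.exp (-lam * x) := by
    intro x; rw [← Real.exp_add]; congr 1; ring
  rw [← Complex.ofReal_inj, expMoment_eq_integral hl, ← integral_complex_ofReal,
    ← integral_complex_ofReal]
  refine Eq.trans ?_ (h.trans ?_)
  · refine setIntegral_congr_fun measurableSet_Ioi fun x hx => ?_
    rw [temperedIntegral_exp_mul_eval hs lam _ hx, ← map_diagMap, eval_map_ofReal, hexp]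
    push_cast; ring
  · refine setIntegral_congr_fun measurableSet_Ioi fun x hx => ?_
    rw [eval_map_ofReal, hexp, eval_mul]
    push_cast; ring

theorem isTriangular_trialPoly (s : ℝ) : IsTriangular (trialPoly s) (gammaRatio s) := by
  intro n
  rw [← monomial_one_right_eq_X_pow, diagMap_monomial, smul_monomial]
  simp

/-- A B is triangular and symmetric, so the orthogonal polynomials are its eigenvectors and the
eigenvalue is the product of the two diagonal entries. -/
theorem adjointPoly_trialPoly_orthPoly {s lam : ℝ} (hs : 0 ≤ s) (hl : 0 < lam) (n : ℕ) :
    adjointPoly s lam (trialPoly s (orthPoly lam n)) =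
      ((1 / (2 * lam)) ^ s * gammaRatio s n) • orthPoly lam n := by
  refine ((isTriangular_adjointPoly s lam).comp (isTriangular_trialPoly s)).eq_smul_of_symmetric
    (expMoment lam) (eq_zero_of_expMoment_mul_self hl) (fun p q => ?_)
    (orthPoly_sub_mem hl n) fun q hq => expMoment_orthPoly_mul hl hq
  simp only [LinearMap.comp_apply]
  rw [mul_comm, ← integral_rpow_mul_trialPoly hs hl, ← integral_rpow_mul_trialPoly hs hl]
  congr 1
  ext x; ring

/-! ### Integration by parts through Fubini's theorem -/

/-- The kernel with `∫ t in 1..x, h t = ∫ t in Ioi 0, primKernel x t * h t`. -/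
def primKernel (x t : ℝ) : ℝ := (Ioc 1 x).indicator 1 t - (Ioc x 1).indicator 1 t

theorem primKernel_of_gt {x t : ℝ} (ht : 1 < t) : primKernel x t = (Ici t).indicator 1 x := by
  have h2 : t ∉ Ioc x 1 := fun h => absurd h.2 (not_le.2 ht)
  rw [primKernel, indicator_of_notMem h2, sub_zero]
  by_cases h : t ≤ x
  · rw [indicator_of_mem (show t ∈ Ioc 1 x from ⟨ht, h⟩), indicator_of_mem (show x ∈ Ici t from h)]
    rfl
  · rw [indicator_of_notMem (fun h' => h h'.2), indicator_of_notMem (show x ∉ Ici t from h)]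

theorem primKernel_of_le {x t : ℝ} (ht : t ≤ 1) : primKernel x t = -(Iio t).indicator 1 x := by
  have h2 : t ∉ Ioc 1 x := fun h => absurd h.1 (not_lt.2 ht)
  rw [primKernel, indicator_of_notMem h2, zero_sub]
  by_cases h : x < t
  · rw [indicator_of_mem (show t ∈ Ioc x 1 from ⟨h, ht⟩), indicator_of_mem (show x ∈ Iio t from h)]
    rfl
  · rw [indicator_of_notMem (fun h' => h h'.1), indicator_of_notMem (show x ∉ Iio t from h)]

theorem abs_primKernel_le (x t : ℝ) : |primKernel x t| ≤ 1 := by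
  rcases le_or_gt t 1 with h | h
  · rw [primKernel_of_le h, abs_neg, indicator_apply]
    split_ifs <;> simp
  · rw [primKernel_of_gt h, indicator_apply]
    split_ifs <;> simp

theorem measurable_primKernel : Measurable (Function.uncurry primKernel) := by
  have h1 : MeasurableSet {z : ℝ × ℝ | z.2 ∈ Ioc 1 z.1} :=
    (measurableSet_lt measurable_const measurable_snd).inter
      (measurableSet_le measurable_snd measurable_fst)
  have h2 : MeasurableSet {z : ℝ × ℝ | z.2 ∈ Ioc z.1 1} :=
    (measurableSet_lt measurable_fst measurable_snd).inter
      (measurableSet_le measurable_snd measurable_const)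
  exact (Measurable.ite h1 measurable_const measurable_const).sub
    (Measurable.ite h2 measurable_const measurable_const)

theorem integral_primKernel_mul {h : ℝ → ℂ} (hh : LocallyIntegrableOn h (Ioi (0 : ℝ))) {x : ℝ}
    (hx : 0 < x) : ∫ t in Ioi (0 : ℝ), (primKernel x t : ℂ) * h t = ∫ t in (1 : ℝ)..x, h t := by
  have hi := intervalIntegrable_of_locallyIntegrableOn_Ioi hh one_pos hx
  have e : ∀ t, (primKernel x t : ℂ) * h t =
      (Ioc 1 x).indicator h t - (Ioc x 1).indicator h t := by
    intro t
    simp only [primKernel, indicator_apply]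
    split_ifs <;> simp
  simp only [e]
  have s1 : Ioi (0 : ℝ) ∩ Ioc 1 x = Ioc 1 x :=
    inter_eq_right.2 fun t ht => one_pos.trans ht.1
  have s2 : Ioi (0 : ℝ) ∩ Ioc x 1 = Ioc x 1 := inter_eq_right.2 fun t ht => hx.trans ht.1
  rw [integral_sub, setIntegral_indicator measurableSet_Ioc,
    setIntegral_indicator measurableSet_Ioc, s1, s2, intervalIntegral]
  · rw [integrable_indicator_iff measurableSet_Ioc, IntegrableOn,
      Measure.restrict_restrict measurableSet_Ioc, inter_comm, s1]
    exact hi.1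
  · rw [integrable_indicator_iff measurableSet_Ioc, IntegrableOn,
      Measure.restrict_restrict measurableSet_Ioc, inter_comm, s2]
    exact hi.2

/-- For t ≤ 1 the kernel selects (0, t), where integrating x^j gains one power of t. For t > 1 it
selects [t, ∞), where part of the rate μ is spent on e^{-μ't} and the rest keeps the integral
finite. -/
theorem integral_abs_mul_primKernel_le {θ : ℝ → ℝ} {C μ μ' : ℝ} {j : ℕ} (hC : 0 ≤ C) (hμ' : 0 < μ')
    (hμ : μ' < μ) (hθm : Measurable θ) (hθ : ∀ x, 0 < x → |θ x| ≤ C * (x ^ j * Real.exp (-(μ * x))))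
    {t : ℝ} (ht : 0 < t) : ∫ x in Ioi (0 : ℝ), |θ x * primKernel x t| ≤
      (C * ((∫ x in Ioi (0 : ℝ), x ^ j * Real.exp (-((μ - μ') * x))) + Real.exp μ')) *
        (t ^ (j + 1) * Real.exp (-(μ' * t))) := by
  set K := ∫ x in Ioi (0 : ℝ), x ^ j * Real.exp (-((μ - μ') * x)) with hK
  have hK0 : 0 ≤ K := setIntegral_nonneg measurableSet_Ioi fun x (hx : 0 < x) => by positivity
  have hθi : IntegrableOn (fun x => C * (x ^ j * Real.exp (-(μ * x)))) (Ioi 0) :=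
    (integrableOn_pow_mul_exp (hμ'.trans hμ) j).const_mul C
  have hli : IntegrableOn (fun x => |θ x * primKernel x t|) (Ioi 0) := by
    refine hθi.mono' (Measurable.aestronglyMeasurable ?_) ?_
    · exact (hθm.mul (measurable_primKernel.comp (measurable_id.prodMk measurable_const))).abs
    · filter_upwards [ae_restrict_mem measurableSet_Ioi] with x hx
      rw [Real.norm_of_nonneg (abs_nonneg _), abs_mul]
      exact (mul_le_of_le_one_right (abs_nonneg _) (abs_primKernel_le x t)).trans (hθ x hx)
  rcases le_or_gt t 1 with h1 | h1
  · calc _ ≤ ∫ x in Ioi (0 : ℝ), (Ioo 0 t).indicator (fun _ => C * t ^ j) x := by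
          refine setIntegral_mono_on hli ?_ measurableSet_Ioi fun x hx => ?_
          · rw [IntegrableOn, integrable_indicator_iff measurableSet_Ioo, IntegrableOn,
              Measure.restrict_restrict measurableSet_Ioo]
            refine integrableOn_const ?_
            refine ((measure_mono inter_subset_left).trans_lt ?_).ne
            simp
          · have hx : 0 < x := hx
            rw [primKernel_of_le h1]
            by_cases h : x < t
            · rw [indicator_of_mem (show x ∈ Iio t from h),
                indicator_of_mem (show x ∈ Ioo 0 t from ⟨hx, h⟩)]
              simp only [Pi.one_apply, mul_neg, mul_one, abs_neg]
              refine (hθ x hx).trans (mul_le_mul_of_nonneg_left ?_ hC)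
              refine (mul_le_of_le_one_right (by positivity) ?_).trans (by gcongr)
              rw [Real.exp_le_one_iff]
              have := mul_pos (hμ'.trans hμ) hx
              linarith
            · rw [indicator_of_notMem (show x ∉ Iio t from h),
                indicator_of_notMem (fun h' => h h'.2)]
              simp
      _ = C * t ^ (j + 1) := by
          rw [setIntegral_indicator measurableSet_Ioo, inter_eq_right.2 Ioo_subset_Ioi_self,
            setIntegral_const]
          simp only [measureReal_def, Real.volume_Ioo, sub_zero, ENNReal.toReal_ofReal ht.le,
            smul_eq_mul]
          ring
      _ ≤ (C * Real.exp μ') * (t ^ (j + 1) * Real.exp (-(μ' * t))) := by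
          have : 1 ≤ Real.exp μ' * Real.exp (-(μ' * t)) := by
            rw [← Real.exp_add, Real.one_le_exp_iff]
            nlinarith
          nlinarith [mul_le_mul_of_nonneg_left this (show 0 ≤ C * t ^ (j + 1) by positivity)]
      _ ≤ _ := by
          have := Real.exp_pos (-(μ' * t))
          gcongr
          linarith
  · calc _ ≤ ∫ x in Ioi (0 : ℝ),
          C * Real.exp (-(μ' * t)) * (x ^ j * Real.exp (-((μ - μ') * x))) := by
          refine setIntegral_mono_on hli ?_ measurableSet_Ioi fun x hx => ?_
          · exact (integrableOn_pow_mul_exp (sub_pos.2 hμ) j).const_mul _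
          · have hx : 0 < x := hx
            rw [primKernel_of_gt h1]
            by_cases h : t ≤ x
            · rw [indicator_of_mem (show x ∈ Ici t from h)]
              simp only [Pi.one_apply, mul_one]
              refine (hθ x hx).trans ?_
              have : Real.exp (-(μ * x)) ≤
                  Real.exp (-(μ' * t)) * Real.exp (-((μ - μ') * x)) := by
                rw [← Real.exp_add, Real.exp_le_exp]
                nlinarith
              calc _ ≤ C * (x ^ j * (Real.exp (-(μ' * t)) * Real.exp (-((μ - μ') * x)))) := by
                    gcongr
                _ = _ := by ring
            · rw [indicator_of_notMem (show x ∉ Ici t from h)]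
              simp only [mul_zero, abs_zero]
              positivity
      _ = C * K * Real.exp (-(μ' * t)) := by rw [integral_const_mul]; ring
      _ ≤ C * K * (t ^ (j + 1) * Real.exp (-(μ' * t))) := by
          refine mul_le_mul_of_nonneg_left ?_ (by positivity)
          exact le_mul_of_one_le_left (Real.exp_pos _).le (one_le_pow₀ h1.le)
      _ ≤ _ := by
          have := Real.exp_pos μ'
          gcongr
          linarith

/-- Fubini's theorem for a primitive `W` of `h` on `(0, ∞)` against `θ`. -/
theorem integrable_mul_primKernel_mul {θ : ℝ → ℝ} {C μ μ' : ℝ} {j : ℕ} (hC : 0 ≤ C) (hμ' : 0 < μ')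
    (hμ : μ' < μ) (hθm : Measurable θ) (hθ : ∀ x, 0 < x → |θ x| ≤ C * (x ^ j * Real.exp (-(μ * x))))
    {h : ℝ → ℂ} (hhm : AEStronglyMeasurable h (volume.restrict (Ioi (0 : ℝ))))
    (hh : IntegrableOn (fun t => ((t ^ (j + 1) * Real.exp (-(μ' * t)) : ℝ) : ℂ) * h t)
      (Ioi (0 : ℝ))) :
    Integrable (fun z : ℝ × ℝ => ((θ z.1 * primKernel z.1 z.2 : ℝ) : ℂ) * h z.2)
      ((volume.restrict (Ioi (0 : ℝ))).prod (volume.restrict (Ioi (0 : ℝ)))) := by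
  set ν := volume.restrict (Ioi (0 : ℝ)) with hν
  have hmem : ∀ᵐ x ∂ν, x ∈ Ioi (0 : ℝ) := ae_restrict_mem measurableSet_Ioi
  have hκm : Measurable fun z : ℝ × ℝ => θ z.1 * primKernel z.1 z.2 :=
    (hθm.comp measurable_fst).mul measurable_primKernel
  have hmeas : AEStronglyMeasurable
      (fun z : ℝ × ℝ => ((θ z.1 * primKernel z.1 z.2 : ℝ) : ℂ) * h z.2) (ν.prod ν) :=
    (Complex.measurable_ofReal.comp hκm).aestronglyMeasurable.mul hhm.comp_snd
  have hθi : Integrable (fun x => C * (x ^ j * Real.exp (-(μ * x)))) ν :=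
    (integrableOn_pow_mul_exp (hμ'.trans hμ) j).const_mul C
  rw [integrable_prod_iff' hmeas]
  constructor
  · refine Eventually.of_forall fun t => Integrable.mul_const (Integrable.ofReal
      (f := fun x => θ x * primKernel x t) ?_) (h t)
    refine hθi.mono' (hκm.comp (measurable_id.prodMk measurable_const)).aestronglyMeasurable ?_
    filter_upwards [hmem] with x hx
    rw [Real.norm_eq_abs, abs_mul]
    exact (mul_le_of_le_one_right (abs_nonneg _) (abs_primKernel_le x t)).trans (hθ x hx)
  · refine (hh.norm.const_mul (C * ((∫ x in Ioi (0 : ℝ), x ^ j * Real.exp (-((μ - μ') * x))) +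
      Real.exp μ'))).mono' hmeas.norm.prod_swap.integral_prod_right' ?_
    filter_upwards [hmem] with t ht
    have ht : 0 < t := ht
    have e : ∀ x, ‖((θ x * primKernel x t : ℝ) : ℂ) * h t‖ = |θ x * primKernel x t| * ‖h t‖ :=
      fun x => by rw [norm_mul, Complex.norm_real, Real.norm_eq_abs]
    rw [Real.norm_of_nonneg (integral_nonneg fun x => norm_nonneg _)]
    simp only [e]
    rw [integral_mul_const, norm_mul, Complex.norm_real, Real.norm_of_nonneg (by positivity),
      ← mul_assoc]
    exact mul_le_mul_of_nonneg_right
      (integral_abs_mul_primKernel_le hC hμ' hμ hθm hθ ht) (norm_nonneg _)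

theorem integrableOn_primitive_mul {θ : ℝ → ℝ} {C μ μ' : ℝ} {j : ℕ} (hC : 0 ≤ C) (hμ' : 0 < μ')
    (hμ : μ' < μ) (hθm : Measurable θ) (hθ : ∀ x, 0 < x → |θ x| ≤ C * (x ^ j * Real.exp (-(μ * x))))
    {h W : ℝ → ℂ} (hhl : LocallyIntegrableOn h (Ioi (0 : ℝ)))
    (hW : ∀ x, 0 < x → W x = W 1 + ∫ t in (1 : ℝ)..x, h t)
    (hh : IntegrableOn (fun t => ((t ^ (j + 1) * Real.exp (-(μ' * t)) : ℝ) : ℂ) * h t)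
      (Ioi (0 : ℝ))) :
    IntegrableOn (fun x => (θ x : ℂ) * W x) (Ioi (0 : ℝ)) ∧
      ∫ x in Ioi (0 : ℝ), (θ x : ℂ) * W x = (∫ x in Ioi (0 : ℝ), (θ x : ℂ)) * W 1 +
        ∫ t in Ioi (0 : ℝ), ((∫ x in Ioi (0 : ℝ), θ x * primKernel x t : ℝ) : ℂ) * h t := by
  have hint := integrable_mul_primKernel_mul hC hμ' hμ hθm hθ hhl.aestronglyMeasurable hh
  set ν := volume.restrict (Ioi (0 : ℝ)) with hν
  have hmem : ∀ᵐ x ∂ν, x ∈ Ioi (0 : ℝ) := ae_restrict_mem measurableSet_Ioi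
  have hθi : Integrable θ ν := by
    refine Integrable.mono' ((integrableOn_pow_mul_exp (hμ'.trans hμ) j).const_mul C)
      hθm.aestronglyMeasurable ?_
    filter_upwards [hmem] with x hx using hθ x hx
  have e : (fun x => (θ x : ℂ) * W 1 + ∫ t, ((θ x * primKernel x t : ℝ) : ℂ) * h t ∂ν) =ᵐ[ν]
      fun x => (θ x : ℂ) * W x := by
    filter_upwards [hmem] with x hx
    rw [hW x hx, ← integral_primKernel_mul hhl hx, mul_add, ← integral_const_mul]
    congr 1
    refine integral_congr_ae (Eventually.of_forall fun t => ?_)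
    push_cast; ring
  have h1 : Integrable (fun x => (θ x : ℂ) * W 1) ν := hθi.ofReal.mul_const _
  have h2 : Integrable (fun x => ∫ t, ((θ x * primKernel x t : ℝ) : ℂ) * h t ∂ν) ν :=
    hint.integral_prod_left
  refine ⟨(h1.add h2).congr e, ?_⟩
  rw [← integral_congr_ae e, integral_add h1 h2, integral_mul_const]
  congr 1
  rw [integral_integral_swap (f := fun x t => ((θ x * primKernel x t : ℝ) : ℂ) * h t) hint]
  refine integral_congr_ae (Eventually.of_forall fun t => ?_)
  simp only
  rw [integral_mul_const, integral_complex_ofReal]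

/-- The hypotheses say that Φ is a primitive of θ vanishing at both ends, so both cases of the
kernel give the same value. -/
theorem integral_mul_primKernel {θ Φ : ℝ → ℝ} {t : ℝ} (ht : 0 < t)
    (h1 : ∫ x in Ioc 0 t, θ x = Φ t) (h2 : ∫ x in Ioi t, θ x = -Φ t) :
    ∫ x in Ioi (0 : ℝ), θ x * primKernel x t = -Φ t := by
  rcases le_or_gt t 1 with h | h
  · simp only [primKernel_of_le h]
    have e : ∀ x, θ x * -(Iio t).indicator 1 x = (Iio t).indicator (fun x => -θ x) x := by
      intro x
      simp only [indicator_apply]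
      split_ifs <;> simp
    have hs : Ioi (0 : ℝ) ∩ Iio t = Ioo 0 t := rfl
    simp only [e]
    rw [setIntegral_indicator measurableSet_Iio, hs, integral_neg, ← integral_Ioc_eq_integral_Ioo,
      h1]
  · simp only [primKernel_of_gt h]
    have e : ∀ x, θ x * (Ici t).indicator 1 x = (Ici t).indicator θ x := by
      intro x
      simp only [indicator_apply]
      split_ifs <;> simp
    have hs : Ici t ⊆ Ioi 0 := fun x hx => ht.trans_le hx
    simp only [e]
    rw [setIntegral_indicator measurableSet_Ici,
      inter_eq_right.2 hs, integral_Ici_eq_integral_Ioi, h2]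

theorem exists_abs_eval_mul_exp_le (c : ℝ[X]) {r : ℝ} (hr : 0 < r) :
    ∃ C, 0 ≤ C ∧ ∀ x, 0 < x → |c.eval x| * Real.exp (-(r * x)) ≤ C := by
  induction c using Polynomial.induction_on' with
  | add p q hp hq =>
    obtain ⟨C, hC, h⟩ := hp
    obtain ⟨D, hD, h'⟩ := hq
    refine ⟨C + D, by positivity, fun x hx => ?_⟩
    rw [eval_add]
    nlinarith [h x hx, h' x hx, abs_add_le (p.eval x) (q.eval x), Real.exp_pos (-(r * x))]
  | monomial n a =>
    refine ⟨|a| * (n.factorial / r ^ n), by positivity, fun x hx => ?_⟩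
    rw [eval_monomial, abs_mul, abs_of_nonneg (show 0 ≤ x ^ n by positivity), mul_assoc]
    refine mul_le_mul_of_nonneg_left ?_ (abs_nonneg a)
    have h := Real.pow_div_factorial_le_exp (r * x) (by positivity) n
    rw [Real.exp_neg, ← div_eq_mul_inv, div_le_div_iff₀ (Real.exp_pos _) (by positivity)]
    rw [div_le_iff₀ (by positivity), mul_pow] at h
    linarith

theorem tendsto_eval_mul_exp_atTop (q : ℝ[X]) {r : ℝ} (hr : 0 < r) :
    Tendsto (fun x => q.eval x * Real.exp (-(r * x))) atTop (𝓝 0) := by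
  obtain ⟨C, hC, h⟩ := exists_abs_eval_mul_exp_le q (half_pos hr)
  have h1 : Tendsto (fun x : ℝ => C * Real.exp (-(r / 2 * x))) atTop (𝓝 (C * 0)) := by
    refine Tendsto.const_mul _ (Real.tendsto_exp_neg_atTop_nhds_zero.comp ?_)
    exact tendsto_id.const_mul_atTop (half_pos hr)
  rw [mul_zero] at h1
  refine squeeze_zero_norm' ?_ h1
  filter_upwards [eventually_gt_atTop 0] with x hx
  have e : Real.exp (-(r * x)) = Real.exp (-(r / 2 * x)) * Real.exp (-(r / 2 * x)) := by
    rw [← Real.exp_add]; congr 1; ring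
  rw [norm_mul, Real.norm_eq_abs, Real.norm_of_nonneg (Real.exp_pos _).le, e, ← mul_assoc]
  exact mul_le_mul_of_nonneg_right (h x hx) (Real.exp_pos _).le

theorem hasDerivAt_eval_mul_exp (lam : ℝ) (q : ℝ[X]) (x : ℝ) :
    HasDerivAt (fun x => q.eval x * Real.exp (-(2 * lam * x)))
      (-(expDual lam q).eval x * Real.exp (-(2 * lam * x))) x := by
  have h1 : HasDerivAt (fun x : ℝ => Real.exp (-(2 * lam * x)))
      (Real.exp (-(2 * lam * x)) * (-(2 * lam * 1))) x :=
    (((hasDerivAt_id x).const_mul (2 * lam)).neg).exp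
  have := (q.hasDerivAt x).mul h1
  refine this.congr_deriv ?_
  rw [expDual_apply, eval_sub, eval_smul, smul_eq_mul]
  ring

theorem integral_expDual_Ioc {lam : ℝ} (q : ℝ[X]) (hq : q.eval 0 = 0) {t : ℝ} (ht : 0 < t) :
    ∫ x in Ioc 0 t, -(expDual lam q).eval x * Real.exp (-(2 * lam * x)) =
      q.eval t * Real.exp (-(2 * lam * t)) := by
  rw [← intervalIntegral.integral_of_le ht.le, intervalIntegral.integral_eq_sub_of_hasDerivAt
    (fun x _ => hasDerivAt_eval_mul_exp lam q x) (Continuous.intervalIntegrable (by fun_prop) _ _),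
    hq]
  ring

theorem integrableOn_expDual {lam : ℝ} (hl : 0 < lam) (q : ℝ[X]) :
    IntegrableOn (fun x => -(expDual lam q).eval x * Real.exp (-(2 * lam * x))) (Ioi 0) := by
  simp only [neg_mul]
  exact (integrableOn_eval_mul_exp (by positivity) (expDual lam q)).neg

theorem integral_expDual_Ioi {lam : ℝ} (hl : 0 < lam) (q : ℝ[X]) {t : ℝ} (ht : 0 < t) :
    ∫ x in Ioi t, -(expDual lam q).eval x * Real.exp (-(2 * lam * x)) =
      -(q.eval t * Real.exp (-(2 * lam * t))) := by
  rw [integral_Ioi_of_hasDerivAt_of_tendsto' (fun x _ => hasDerivAt_eval_mul_exp lam q x)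
    ((integrableOn_expDual hl q).mono_set (Ioi_subset_Ioi ht.le))
    (tendsto_eval_mul_exp_atTop q (by positivity)), zero_sub]

/-- The weighted integrability of the members of a chain that makes all boundary terms vanish in
the integration by parts. -/
def ExpIntegrable (lam : ℝ) (j : ℕ) (W : ℝ → ℂ) : Prop :=
  ∀ μ, lam < μ → IntegrableOn (fun t => ((t ^ j * Real.exp (-(μ * t)) : ℝ) : ℂ) * W t)
    (Ioi (0 : ℝ))

/-- A primitive needs one power of t less in the weight and a slightly larger rate. As every rate
above λ is allowed, the class is stable under this loss. -/
theorem IsACChain.expIntegrable {m : ℕ} {w : ℕ → ℝ → ℂ} (hw : IsACChain m w) {lam : ℝ}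
    (hl : 0 < lam) {j : ℕ} (hj : j < m) (h : ExpIntegrable lam (j + 1) (w (j + 1))) :
    ExpIntegrable lam j (w j) := by
  intro μ hμ
  refine (integrableOn_primitive_mul (C := 1) (μ := μ) (μ' := (lam + μ) / 2)
    (θ := fun t => t ^ j * Real.exp (-(μ * t))) zero_le_one (by linarith) (by linarith)
    (by fun_prop) (fun x hx => ?_) (hw j hj).1
    (fun x hx => hw.eq_add_integral hj one_pos hx) (h _ (by linarith))).1
  rw [abs_of_nonneg (by positivity), one_mul]

/-- Integration by parts against `e^{-2 lam x} q(x)`. -/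
theorem IsACChain.integral_mul_expDual {m : ℕ} {w : ℕ → ℝ → ℂ} (hw : IsACChain m w) {lam : ℝ}
    (hl : 0 < lam) {j : ℕ} (hj : j < m) (h : ExpIntegrable lam (j + 1) (w (j + 1))) {q : ℝ[X]}
    (hq : X ^ (j + 1) ∣ q) :
    ∫ x in Ioi (0 : ℝ), (((expDual lam q).eval x * Real.exp (-(2 * lam * x)) : ℝ) : ℂ) * w j x =
      ∫ x in Ioi (0 : ℝ), ((q.eval x * Real.exp (-(2 * lam * x)) : ℝ) : ℂ) * w (j + 1) x := by
  have hq0 : q.eval 0 = 0 := by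
    obtain ⟨c, rfl⟩ := hq
    simp
  obtain ⟨c, hc⟩ : X ^ j ∣ expDual lam q := by
    obtain ⟨c, rfl⟩ := hq
    simpa using X_pow_dvd_expDual_pow lam c 1 j
  -- Of the rate 2λ, the part λ/2 absorbs the polynomial c, leaving μ = 3λ/2. Any μ' strictly
  -- between λ and μ would do; 5λ/4 is taken.
  obtain ⟨C, hC, hb⟩ := exists_abs_eval_mul_exp_le c (r := lam / 2) (by positivity)
  set θ : ℝ → ℝ := fun x => -(expDual lam q).eval x * Real.exp (-(2 * lam * x)) with hθ
  have key := (integrableOn_primitive_mul (θ := θ) (C := C) (μ := 3 / 2 * lam) (μ' := 5 / 4 * lam)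
    (j := j) hC (by positivity) (by linarith) (by fun_prop) (fun x hx => ?_) (hw j hj).1
    (fun x hx => hw.eq_add_integral hj one_pos hx) (h _ (by linarith))).2
  -- θ is the derivative of e^{-2λx} q, which vanishes at 0 and at infinity. So the constant w j 1
  -- in the primitive drops out, and no limit of w j is needed.
  · have hθ0 : ∫ x in Ioi (0 : ℝ), (θ x : ℂ) = 0 := by
      rw [integral_complex_ofReal]
      have hu : Ioi (0 : ℝ) = Ioc 0 1 ∪ Ioi 1 := (Ioc_union_Ioi_eq_Ioi zero_le_one).symm
      have hi := integrableOn_expDual hl q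
      rw [hu] at hi ⊢
      rw [setIntegral_union (Ioc_disjoint_Ioi le_rfl) measurableSet_Ioi
        (hi.mono_set subset_union_left) (hi.mono_set subset_union_right),
        integral_expDual_Ioc q hq0 one_pos, integral_expDual_Ioi hl q one_pos]
      simp
    rw [hθ0, zero_mul, zero_add] at key
    have e1 : ∫ x in Ioi (0 : ℝ), (((expDual lam q).eval x * Real.exp (-(2 * lam * x)) : ℝ) : ℂ) *
        w j x = -∫ x in Ioi (0 : ℝ), (θ x : ℂ) * w j x := by
      rw [← integral_neg]
      refine integral_congr_ae (Eventually.of_forall fun x => ?_)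
      simp only [hθ]
      push_cast; ring
    rw [e1, key, ← integral_neg]
    refine setIntegral_congr_fun measurableSet_Ioi fun t ht => ?_
    rw [integral_mul_primKernel (Φ := fun t => q.eval t * Real.exp (-(2 * lam * t)))
      ht (integral_expDual_Ioc q hq0 ht) (integral_expDual_Ioi hl q ht)]
    push_cast; ring
  · have e : Real.exp (-(2 * lam * x)) =
        Real.exp (-(lam / 2 * x)) * Real.exp (-(3 / 2 * lam * x)) := by
      rw [← Real.exp_add]; congr 1; ring
    rw [hθ, abs_mul, abs_of_pos (Real.exp_pos _), abs_neg, hc, eval_mul, eval_pow, eval_X, abs_mul,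
      abs_of_nonneg (pow_nonneg hx.le j), e]
    have := mul_le_mul_of_nonneg_right (hb x hx)
      (show 0 ≤ x ^ j * Real.exp (-(3 / 2 * lam * x)) by positivity)
    linarith

theorem IsACChain.integral_mul_expDual_pow {m : ℕ} {w : ℕ → ℝ → ℂ} (hw : IsACChain m w) {lam : ℝ}
    (hl : 0 < lam) (h : ExpIntegrable lam m (w m)) (q : ℝ[X]) :
    ∫ x in Ioi (0 : ℝ), ((((expDual lam ^ m) (X ^ m * q)).eval x *
        Real.exp (-(2 * lam * x)) : ℝ) : ℂ) * w 0 x =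
      ∫ x in Ioi (0 : ℝ), (((X ^ m * q).eval x * Real.exp (-(2 * lam * x)) : ℝ) : ℂ) * w m x := by
  have hI : ∀ i ≤ m, ExpIntegrable lam (m - i) (w (m - i)) := by
    intro i
    induction i with
    | zero => intro _; simpa using h
    | succ i ih =>
      intro hi
      refine hw.expIntegrable hl (by omega) ?_
      rw [show m - (i + 1) + 1 = m - i by omega]
      exact ih (by omega)
  have key : ∀ i ≤ m, ∫ x in Ioi (0 : ℝ), ((((expDual lam ^ m) (X ^ m * q)).eval x *
        Real.exp (-(2 * lam * x)) : ℝ) : ℂ) * w 0 x =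
      ∫ x in Ioi (0 : ℝ), ((((expDual lam ^ (m - i)) (X ^ m * q)).eval x *
        Real.exp (-(2 * lam * x)) : ℝ) : ℂ) * w i x := by
    intro i
    induction i with
    | zero => intro _; rfl
    | succ i ih =>
      intro hi
      have hd := X_pow_dvd_expDual_pow lam q (m - (i + 1)) (i + 1)
      rw [show i + 1 + (m - (i + 1)) = m by omega] at hd
      have hI' := hI (m - (i + 1)) (by omega)
      rw [show m - (m - (i + 1)) = i + 1 by omega] at hI'
      rw [ih (by omega), ← hw.integral_mul_expDual hl (by omega) hI' hd,
        show m - i = (m - (i + 1)) + 1 by omega, pow_succ', Module.End.mul_apply]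
  rw [key m le_rfl]
  simp

/-! ### Determination by moments -/

/-- Two finite measures on `ℝ` with exponential moments are equal if their moments are. -/
theorem measure_eq_of_moments_eq {P Q : Measure ℝ} [IsFiniteMeasure P] [IsFiniteMeasure Q] {ε : ℝ}
    (hε : 0 < ε) (hP : ∀ t ∈ Ioo (-ε) ε, Integrable (fun x => Real.exp (t * x)) P)
    (hQ : ∀ t ∈ Ioo (-ε) ε, Integrable (fun x => Real.exp (t * x)) Q)
    (h : ∀ n : ℕ, ∫ x, x ^ n ∂P = ∫ x, x ^ n ∂Q) : P = Q := by
  have iP : Ioo (-ε) ε ⊆ interior (ProbabilityTheory.integrableExpSet id P) :=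
    interior_maximal (fun t ht => hP t ht) isOpen_Ioo
  have iQ : Ioo (-ε) ε ⊆ interior (ProbabilityTheory.integrableExpSet id Q) :=
    interior_maximal (fun t ht => hQ t ht) isOpen_Ioo
  -- Both complex moment generating functions are analytic on this strip and have the moments as
  -- derivatives at 0. By the identity theorem they agree on the imaginary axis, where they are the
  -- characteristic functions.
  let S : Set ℂ := Complex.reLm ⁻¹' Ioo (-ε) ε
  have hS : IsPreconnected S := ((convex_Ioo (-ε) ε).linear_preimage Complex.reLm).isPreconnected
  have aP : AnalyticOnNhd ℂ (ProbabilityTheory.complexMGF id P) S := fun z hz =>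
    ProbabilityTheory.analyticAt_complexMGF (iP hz)
  have aQ : AnalyticOnNhd ℂ (ProbabilityTheory.complexMGF id Q) S := fun z hz =>
    ProbabilityTheory.analyticAt_complexMGF (iQ hz)
  have h0 : (0 : ℂ) ∈ S := by simp [S, hε]
  have h0' : (0 : ℂ).re ∈ Ioo (-ε) ε := h0
  have hder : ∀ n, iteratedDeriv n (ProbabilityTheory.complexMGF id P) 0 =
      iteratedDeriv n (ProbabilityTheory.complexMGF id Q) 0 := by
    intro n
    rw [ProbabilityTheory.iteratedDeriv_complexMGF (iP h0'),
      ProbabilityTheory.iteratedDeriv_complexMGF (iQ h0')]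
    have e : ∀ ρ : Measure ℝ, ∫ x, ((id x : ℝ) : ℂ) ^ n * Complex.exp (0 * ((id x : ℝ) : ℂ)) ∂ρ =
        ((∫ x, x ^ n ∂ρ : ℝ) : ℂ) := by
      intro ρ
      rw [← integral_complex_ofReal]
      simp
    rw [e, e, h]
  have hev : ProbabilityTheory.complexMGF id P =ᶠ[𝓝 0] ProbabilityTheory.complexMGF id Q := by
    have h1 := (aP 0 h0).hasFPowerSeriesAt
    have h2 := (aQ 0 h0).hasFPowerSeriesAt
    simp only [hder] at h1
    have := (h1.sub h2)
    rw [sub_self] at this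
    filter_upwards [this.eventually_eq_zero] with z hz
    exact sub_eq_zero.1 hz
  have hon := aP.eqOn_of_preconnected_of_eventuallyEq aQ hS h0 hev
  refine Measure.ext_of_charFun ?_
  ext t
  rw [← ProbabilityTheory.complexMGF_id_mul_I, ← ProbabilityTheory.complexMGF_id_mul_I]
  exact hon (by simp [S, hε])

theorem integrable_withDensity_ofReal {ν : Measure ℝ} {η g : ℝ → ℝ}
    (hη : AEStronglyMeasurable η ν) (hg : Measurable g) (h : Integrable (fun x => η x * g x) ν) :
    Integrable g (ν.withDensity fun x => ENNReal.ofReal (η x)) := by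
  rw [integrable_withDensity_iff_integrable_smul₀' hη.aemeasurable.ennreal_ofReal (by simp)]
  refine h.mono (AEStronglyMeasurable.mul ?_ hg.aestronglyMeasurable)
    (Eventually.of_forall fun x => ?_)
  · exact hη.aemeasurable.ennreal_ofReal.ennreal_toReal.aestronglyMeasurable
  · rw [smul_eq_mul, norm_mul, norm_mul, Real.norm_of_nonneg ENNReal.toReal_nonneg,
      ENNReal.toReal_ofReal']
    refine mul_le_mul_of_nonneg_right ?_ (norm_nonneg _)
    exact max_le (le_abs_self _) (norm_nonneg _)

theorem integral_withDensity_ofReal {ν : Measure ℝ} {η : ℝ → ℝ} (hη : AEStronglyMeasurable η ν)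
    (g : ℝ → ℝ) : ∫ x, g x ∂(ν.withDensity fun x => ENNReal.ofReal (η x)) =
      ∫ x, max (η x) 0 * g x ∂ν := by
  rw [integral_withDensity_eq_integral_toReal_smul₀ hη.aemeasurable.ennreal_ofReal (by simp)]
  simp only [ENNReal.toReal_ofReal', smul_eq_mul]

/-- A function on `(0, ∞)` with exponential decay in the mean and zero moments vanishes. -/
theorem ae_eq_zero_of_integral_pow_mul_eq_zero {η : ℝ → ℝ} {ε : ℝ} (hε : 0 < ε)
    (hi : IntegrableOn (fun x => η x * Real.exp (ε * x)) (Ioi 0))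
    (h : ∀ n : ℕ, ∫ x in Ioi (0 : ℝ), η x * x ^ n = 0) :
    η =ᵐ[volume.restrict (Ioi (0 : ℝ))] 0 := by
  set ν := volume.restrict (Ioi (0 : ℝ)) with hν
  have hmem : ∀ᵐ x ∂ν, x ∈ Ioi (0 : ℝ) := ae_restrict_mem measurableSet_Ioi
  have hm : AEStronglyMeasurable η ν := by
    have h1 : AEStronglyMeasurable (fun x => η x * Real.exp (ε * x) * Real.exp (-(ε * x))) ν :=
      hi.aestronglyMeasurable.mul (Measurable.aestronglyMeasurable (by fun_prop))
    refine h1.congr (Eventually.of_forall fun x => ?_)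
    simp only
    rw [mul_assoc, ← Real.exp_add, add_neg_cancel, Real.exp_zero, mul_one]
  have hexp : ∀ t ≤ ε, Integrable (fun x => η x * Real.exp (t * x)) ν := by
    intro t ht
    refine Integrable.mono hi (hm.mul (show Measurable fun x => Real.exp (t * x) by fun_prop).aestronglyMeasurable) ?_
    filter_upwards [hmem] with x hx
    have hx : 0 < x := hx
    rw [norm_mul, norm_mul, Real.norm_of_nonneg (Real.exp_pos _).le,
      Real.norm_of_nonneg (Real.exp_pos _).le]
    gcongr
  have hpow : ∀ n : ℕ, Integrable (fun x => η x * x ^ n) ν := by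
    intro n
    obtain ⟨C, hC, hb⟩ := exists_abs_eval_mul_exp_le (X ^ n) hε
    refine (hi.const_mul C).mono (hm.mul (show Measurable fun x : ℝ => x ^ n by fun_prop).aestronglyMeasurable) ?_
    filter_upwards [hmem] with x hx
    have hx : 0 < x := hx
    have h1 := hb x hx
    rw [eval_pow, eval_X, abs_of_pos (by positivity), Real.exp_neg, ← div_eq_mul_inv,
      div_le_iff₀ (Real.exp_pos _)] at h1
    rw [norm_mul, norm_mul, norm_mul, Real.norm_of_nonneg (Real.exp_pos _).le,
      Real.norm_of_nonneg hC, Real.norm_of_nonneg (show 0 ≤ x ^ n by positivity)]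
    nlinarith [mul_le_mul_of_nonneg_left h1 (norm_nonneg (η x))]
  have hm' : AEStronglyMeasurable (fun x => -η x) ν := hm.neg
  have hη : Integrable η ν := by simpa using hexp 0 hε.le
  have hfin : ∀ σ : ℝ → ℝ, Integrable σ ν →
      IsFiniteMeasure (ν.withDensity fun x => ENNReal.ofReal (σ x)) := fun σ hσ =>
    isFiniteMeasure_withDensity_ofReal hσ.2
  have := hfin η hη
  have := hfin (fun x => -η x) hη.neg
  -- These are the measures with the positive and the negative part of η as densities; zero moments
  -- of η mean that their moments agree.
  have key : ν.withDensity (fun x => ENNReal.ofReal (η x)) =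
      ν.withDensity (fun x => ENNReal.ofReal (-η x)) := by
    refine measure_eq_of_moments_eq hε (fun t ht => ?_) (fun t ht => ?_) fun n => ?_
    · exact integrable_withDensity_ofReal hm (by fun_prop) (hexp t ht.2.le)
    · refine integrable_withDensity_ofReal hm' (by fun_prop) ?_
      exact (hexp t ht.2.le).neg.congr (Eventually.of_forall fun x => by simp)
    · rw [integral_withDensity_ofReal hm, integral_withDensity_ofReal hm', ← sub_eq_zero,
        ← integral_sub]
      · refine Eq.trans ?_ (h n)
        refine integral_congr_ae (Eventually.of_forall fun x => ?_)
        simp only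
        rw [← sub_mul]
        congr 1
        rcases le_total (η x) 0 with hx | hx
        · rw [max_eq_right hx, max_eq_left (by linarith)]; ring
        · rw [max_eq_left hx, max_eq_right (by linarith)]; ring
      · refine (hpow n).mono ((hm.sup aestronglyMeasurable_const).mul
          (show Measurable fun x : ℝ => x ^ n by fun_prop).aestronglyMeasurable) (Eventually.of_forall fun x => ?_)
        rw [norm_mul, norm_mul]
        refine mul_le_mul_of_nonneg_right ?_ (norm_nonneg _)
        rw [Real.norm_of_nonneg (le_max_right _ _)]
        exact max_le (le_abs_self _) (norm_nonneg _)
      · refine (hpow n).mono ((hm'.sup aestronglyMeasurable_const).mul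
          (show Measurable fun x : ℝ => x ^ n by fun_prop).aestronglyMeasurable) (Eventually.of_forall fun x => ?_)
        rw [norm_mul, norm_mul]
        refine mul_le_mul_of_nonneg_right ?_ (norm_nonneg _)
        rw [Real.norm_of_nonneg (le_max_right _ _)]
        exact max_le (neg_le_abs _) (norm_nonneg _)
  rw [withDensity_eq_iff hm.aemeasurable.ennreal_ofReal hm'.aemeasurable.ennreal_ofReal
    hη.lintegral_lt_top.ne] at key
  filter_upwards [key] with x hx
  rcases lt_trichotomy (η x) 0 with h0 | h0 | h0
  · rw [ENNReal.ofReal_of_nonpos h0.le, eq_comm, ENNReal.ofReal_eq_zero] at hx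
    linarith
  · exact h0
  · have h1 : ENNReal.ofReal (-η x) = 0 := ENNReal.ofReal_of_nonpos (by linarith)
    have hx' : ENNReal.ofReal (η x) = ENNReal.ofReal (-η x) := hx
    rw [h1, ENNReal.ofReal_eq_zero] at hx'
    linarith

/-- The functions `x ^ n e^{-lam x}` separate the points of the weighted space. -/
theorem MemWeightedL2.ae_eq_zero {s lam : ℝ} (hs : 0 ≤ s) (hl : 0 < lam) {v : ℝ → ℂ}
    (hv : MemWeightedL2 (-s) v)
    (h : ∀ n : ℕ, ∫ x in Ioi (0 : ℝ), v x * ((x ^ n * Real.exp (-lam * x) : ℝ) : ℂ) = 0) :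
    v =ᵐ[volume.restrict (Ioi (0 : ℝ))] 0 := by
  -- Half of the decay e^{-λx} makes v integrable; the other half is the exponential moment
  -- required, with ε = λ/2.
  have h2 : IntegrableOn (fun x => v x * ((Real.exp (-(lam / 2) * x) : ℝ) : ℂ)) (Ioi 0) := by
    have := hv.integrableOn_mul_expPoly hs (half_pos hl) 1
    simpa using this
  have hint : ∀ n : ℕ, IntegrableOn
      (fun x => v x * ((x ^ n * Real.exp (-lam * x) : ℝ) : ℂ)) (Ioi 0) := by
    intro n
    have := hv.integrableOn_mul_expPoly hs hl (X ^ n)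
    simpa using this
  have hexp : ∀ x, Real.exp (-lam * x) * Real.exp (lam / 2 * x) = Real.exp (-(lam / 2) * x) := by
    intro x; rw [← Real.exp_add]; congr 1; ring
  have hre := ae_eq_zero_of_integral_pow_mul_eq_zero (η := fun x => (v x).re * Real.exp (-lam * x))
    (half_pos hl) (by
      refine h2.re.congr (Eventually.of_forall fun x => ?_)
      simp only [RCLike.re_eq_complex_re, Complex.re_mul_ofReal, mul_assoc, hexp])
    (fun n => by
      have h3 := congrArg Complex.re (h n)
      have h4 := integral_re (𝕜 := ℂ) (hint n)
      simp only [RCLike.re_eq_complex_re] at h4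
      rw [← h4] at h3
      rw [Complex.zero_re] at h3
      refine Eq.trans ?_ h3
      refine integral_congr_ae (Eventually.of_forall fun x => ?_)
      simp only [Complex.re_mul_ofReal]
      ring)
  have him := ae_eq_zero_of_integral_pow_mul_eq_zero (η := fun x => (v x).im * Real.exp (-lam * x))
    (half_pos hl) (by
      refine h2.im.congr (Eventually.of_forall fun x => ?_)
      simp only [RCLike.im_eq_complex_im, Complex.im_mul_ofReal, mul_assoc, hexp])
    (fun n => by
      have h3 := congrArg Complex.im (h n)
      have h4 := integral_im (𝕜 := ℂ) (hint n)
      simp only [RCLike.im_eq_complex_im] at h4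
      rw [← h4] at h3
      rw [Complex.zero_im] at h3
      refine Eq.trans ?_ h3
      refine integral_congr_ae (Eventually.of_forall fun x => ?_)
      simp only [Complex.im_mul_ofReal]
      ring)
  filter_upwards [hre, him] with x h1 h2
  have h1' : (v x).re = 0 := by simpa [Real.exp_ne_zero] using h1
  have h2' : (v x).im = 0 := by simpa [Real.exp_ne_zero] using h2
  exact Complex.ext h1' h2'

/-! ### The Petrov–Galerkin solution as a projection -/

theorem rlIntegral_exp_mul_temperedIntegral {k : ℕ} (hk : 1 ≤ k) {s : ℝ} (hs : 0 ≤ s)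
    (hsk : s < k) {lam : ℝ} {f : ℝ → ℂ} {x : ℝ} (hx : 0 < x)
    (hF : IntegrableOn (fun y => (Real.exp (lam * y) : ℂ) * f y) (Ioc 0 x)) :
    rlIntegral (k - s) (fun y => (Real.exp (lam * y) : ℂ) * temperedIntegral s lam f y) x =
      rlIntegral k (fun y => (Real.exp (lam * y) : ℂ) * f y) x := by
  have hk' : (1 : ℝ) ≤ k := by exact_mod_cast hk
  rcases hs.eq_or_lt with rfl | hs
  · simp only [exp_mul_temperedIntegral_zero, sub_zero]
  · simp only [exp_mul_temperedIntegral hs.ne']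
    have := rlIntegral_rlIntegral (a := k - s) (b := s) (by linarith) hs (by linarith) hx hF
    rw [sub_add_cancel] at this
    exact this

/-- The elements of the trial space are tempered fractional integrals, also with their
derivatives. -/
theorem MemGLFSpace.exists_polynomial {k : ℕ} (hk : 1 ≤ k) {s : ℝ} (hs : (k : ℝ) - 1 ≤ s)
    (hsk : s < k) {lam : ℝ} (hl : 0 < lam) {N : ℕ} {w d : ℝ → ℂ} (hw : MemGLFSpace s lam N w)
    (hd : HasTemperedDeriv s lam w d) : MemWeightedL2 0 d ∧
      w =ᵐ[volume.restrict (Ioi (0 : ℝ))] temperedIntegral s lam d := by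
  have hk' : (1 : ℝ) ≤ k := by exact_mod_cast hk
  have hs0 : 0 ≤ s := by linarith
  have hfl := floor_add_one_eq hk hs hsk
  have hfl' : ((⌊s⌋₊ : ℝ) + 1) = k := by exact_mod_cast hfl
  obtain ⟨_, hder⟩ := hd
  rw [hfl, hfl'] at hder
  obtain ⟨q, hq, hwq⟩ := hw
  -- Inverting the diagonal map represents w as T(e^{-λx} P). Uniqueness of weak derivatives then
  -- identifies d with e^{-λx} P.
  set P := diagMap (fun n => ((gammaRatio s n : ℂ))⁻¹) q with hP
  set e : ℝ → ℂ := fun y => (Real.exp (-lam * y) : ℂ) * P.eval (y : ℂ) with he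
  have hP' : diagMap (fun n => (gammaRatio s n : ℂ)) P = q :=
    diagMap_diagMap_inv (fun n => by exact_mod_cast (gammaRatio_pos hs0 n).ne') q
  have he2 : MemWeightedL2 0 e := memWeightedL2_exp_mul_eval hl P
  have hwe : ∀ x, 0 < x → w x = temperedIntegral s lam e x := by
    intro x hx
    rw [hwq x hx, he, temperedIntegral_exp_mul_eval hs0 lam P hx, hP']
  have hF := fun x => he2.integrableOn_exp_mul (lam := lam) x
  have hae : (fun x => (Real.exp (lam * x) : ℂ) * d x) =ᵐ[volume.restrict (Ioi (0 : ℝ))]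
      fun x => (Real.exp (lam * x) : ℂ) * e x := by
    refine hder.unique (hasACDeriv_rlIntegral hF hk) ?_
    filter_upwards [ae_restrict_mem measurableSet_Ioi] with x hx
    rw [← rlIntegral_exp_mul_temperedIntegral hk hs0 hsk hx (hF x)]
    refine rlIntegral_congr hx ?_
    filter_upwards [ae_restrict_mem measurableSet_Ioi] with y hy
    rw [hwe y hy]
  have hde : e =ᵐ[volume.restrict (Ioi (0 : ℝ))] d := by
    filter_upwards [hae] with x hx
    have : (Real.exp (lam * x) : ℂ) ≠ 0 := by exact_mod_cast (Real.exp_pos _).ne'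
    exact (mul_left_cancel₀ this hx).symm
  refine ⟨he2.congr hde, ?_⟩
  filter_upwards [hde, ae_restrict_mem measurableSet_Ioi] with x hxe hx
  rw [hwe x hx]
  simp only [temperedIntegral]
  split_ifs with h0
  · exact hxe
  · congr 1
    refine rlIntegral_congr hx ?_
    filter_upwards [hde] with y hy
    rw [hy]

theorem weightedInner_eq_integral (a : ℝ) (u v : ℝ → ℂ) : weightedInner a u v =
    ∫ x in Ioi (0 : ℝ), ((x ^ a : ℝ) : ℂ) * (u x * (starRingEnd ℂ) (v x)) :=
  integral_halfLineWeight a _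

theorem weightedInner_conj (a : ℝ) (u v : ℝ → ℂ) :
    (starRingEnd ℂ) (weightedInner a u v) = weightedInner a v u := by
  rw [weightedInner, weightedInner, ← integral_conj]
  refine integral_congr_ae (Eventually.of_forall fun x => ?_)
  simp [mul_comm]

theorem weightedInner_mul_rpow_mul_exp {ν lam : ℝ} (u : ℝ → ℂ) (q : ℝ[X]) :
    weightedInner (-ν) u (fun x => ((x ^ ν * Real.exp (-lam * x) * q.eval x : ℝ) : ℂ)) =
      ∫ x in Ioi (0 : ℝ), u x * ((q.eval x * Real.exp (-lam * x) : ℝ) : ℂ) := by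
  rw [weightedInner_eq_integral]
  refine setIntegral_congr_fun measurableSet_Ioi fun x hx => ?_
  have hx : 0 < x := hx
  have e : x ^ (-ν) * x ^ ν = 1 := by rw [← Real.rpow_add hx]; simp
  have e' : ((x ^ (-ν) : ℝ) : ℂ) * ((x ^ ν : ℝ) : ℂ) = 1 := by exact_mod_cast e
  simp only [Complex.conj_ofReal]
  simp only [Complex.ofReal_mul]
  linear_combination (u x * (Real.exp (-lam * x) : ℂ) * ((q.eval x : ℝ) : ℂ)) * e'

theorem weightedInner_memGLFSpace {ν lam : ℝ} (hν : 0 ≤ ν) (hl : 0 < lam) {u w : ℝ → ℂ}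
    (hu : MemWeightedL2 (-ν) u) {N : ℕ} {p : ℂ[X]} (hp : p.natDegree ≤ N)
    (hw : ∀ x : ℝ, 0 < x → w x = ((x ^ ν * Real.exp (-lam * x) : ℝ) : ℂ) * p.eval (x : ℂ)) :
    weightedInner (-ν) u w = ∑ n ∈ Finset.range (N + 1), (starRingEnd ℂ) (p.coeff n) *
      ∫ x in Ioi (0 : ℝ), u x * ((x ^ n * Real.exp (-lam * x) : ℝ) : ℂ) := by
  have hint : ∀ n : ℕ, IntegrableOn
      (fun x => u x * ((x ^ n * Real.exp (-lam * x) : ℝ) : ℂ)) (Ioi 0) := by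
    intro n
    have := hu.integrableOn_mul_expPoly hν hl (X ^ n)
    simpa using this
  simp only [← integral_const_mul]
  rw [weightedInner_eq_integral, ← integral_finsetSum]
  · refine setIntegral_congr_fun measurableSet_Ioi fun x hx => ?_
    have hx : 0 < x := hx
    have e : x ^ (-ν) * x ^ ν = 1 := by rw [← Real.rpow_add hx]; simp
    have e' : ((x ^ (-ν) : ℝ) : ℂ) * ((x ^ ν : ℝ) : ℂ) = 1 := by exact_mod_cast e
    rw [hw x hx, eval_eq_sum_range' (Nat.lt_succ_of_le hp), map_mul, map_sum, Finset.mul_sum,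
      Finset.mul_sum, Finset.mul_sum]
    refine Finset.sum_congr rfl fun n _ => ?_
    simp only [map_mul, map_pow, Complex.conj_ofReal, Complex.ofReal_mul, Complex.ofReal_pow]
    linear_combination (u x * (Real.exp (-lam * x) : ℂ) *
      ((starRingEnd ℂ) (p.coeff n)) * (x : ℂ) ^ n) * e'
  · intro n _
    exact (hint n).const_mul _

theorem memGLFSpace_of_real {ν lam : ℝ} {N : ℕ} {q : ℝ[X]} (hq : q.natDegree ≤ N) :
    MemGLFSpace ν lam N fun x => ((x ^ ν * Real.exp (-lam * x) * q.eval x : ℝ) : ℂ) := by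
  refine ⟨q.map (algebraMap ℝ ℂ), natDegree_map_le.trans hq, fun x _ => ?_⟩
  rw [eval_map_ofReal]
  push_cast; ring

theorem natDegree_le_of_mem_degreeLT_succ {n : ℕ} {p : ℝ[X]} (h : p ∈ degreeLT ℝ (n + 1)) :
    p.natDegree ≤ n := by
  rw [mem_degreeLT] at h
  by_cases h0 : p = 0
  · simp [h0]
  · exact Nat.lt_succ_iff.1 ((natDegree_lt_iff_degree_lt h0).2 h)

theorem natDegree_adjointPoly_X_pow_le {s lam : ℝ} (n : ℕ) :
    (adjointPoly s lam (X ^ n)).natDegree ≤ n :=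
  natDegree_le_of_mem_degreeLT_succ
    ((isTriangular_adjointPoly s lam).map_mem (X_pow_mem_degreeLT n.lt_succ_self))

theorem integral_congr_mul {u v : ℝ → ℂ} (h : u =ᵐ[volume.restrict (Ioi (0 : ℝ))] v)
    (g : ℝ → ℂ) : ∫ x in Ioi (0 : ℝ), u x * g x = ∫ x in Ioi (0 : ℝ), v x * g x := by
  refine integral_congr_ae ?_
  filter_upwards [h] with x hx
  rw [hx]

/-- The Petrov-Galerkin solution is the orthogonal projection of the solution. -/
theorem SolvesPetrovGalerkin.isGLFProjection {k : ℕ} (hk : 1 ≤ k) {s : ℝ} (hs : (k : ℝ) - 1 ≤ s)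
    (hsk : s < k) {lam : ℝ} (hl : 0 < lam) {N : ℕ} {f u uN : ℝ → ℂ} (hf : MemWeightedL2 0 f)
    (hu : SolvesTemperedIVP k s lam f u) (huN : SolvesPetrovGalerkin s lam N f uN) :
    IsGLFProjection s lam N u uN := by
  have hk' : (1 : ℝ) ≤ k := by exact_mod_cast hk
  have hs0 : 0 ≤ s := by linarith
  have hue := hu.ae_eq_temperedIntegral hk hs hsk (fun x => hf.integrableOn_exp_mul x)
  have hu2 : MemWeightedL2 (-s) u :=
    (memWeightedL2_temperedIntegral hs0 hl hf).congr hue.symm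
  obtain ⟨hmem, d, hd, hdv⟩ := huN
  have huN2 : MemWeightedL2 (-s) uN := hmem.memWeightedL2 hl (by linarith)
  obtain ⟨hd2, hdu⟩ := hmem.exists_polynomial hk hs hsk hl hd
  refine ⟨hu2, huN2, hmem, fun w hw => ?_⟩
  obtain ⟨p, hp, hwp⟩ := hw
  have hsub : MemWeightedL2 (-s) fun x => uN x - u x := MemLp.sub huN2 hu2
  rw [weightedInner_memGLFSpace hs0 hl hsub hp hwp]
  refine Finset.sum_eq_zero fun n hn => ?_
  rw [Finset.mem_range, Nat.lt_succ_iff] at hn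
  -- Moments of T f' are pairings of f' with e^{-λx} A(x^n), a test function since n ≤ N and A keeps
  -- the degree. This is applied to both u and u_N.
  have hpair : ∀ {f' u' : ℝ → ℂ}, MemWeightedL2 0 f' →
      u' =ᵐ[volume.restrict (Ioi (0 : ℝ))] temperedIntegral s lam f' →
      ∫ x in Ioi (0 : ℝ), u' x * ((x ^ n * Real.exp (-lam * x) : ℝ) : ℂ) =
        weightedInner 0 f' fun x => ((x ^ (0 : ℝ) * Real.exp (-lam * x) *
          (adjointPoly s lam (X ^ n)).eval x : ℝ) : ℂ) := by
    intro f' u' hf' hu'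
    have h1 := weightedInner_mul_rpow_mul_exp (ν := 0) (lam := lam) f' (adjointPoly s lam (X ^ n))
    rw [neg_zero] at h1
    rw [integral_congr_mul hu', h1, ← integral_temperedIntegral_mul hs0 hl hf']
    simp
  have hi1 := huN2.integrableOn_mul_expPoly hs0 hl (X ^ n)
  have hi2 := hu2.integrableOn_mul_expPoly hs0 hl (X ^ n)
  simp only [eval_pow, eval_X] at hi1 hi2
  simp only [sub_mul]
  rw [integral_sub hi1 hi2, hpair hd2 hdu, hpair hf hue, hdv _ (memGLFSpace_of_real
    ((natDegree_adjointPoly_X_pow_le n).trans hn)), sub_self, mul_zero]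

/-! ### Composition with derivatives of integer order -/

theorem LocallyIntegrableOn.congr_ae_Ioi {f g : ℝ → ℂ} (hf : LocallyIntegrableOn f (Ioi (0 : ℝ)))
    (h : f =ᵐ[volume.restrict (Ioi (0 : ℝ))] g) : LocallyIntegrableOn g (Ioi (0 : ℝ)) := by
  intro x hx
  obtain ⟨t, ht, hi⟩ := hf x hx
  refine ⟨t ∩ Ioi 0, inter_mem ht self_mem_nhdsWithin, ?_⟩
  refine (hi.mono_set inter_subset_left).congr ?_
  exact ae_restrict_of_ae_restrict_of_subset inter_subset_right h

theorem IsACChain.append {k m : ℕ} {w w' : ℕ → ℝ → ℂ} (hw : IsACChain k w) (hw' : IsACChain m w')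
    (h : w k =ᵐ[volume.restrict (Ioi (0 : ℝ))] w' 0) :
    IsACChain (k + m) fun j => if j < k then w j else w' (j - k) := by
  intro j hj
  rcases lt_trichotomy (j + 1) k with h1 | h1 | h1
  · simp only [h1, show j < k by omega, if_true]
    exact hw j (by omega)
  · simp only [show j < k by omega, if_true, if_false, h1, Nat.sub_self, lt_irrefl]
    have := hw j (by omega)
    rw [h1] at this
    refine ⟨LocallyIntegrableOn.congr_ae_Ioi this.1 h, fun a b ha hab => ?_⟩
    rw [this.2 a b ha hab]
    refine intervalIntegral.integral_congr_ae' ?_ ?_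
    · filter_upwards [(ae_restrict_iff' measurableSet_Ioi).1 h] with t ht ht'
      exact ht (ha.trans ht'.1)
    · filter_upwards [(ae_restrict_iff' measurableSet_Ioi).1 h] with t ht ht'
      exact ht ((ha.trans_le hab).trans ht'.1)
  · have h2 : ¬ j + 1 < k := by omega
    have h3 : ¬ j < k := by omega
    simp only [h2, h3, if_false, show j + 1 - k = j - k + 1 by omega]
    exact hw' (j - k) (by omega)

/-- The tempered derivatives of integer order as chains. -/
theorem HasTemperedDeriv.exists_chain {m : ℕ} {lam : ℝ} {f g : ℝ → ℂ}
    (h : HasTemperedDeriv m lam f g) : ∃ w, IsACChain m w ∧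
      w 0 =ᵐ[volume.restrict (Ioi (0 : ℝ))] (fun x => (Real.exp (lam * x) : ℂ) * f x) ∧
      w m =ᵐ[volume.restrict (Ioi (0 : ℝ))] (fun x => (Real.exp (lam * x) : ℂ) * g x) := by
  obtain ⟨hF, hder⟩ := h
  rw [Nat.floor_natCast, add_sub_cancel_left] at hder
  obtain ⟨w, h0, hm, hw⟩ := hder
  have hw : IsACChain (m + 1) w := hw
  -- At integer order m the definition differentiates I^1 a total of m + 1 times. The first
  -- differentiation recovers e^{λx} f, so the chain for f starts at index 1.
  refine ⟨fun j => w (j + 1), hw.succ, ?_, hm⟩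
  have h1 : HasACDeriv 1 (rlIntegral (1 : ℕ) fun x => (Real.exp (lam * x) : ℂ) * f x) (w 1) := by
    rw [Nat.cast_one]
    exact ⟨w, h0, EventuallyEq.rfl, fun j hj => hw j (by omega)⟩
  exact h1.unique (hasACDeriv_rlIntegral
    (integrableOn_Ioc_of_locallyIntegrableOn_Ici hF) le_rfl) EventuallyEq.rfl

/-- Adding an integer to s leaves the order of the fractional integral unchanged and only lengthens
the chain, so the two chains are concatenated. -/
theorem HasTemperedDeriv.add {s : ℝ} (hs : 0 ≤ s) {m : ℕ} {lam : ℝ} {u f g : ℝ → ℂ}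
    (h : HasTemperedDeriv s lam u f) (h' : HasTemperedDeriv m lam f g) :
    HasTemperedDeriv (s + m) lam u g := by
  obtain ⟨w', hw', h0', hm'⟩ := h'.exists_chain
  obtain ⟨hU, w, h0, hk, hw⟩ := h
  refine ⟨hU, ?_⟩
  rw [Nat.floor_add_natCast hs, show ((⌊s⌋₊ + m : ℕ) : ℝ) + 1 - (s + m) = ⌊s⌋₊ + 1 - s by
    push_cast; ring, show ⌊s⌋₊ + m + 1 = ⌊s⌋₊ + 1 + m by ring]
  refine ⟨fun j => if j < ⌊s⌋₊ + 1 then w j else w' (j - (⌊s⌋₊ + 1)), ?_, ?_,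
    IsACChain.append hw hw' (hk.trans h0'.symm)⟩
  · simpa using h0
  · simpa [show ¬ ⌊s⌋₊ + 1 + m ≤ ⌊s⌋₊ by omega] using hm'

/-! ### Coefficients, completeness and the error estimate -/

theorem inner_toLp_halfLineWeight {a : ℝ} {u v : ℝ → ℂ} (hu : MemWeightedL2 a u)
    (hv : MemWeightedL2 a v) :
    inner ℂ (MemLp.toLp u hu) (MemLp.toLp v hv) = weightedInner a v u := by
  rw [L2.inner_def, weightedInner]
  refine integral_congr_ae ?_
  filter_upwards [MemLp.coeFn_toLp hu, MemLp.coeFn_toLp hv] with x h1 h2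
  rw [h1, h2]
  simp

/-- The function `x ^ ν e^{-lam x} q(x)` of a real polynomial `q`. -/
def expPolyFun (ν lam : ℝ) (q : ℝ[X]) (x : ℝ) : ℂ :=
  ((x ^ ν * Real.exp (-lam * x) * q.eval x : ℝ) : ℂ)

theorem memWeightedL2_expPolyFun {a ν lam : ℝ} (hl : 0 < lam) (h : -1 < a + 2 * ν) (q : ℝ[X]) :
    MemWeightedL2 a (expPolyFun ν lam q) :=
  (memGLFSpace_of_real (le_refl q.natDegree)).memWeightedL2 hl h

theorem weightedInner_expPolyFun (a ν lam : ℝ) (p q : ℝ[X]) :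
    weightedInner a (expPolyFun ν lam p) (expPolyFun ν lam q) = ((∫ x in Ioi (0 : ℝ),
      x ^ (a + 2 * ν) * (p.eval x * q.eval x * Real.exp (-(2 * lam * x))) : ℝ) : ℂ) := by
  rw [weightedInner_eq_integral, ← integral_complex_ofReal]
  refine setIntegral_congr_fun measurableSet_Ioi fun x hx => ?_
  have hx : 0 < x := hx
  simp only [expPolyFun, Complex.conj_ofReal]
  rw [Real.rpow_add hx, two_mul, Real.rpow_add hx,
    show -(2 * lam * x) = -lam * x + -lam * x by ring, Real.exp_add]
  push_cast
  ring

/-- The factor between `orthPoly` and its image under the normal operator. -/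
def trialFactor (s lam : ℝ) (n : ℕ) : ℝ := (1 / (2 * lam)) ^ s * gammaRatio s n

/-- The weights combine to x^s, so the inner product is the moment form of p_i and A B p_j, and p_j
is an eigenvector of A B. This gives both orthogonality and norms. -/
theorem weightedInner_trialPoly {s lam : ℝ} (hs : 0 ≤ s) (hl : 0 < lam) (i j : ℕ) :
    weightedInner (-s) (expPolyFun s lam (trialPoly s (orthPoly lam i)))
      (expPolyFun s lam (trialPoly s (orthPoly lam j))) =
      ((trialFactor s lam j * expMoment lam (orthPoly lam i * orthPoly lam j) : ℝ) : ℂ) := by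
  rw [weightedInner_expPolyFun, show -s + 2 * s = s by ring, integral_rpow_mul_trialPoly hs hl,
    adjointPoly_trialPoly_orthPoly hs hl, mul_smul_comm, map_smul, smul_eq_mul, trialFactor]

/-- The factor between `orthPoly` and its image under the `m`-th derivative and its adjoint. -/
def derivFactor (lam : ℝ) (m n : ℕ) : ℝ := (2 * lam) ^ m * n.descFactorial m

theorem weightedInner_derivative {lam : ℝ} (hl : 0 < lam) (m i j : ℕ) :
    weightedInner m (expPolyFun 0 lam (derivative^[m] (orthPoly lam i)))
      (expPolyFun 0 lam (derivative^[m] (orthPoly lam j))) =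
      ((derivFactor lam m j * expMoment lam (orthPoly lam i * orthPoly lam j) : ℝ) : ℂ) := by
  have h := expMoment_mul_expDual_pow hl (orthPoly lam i) (derivative^[m] (orthPoly lam j)) m
  rw [expDual_pow_orthPoly hl, mul_smul_comm, map_smul, smul_eq_mul,
    expMoment_eq_integral hl (_ * _ * _)] at h
  rw [weightedInner_expPolyFun, derivFactor, h]
  simp only [mul_zero, add_zero, Real.rpow_natCast, eval_mul, eval_pow, eval_X]
  congr 2
  ext x
  ring

theorem norm_sq_toLp {a c : ℝ} {u : ℝ → ℂ} (hu : MemWeightedL2 a u)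
    (h : weightedInner a u u = (c : ℂ)) : ‖MemLp.toLp u hu‖ ^ 2 = c := by
  have h1 : inner ℂ (MemLp.toLp u hu) (MemLp.toLp u hu) = ((‖MemLp.toLp u hu‖ : ℝ) : ℂ) ^ 2 :=
    inner_self_eq_norm_sq_to_K (𝕜 := ℂ) _
  rw [inner_toLp_halfLineWeight, h] at h1
  exact_mod_cast h1.symm

/-- If v is orthogonal to all these functions, then q ↦ ∫ v e^{-λx} q kills every B p_n. As B is
triangular with nonzero diagonal, induction on the degree shows that it kills all polynomials, and
the moments determine v. -/
theorem dense_span_trialPoly {s lam : ℝ} (hs : 0 ≤ s) (hl : 0 < lam)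
    (hφ : ∀ n, MemWeightedL2 (-s) (expPolyFun s lam (trialPoly s (orthPoly lam n)))) :
    Dense (Submodule.span ℂ (range fun n => MemLp.toLp _ (hφ n)) :
      Set (Lp ℂ 2 (halfLineWeight (-s)))) := by
  rw [Submodule.dense_iff_topologicalClosure_eq_top, Submodule.topologicalClosure_eq_top_iff,
    Submodule.eq_bot_iff]
  intro v hv
  have hvm : MemWeightedL2 (-s) v := Lp.memLp v
  have hv0 : ∀ n, ∫ x in Ioi (0 : ℝ), v x *
      (((trialPoly s (orthPoly lam n)).eval x * Real.exp (-lam * x) : ℝ) : ℂ) = 0 := by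
    intro n
    rw [← weightedInner_mul_rpow_mul_exp (ν := s)]
    have := hv (MemLp.toLp _ (hφ n)) (Submodule.subset_span ⟨n, rfl⟩)
    rw [← Lp.toLp_coeFn v hvm, inner_toLp_halfLineWeight] at this
    exact this
  let ℓ : ℝ[X] →ₗ[ℝ] ℂ :=
    { toFun := fun q => ∫ x in Ioi (0 : ℝ), v x * ((q.eval x * Real.exp (-lam * x) : ℝ) : ℂ)
      map_add' := fun p q => by
        rw [← integral_add (hvm.integrableOn_mul_expPoly hs hl p)
          (hvm.integrableOn_mul_expPoly hs hl q)]
        congr 1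
        ext x
        rw [eval_add]; push_cast; ring
      map_smul' := fun c q => by
        rw [RingHom.id_apply, ← integral_smul]
        congr 1
        ext x
        rw [eval_smul, smul_eq_mul, Complex.real_smul]; push_cast; ring }
  have hℓ : ∀ n, ∀ q ∈ degreeLT ℝ n, ℓ q = 0 := by
    intro n
    induction n with
    | zero =>
      intro q hq
      have : q = 0 := iterate_derivative_eq_zero_of_mem hq
      rw [this, map_zero]
    | succ n ih =>
      have hX : ℓ (X ^ n) = 0 := by
        set A := trialPoly s (orthPoly lam n) with hA
        have h0 : ℓ A = 0 := hv0 n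
        have h1 := (isTriangular_trialPoly s).map_sub_mem (orthPoly_sub_mem hl n)
        have h2 := ih _ h1
        have h3 := ih _ (orthPoly_sub_mem hl n)
        rw [map_sub, ← hA, h0, map_smul, zero_sub, neg_eq_zero] at h2
        have h4 : ℓ (orthPoly lam n) = 0 := (smul_eq_zero.1 h2).resolve_left (gammaRatio_pos hs n).ne'
        rwa [map_sub, h4, zero_sub, neg_eq_zero] at h3
      intro q hq
      have hq' : q - q.coeff n • X ^ n ∈ degreeLT ℝ n := by
        rw [mem_degreeLT, degree_lt_iff_coeff_zero] at hq ⊢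
        intro i hi
        rcases hi.eq_or_lt with rfl | hi
        · simp
        · simp [hq i hi, coeff_X_pow, hi.ne']
      have := ih _ hq'
      rwa [map_sub, map_smul, hX, smul_zero, sub_zero] at this
  have hae := hvm.ae_eq_zero hs hl fun n => by
    have : ℓ (X ^ n) = 0 := hℓ (n + 1) _ (X_pow_mem_degreeLT n.lt_succ_self)
    simpa [ℓ] using this
  refine (Lp.eq_zero_iff_ae_eq_zero).2 (ae_halfLineWeight_iff.2 hae)

/-- The left side is (n-m)!/Γ(n+1+s). Consecutive values have the quotient (n+1-m)/(n+1+s) ≤ 1, so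
the largest occurs at n = N + 1. -/
theorem gammaRatio_div_descFactorial_le {s : ℝ} (hs : 0 ≤ s) {m N n : ℕ} (hm : m ≤ N + 1)
    (hn : N + 1 ≤ n) : gammaRatio s n / n.descFactorial m ≤
      (N + 1 - m).factorial / Real.Gamma (N + 2 + s) := by
  have key : ((n - m).factorial : ℝ) / Real.Gamma (n + 1 + s) ≤
      (N + 1 - m).factorial / Real.Gamma (N + 2 + s) := by
    induction n, hn using Nat.le_induction with
    | base =>
      push_cast
      rw [show (N : ℝ) + 1 + 1 + s = N + 2 + s by ring]
    | succ n hn ih =>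
      refine le_trans ?_ ih
      rw [Nat.succ_sub (hm.trans hn), Nat.factorial_succ]
      push_cast
      rw [show (n : ℝ) + 1 + 1 + s = n + 1 + s + 1 by ring,
        Real.Gamma_add_one (by positivity : (n : ℝ) + 1 + s ≠ 0), mul_div_mul_comm]
      refine mul_le_of_le_one_left (div_nonneg (by positivity)
        (Real.Gamma_pos_of_pos (by positivity)).le) ?_
      rw [div_le_one (by positivity)]
      have : ((n - m : ℕ) : ℝ) ≤ n := by exact_mod_cast Nat.sub_le n m
      linarith
  refine le_trans (le_of_eq ?_) key
  rw [gammaRatio, ← Nat.factorial_mul_descFactorial (hm.trans hn), Nat.cast_mul]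
  have h1 : (n.descFactorial m : ℝ) ≠ 0 := by
    exact_mod_cast (Nat.descFactorial_pos.2 (hm.trans hn)).ne'
  field_simp

theorem sq_errorConst_mul_rpow {s lam : ℝ} (hs : 0 ≤ s) (hl : 0 < lam) {m N : ℕ} (hN : 1 ≤ N) :
    (errorConst s m N * (2 * lam * N) ^ (-(s + m) / 2)) ^ 2 =
      (2 * lam) ^ (-(s + m)) * ((N + 1 - m).factorial / Real.Gamma (N + 2 + s)) := by
  have hN' : (0 : ℝ) < N := by exact_mod_cast hN
  have hΓ : 0 < Real.Gamma (N + 2 + s) := Real.Gamma_pos_of_pos (by positivity)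
  rw [mul_pow, errorConst, Real.sq_sqrt (by positivity), ← Real.rpow_natCast (_ ^ _),
    ← Real.rpow_mul (by positivity)]
  rw [show -(s + m) / 2 * ((2 : ℕ) : ℝ) = -(s + m) by push_cast; ring,
    Real.mul_rpow (by positivity) hN'.le, Real.rpow_neg hN'.le]
  have : (N : ℝ) ^ (s + m) ≠ 0 := (Real.rpow_pos_of_pos hN' _).ne'
  field_simp

theorem trialFactor_div_derivFactor_le {s lam : ℝ} (hs : 0 ≤ s) (hl : 0 < lam) {m N n : ℕ}
    (hN : 1 ≤ N) (hm : m ≤ N + 1) (hn : N + 1 ≤ n) : trialFactor s lam n / derivFactor lam m n ≤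
      (errorConst s m N * (2 * lam * N) ^ (-(s + m) / 2)) ^ 2 := by
  rw [sq_errorConst_mul_rpow hs hl hN, trialFactor, derivFactor, mul_div_mul_comm]
  have e : (1 / (2 * lam)) ^ s / (2 * lam) ^ m = (2 * lam) ^ (-(s + m)) := by
    rw [one_div, Real.inv_rpow (by positivity), Real.rpow_neg (by positivity),
      Real.rpow_add (by positivity), Real.rpow_natCast, mul_inv, div_eq_mul_inv]
  rw [e]
  exact mul_le_mul_of_nonneg_left (gammaRatio_div_descFactorial_le hs hm hn)
    (Real.rpow_nonneg (by positivity) _)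

/-- Integrating by parts m times moves the derivatives from f to x^m p_n^{(m)}, and the eigenvector
relation turns the result back into p_n. -/
theorem weightedInner_derivative_eq {lam : ℝ} (hl : 0 < lam) {m : ℕ} {f g : ℝ → ℂ}
    (hg : MemWeightedL2 m g) (h : HasTemperedDeriv m lam f g) (n : ℕ) :
    weightedInner m g (expPolyFun 0 lam (derivative^[m] (orthPoly lam n))) =
      (derivFactor lam m n : ℂ) *
        ∫ x in Ioi (0 : ℝ), f x * (((orthPoly lam n).eval x * Real.exp (-lam * x) : ℝ) : ℂ) := by
  obtain ⟨w, hw, h0, hm⟩ := h.exists_chain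
  have hexp : ∀ x, ((Real.exp (-(2 * lam * x)) : ℝ) : ℂ) * ((Real.exp (lam * x) : ℝ) : ℂ) =
      ((Real.exp (-lam * x) : ℝ) : ℂ) := by
    intro x
    rw [← Complex.ofReal_mul, ← Real.exp_add]
    congr 2; ring
  -- w m is e^{λx} g, so a rate μ > λ leaves e^{-(μ-λ)x} to pair with g in the space with weight
  -- x^m.
  have hE : ExpIntegrable lam m (w m) := by
    intro μ hμ
    have h1 := hg.integrableOn_mul_exp (ν := 0) (sub_pos.2 hμ)
      (by rw [mul_zero, add_zero]; linarith [(Nat.cast_nonneg m : (0 : ℝ) ≤ m)]) 1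
    refine IntegrableOn.congr_fun_ae h1 ?_
    filter_upwards [hm] with x hx
    rw [hx, add_zero, Real.rpow_natCast, eval_one, mul_one,
      show -(μ - lam) * x = -(μ * x) + lam * x by ring, Real.exp_add]
    push_cast; ring
  have key := hw.integral_mul_expDual_pow hl hE (derivative^[m] (orthPoly lam n))
  rw [expDual_pow_orthPoly hl] at key
  calc _ = ∫ x in Ioi (0 : ℝ), (((X ^ m * derivative^[m] (orthPoly lam n)).eval x *
          Real.exp (-(2 * lam * x)) : ℝ) : ℂ) * w m x := by
        rw [weightedInner_eq_integral]
        refine integral_congr_ae ?_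
        filter_upwards [hm] with x hx
        rw [hx, expPolyFun, Complex.conj_ofReal, eval_mul, eval_pow, eval_X, Real.rpow_natCast,
          Real.rpow_zero]
        simp only [Complex.ofReal_mul, Complex.ofReal_pow, Complex.ofReal_one]
        rw [← hexp x]
        ring
    _ = _ := by
        rw [← key, ← integral_const_mul]
        refine integral_congr_ae ?_
        filter_upwards [h0] with x hx
        rw [hx, eval_smul, smul_eq_mul]
        change ((derivFactor lam m n * _ * _ : ℝ) : ℂ) * _ = _
        simp only [Complex.ofReal_mul]
        rw [← hexp x]
        ring

theorem weightedInner_trialPoly_eq {s lam : ℝ} (hs : 0 ≤ s) (hl : 0 < lam) {f u : ℝ → ℂ}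
    (hf : MemWeightedL2 0 f)
    (hu : u =ᵐ[volume.restrict (Ioi (0 : ℝ))] temperedIntegral s lam f) (n : ℕ) :
    weightedInner (-s) u (expPolyFun s lam (trialPoly s (orthPoly lam n))) =
      (trialFactor s lam n : ℂ) *
        ∫ x in Ioi (0 : ℝ), f x * (((orthPoly lam n).eval x * Real.exp (-lam * x) : ℝ) : ℂ) := by
  refine (weightedInner_mul_rpow_mul_exp u _).trans ?_
  rw [integral_congr_mul hu, integral_temperedIntegral_mul hs hl hf,
    adjointPoly_trialPoly_orthPoly hs hl, ← integral_const_mul]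
  congr 1
  ext x
  rw [eval_smul, smul_eq_mul]
  change _ * ((trialFactor s lam n * _ * _ : ℝ) : ℂ) = _
  simp only [Complex.ofReal_mul]
  ring

/-- The trial functions of index above `N` are orthogonal to the trial space of degree `N`. -/
theorem weightedInner_trialPoly_eq_zero {s lam : ℝ} (hs : 0 ≤ s) (hl : 0 < lam) {N n : ℕ}
    (hn : N < n) {w : ℝ → ℂ} (hw : MemGLFSpace s lam N w) :
    weightedInner (-s) w (expPolyFun s lam (trialPoly s (orthPoly lam n))) = 0 := by
  obtain ⟨p, hp, hw⟩ := hw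
  rw [← weightedInner_conj, weightedInner_memGLFSpace hs hl
    (memWeightedL2_expPolyFun hl (by linarith) _) hp hw, Finset.sum_eq_zero, map_zero]
  intro j hj
  rw [Finset.mem_range] at hj
  have h := integral_rpow_mul_trialPoly hs hl (orthPoly lam n) (X ^ j)
  rw [expMoment_orthPoly_mul hl ((isTriangular_adjointPoly s lam).map_mem
    (X_pow_mem_degreeLT (by omega)))] at h
  have h' : ∫ x in Ioi (0 : ℝ), expPolyFun s lam (trialPoly s (orthPoly lam n)) x *
      ((x ^ j * Real.exp (-lam * x) : ℝ) : ℂ) = ((0 : ℝ) : ℂ) := by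
    refine Eq.trans ?_ (congrArg Complex.ofReal h)
    rw [← integral_complex_ofReal]
    congr 1
    ext x
    rw [expPolyFun, show -(2 * lam * x) = -lam * x + -lam * x by ring, Real.exp_add, eval_pow,
      eval_X]
    push_cast; ring
  rw [h', Complex.ofReal_zero, mul_zero]

theorem IsGLFProjection.weightedNorm_sub_le {s lam : ℝ} (hs : 0 ≤ s) (hl : 0 < lam) {m N : ℕ}
    (hN : 1 ≤ N) (hm : m ≤ N + 1) {f g u uN : ℝ → ℂ} (hf : MemWeightedL2 0 f)
    (hfg : HasTemperedDeriv m lam f g) (hg : MemWeightedL2 m g)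
    (hu : u =ᵐ[volume.restrict (Ioi (0 : ℝ))] temperedIntegral s lam f)
    (h : IsGLFProjection s lam N u uN) : weightedNorm (-s) (fun x => u x - uN x) ≤
      errorConst s m N * (2 * lam * N) ^ (-(s + m) / 2) * weightedNorm m g := by
  obtain ⟨hu2, huN2, hmem, horth⟩ := h
  have he : MemWeightedL2 (-s) fun x => u x - uN x := MemLp.sub hu2 huN2
  have hφ : ∀ n, MemWeightedL2 (-s) (expPolyFun s lam (trialPoly s (orthPoly lam n))) :=
    fun n => memWeightedL2_expPolyFun hl (by linarith) _
  have hψ : ∀ n, MemWeightedL2 m (expPolyFun 0 lam (derivative^[m] (orthPoly lam n))) :=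
    fun n => memWeightedL2_expPolyFun hl
      (by rw [mul_zero, add_zero]; linarith [(Nat.cast_nonneg m : (0 : ℝ) ≤ m)]) _
  have hκ : 0 ≤ errorConst s m N * (2 * lam * N) ^ (-(s + m) / 2) :=
    mul_nonneg (Real.sqrt_nonneg _) (Real.rpow_nonneg (by positivity) _)
  have hτ : ∀ n, N < n → 0 < derivFactor lam m n := fun n hn =>
    mul_pos (by positivity) (by exact_mod_cast Nat.descFactorial_pos.2 (by omega))
  have hφn := fun n => norm_sq_toLp (hφ n) (weightedInner_trialPoly hs hl n n)
  have hψn := fun n => norm_sq_toLp (hψ n) (weightedInner_derivative hl m n n)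
  have hsub : ∀ n, weightedInner (-s) (fun x => u x - uN x)
      (expPolyFun s lam (trialPoly s (orthPoly lam n))) =
      weightedInner (-s) u (expPolyFun s lam (trialPoly s (orthPoly lam n))) -
      weightedInner (-s) uN (expPolyFun s lam (trialPoly s (orthPoly lam n))) := by
    intro n
    simp only [← inner_toLp_halfLineWeight (hφ n) he, ← inner_toLp_halfLineWeight (hφ n) hu2,
      ← inner_toLp_halfLineWeight (hφ n) huN2]
    rw [← inner_sub_right]
    rfl
  have main := norm_le_of_inner_eq_mul_inner (fun n => MemLp.toLp _ (hφ n))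
    (fun n => MemLp.toLp _ (hψ n)) (fun i j hij => ?_) (fun i j hij => ?_)
    (dense_span_trialPoly hs hl hφ) (MemLp.toLp _ he) (MemLp.toLp _ hg)
    -- The error is orthogonal to the trial space, whence 0 for n ≤ N. For n > N the coefficient of
    -- u_N vanishes, and m ≤ N + 1 ensures n ≥ m, so the denominator is positive.
    (fun n => if n ≤ N then 0 else trialFactor s lam n / derivFactor lam m n) _ hκ
    (fun n => ?_) (fun n => ?_)
  · have e1 : ‖MemLp.toLp _ he‖ = weightedNorm (-s) _ := Lp.norm_toLp _ _
    have e2 : ‖MemLp.toLp _ hg‖ = weightedNorm m g := Lp.norm_toLp _ _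
    rwa [e1, e2] at main
  · rw [inner_toLp_halfLineWeight, weightedInner_trialPoly hs hl,
      expMoment_orthPoly_mul_orthPoly hl hij.symm, mul_zero, Complex.ofReal_zero]
  · rw [inner_toLp_halfLineWeight, weightedInner_derivative hl,
      expMoment_orthPoly_mul_orthPoly hl hij.symm, mul_zero, Complex.ofReal_zero]
  · rw [inner_toLp_halfLineWeight, inner_toLp_halfLineWeight]
    split_ifs with hn
    · have hq : (trialPoly s (orthPoly lam n)).natDegree ≤ N :=
        natDegree_le_of_mem_degreeLT_succ ((isTriangular_trialPoly s).map_mem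
          (orthPoly_mem hl (Nat.lt_succ_of_le hn)))
      have h1 := horth _ (memGLFSpace_of_real hq)
      have h2 : weightedInner (-s) (fun x => u x - uN x)
          (expPolyFun s lam (trialPoly s (orthPoly lam n))) =
          -weightedInner (-s) (fun x => uN x - u x)
          (expPolyFun s lam (trialPoly s (orthPoly lam n))) := by
        rw [weightedInner, weightedInner, ← integral_neg]
        congr 1
        ext x
        ring
      rw [h2]
      erw [h1]
      simp
    · rw [hsub, weightedInner_trialPoly_eq_zero hs hl (not_le.1 hn) hmem, sub_zero,
        weightedInner_trialPoly_eq hs hl hf hu, weightedInner_derivative_eq hl hg hfg, ← mul_assoc,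
        ← Complex.ofReal_mul, div_mul_cancel₀ _ (hτ n (not_le.1 hn)).ne']
  · split_ifs with hn
    · rw [zero_pow two_ne_zero, zero_mul]; positivity
    · have h1 := trialFactor_div_derivFactor_le hs hl hN hm (not_le.1 hn)
      -- With r = σ_n/τ_n and squared norms σ_n h_n and τ_n h_n, one has r² τ_n h_n = r σ_n h_n. So
      -- the bound involves r itself, and κ is the square root of a bound for r.
      calc _ = trialFactor s lam n / derivFactor lam m n * ‖MemLp.toLp _ (hφ n)‖ ^ 2 := by
            rw [hφn, hψn]
            have := (hτ n (not_le.1 hn)).ne'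
            field_simp
        _ ≤ _ := mul_le_mul_of_nonneg_right h1 (by positivity)

end

theorem mainTheorem5 (k : ℕ) (hk : 1 ≤ k) (s : ℝ) (hs : (k : ℝ) - 1 ≤ s) (hsk : s < k) :
    (∀ (lam : ℝ) (N : ℕ) (f u uN : ℝ → ℂ), 0 < lam →
      MemWeightedL2 0 f →
      SolvesTemperedIVP k s lam f u →
      SolvesPetrovGalerkin s lam N f uN →
        IsGLFProjection s lam N u uN) ∧
    ∀ m : ℕ, ∃ c : ℕ → ℝ, Tendsto c atTop (𝓝 1) ∧
      ∀ (lam : ℝ) (N : ℕ) (f g u uN : ℝ → ℂ), 0 < lam → 1 ≤ N → m ≤ N + 1 →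
        MemWeightedL2 0 f →
        HasTemperedDeriv m lam f g →
        MemWeightedL2 m g →
        SolvesTemperedIVP k s lam f u →
        SolvesPetrovGalerkin s lam N f uN →
          HasTemperedDeriv (s + m) lam u g ∧
          weightedNorm (-s) (fun x => u x - uN x) ≤
            c N * (2 * lam * N) ^ (-(s + m) / 2) * weightedNorm m g := by
  have hs0 : 0 ≤ s := by
    have : (1 : ℝ) ≤ k := by exact_mod_cast hk
    linarith
  refine ⟨fun lam N f u uN hl hf hu huN => huN.isGLFProjection hk hs hsk hl hf hu, fun m =>
    ⟨errorConst s m, tendsto_errorConst hs0 m, ?_⟩⟩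
  intro lam N f g u uN hl hN hm hf hfg hg hu huN
  exact ⟨hu.1.add hs0 hfg, (huN.isGLFProjection hk hs hsk hl hf hu).weightedNorm_sub_le hs0 hl hN hm
    hf hfg hg (hu.ae_eq_temperedIntegral hk hs hsk fun x => hf.integrableOn_exp_mul x)⟩
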